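/- Let $K$ be a field and $A$ an associative unital $K$-algebra; modules are left modules unless said otherwise, and $A$-bimodules are modules over $A\otimes_K A^{op}$. Suppose that $A$ is $2$-Calabi-Yau, that is, the bimodule $A$ has a finite resolution by finitely generated projective $A$-bimodules, and $\mathrm{RHom}_{AA}(A,A\otimes_K A)\cong A[-2]$ in the derived category of $A$-bimodules (bimodule homomorphisms are taken with respect to the outer bimodule structure $b(a\otimes a')c=ba\otimes a'c$, and the bimodule structure on $\mathrm{RHom}$ comes from the inner one, in which $b$ on the left and $c$ on the right send $a\otimes a'$ to $ac\otimes ba'$). For a ring $R$ and an $R$-module $M$ let $\mathrm{add}\,M$ be the class of modules isomorphic to a direct summand of a finite direct sum of copies of $M$. An $R$-module $T$ is partial tilting if there is an exact sequence $0\to P_1\to P_0\to T\to 0$ with $P_0,P_1\in\mathrm{add}\,R$ and $\mathrm{Ext}^i_R(T,T)=0$ for all $i>0$; it is tilting if moreover there is an exact sequence $0\to R\to T_0\to T_1\to 0$ with $T_0,T_1\in\mathrm{add}\,T$. A tilting ideal of $A$ is a two-sided ideal that is a tilting module both as a left and as a right $A$-module. Let $\mathcal S$ be a set of finite-dimensional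 simple $A$-modules $S$ that are rigid, i.e. $\mathrm{Ext}^1_A(S,S)=0$. Let $\mathcal E(\mathcal S)$ be the class of finite-dimensional $A$-modules all of whose composition factors are isomorphic to members of $\mathcal S$. For $S\in\mathcal S$ let $I_S=\{a\in A\mid aS=0\}$, and let $\mathcal I(\mathcal S)$ be the set of all products $I_{S_1}I_{S_2}\cdots I_{S_r}$ with $r\ge 0$ and $S_1,\dots,S_r\in\mathcal S$, where the empty product is $A$. Then: 1. Every $I\in\mathcal I(\mathcal S)$ is a tilting ideal with $A/I\in\mathcal E(\mathcal S)$ and $\mathrm{End}_A(I)=A$, in the sense that right multiplication gives a ring isomorphism from $A^{op}$ to the endomorphism ring of the left module $I$, and left multiplication gives a ring isomorphism from $A$ to the endomorphism ring of the right module $I$. 2. Conversely, every left ideal $I$ of $A$ that is a partial tilting left module and satisfies $A/I\in\mathcal E(\mathcal S)$ belongs to $\mathcal I(\mathcal S)$. 3. If $I,I'\in\mathcal I(\mathcal S)$ are isomorphic as left $A$-modules, then $I=I'$. -/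

import Mathlib

open CategoryTheory

open scoped TensorProduct

universe u v

noncomputable section

namespace CYTilting

/-! ### Bimodules and the Calabi-Yau property -/

section Bimodules

variable (K : Type v) [Field K] (A : Type u) [Ring A] [Algebra K A]

/-- The enveloping algebra `A ⊗ Aᵒᵖ`. Its left modules are the `A`-bimodules on which the two
actions of `K` agree: `a ⊗ op b` acts as `m ↦ a m b`. -/
abbrev Env : Type u := A ⊗[K] Aᵐᵒᵖ

/-- The bimodule `A`, with `(a ⊗ op b) • x = a * x * b`. -/
def diagonal : ModuleCat.{u} (Env K A) :=
  letI : Module (Env K A) A := instModuleTensorProductMop K A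
  ModuleCat.of (Env K A) A

/-- The anti-automorphism `a ⊗ op b ↦ b ⊗ op a` of the enveloping algebra. -/
def envSwap : Env K A ≃ₐ[K] (Env K A)ᵐᵒᵖ :=
  ((Algebra.TensorProduct.comm K A Aᵐᵒᵖ).trans
    (Algebra.TensorProduct.congr AlgEquiv.refl (AlgEquiv.opOp K A))).trans
      (Algebra.TensorProduct.opAlgEquiv K K A Aᵐᵒᵖ)

theorem envSwap_tmul (a : A) (b : Aᵐᵒᵖ) :
    envSwap K A (a ⊗ₜ b) = MulOpposite.op (b.unop ⊗ₜ MulOpposite.op a) := rfl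

/-- For a bimodule `M`, the space of bimodule homomorphisms from `M` to `A ⊗ A`, where `A ⊗ A`
(identified with `Env K A` through `a ⊗ a' ↔ a ⊗ op a'`) has the outer bimodule structure. -/
def BimodDual (M : ModuleCat.{u} (Env K A)) : Type u := M →ₗ[Env K A] Env K A

instance (M : ModuleCat.{u} (Env K A)) : AddCommGroup (BimodDual K A M) :=
  inferInstanceAs (AddCommGroup (M →ₗ[Env K A] Env K A))

/-- The bimodule structure on `BimodDual K A M` given by the inner actions on `A ⊗ A`:
`(b f c)(m) = ∑ aᵢ c ⊗ b aᵢ'` if `f m = ∑ aᵢ ⊗ aᵢ'`. In `Env K A` this is right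
multiplication by `c ⊗ op b`. -/
instance (M : ModuleCat.{u} (Env K A)) : Module (Env K A) (BimodDual K A M) :=
  Module.compHom (M →ₗ[Env K A] Env K A) (envSwap K A).toRingEquiv.toRingHom

theorem BimodDual.smul_apply (M : ModuleCat.{u} (Env K A)) (e : Env K A)
    (f : BimodDual K A M) (m : M) :
    (show M →ₗ[Env K A] Env K A from e • f) m =
      (show M →ₗ[Env K A] Env K A from f) m * (envSwap K A e).unop := rfl

/-- Precomposition with a bimodule homomorphism. -/
def BimodDual.map {M N : ModuleCat.{u} (Env K A)} (g : M ⟶ N) :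
    BimodDual K A N →ₗ[Env K A] BimodDual K A M where
  toFun f := LinearMap.comp (show N →ₗ[Env K A] Env K A from f) g.hom
  map_add' _ _ := rfl
  map_smul' _ _ := rfl

/-- The cochain complex of bimodules `Hom(P₀, A ⊗ A) → Hom(P₁, A ⊗ A) → ⋯`, placed in
degrees `0, 1, …`, of a chain complex `P` of bimodules. -/
def dualComplex (P : ChainComplex (ModuleCat.{u} (Env K A)) ℕ) :
    CochainComplex (ModuleCat.{u} (Env K A)) ℕ where
  X n := ModuleCat.of (Env K A) (BimodDual K A (P.X n))
  d i j := ModuleCat.ofHom (BimodDual.map K A (P.d j i))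
  shape i j h := by
    rw [P.shape j i h]
    ext f
    exact LinearMap.comp_zero _
  d_comp_d' i j k _ _ := by
    ext f
    change LinearMap.comp (LinearMap.comp _ (P.d j i).hom) (P.d k j).hom = 0
    rw [LinearMap.comp_assoc, ← ModuleCat.hom_comp, P.d_comp_d]
    exact LinearMap.comp_zero _

/-- `RHom(A, A ⊗ A)` in the derived category of bimodules, computed by means of a projective
resolution of the bimodule `A`. -/
def rHomDiagonal [HasDerivedCategory (ModuleCat.{u} (Env K A))]
    (P : ProjectiveResolution (diagonal K A)) :
    DerivedCategory (ModuleCat.{u} (Env K A)) :=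
  DerivedCategory.Q.obj ((dualComplex K A P.complex).extend ComplexShape.embeddingUpNat)

/-- A projective resolution of finite length by finitely generated modules. -/
def IsPerfectResolution {R : Type u} [Ring R] {M : ModuleCat.{u} R}
    (P : ProjectiveResolution M) : Prop :=
  (∀ n, Module.Finite R (P.complex.X n)) ∧
    ∃ N : ℕ, ∀ n, N < n → Limits.IsZero (P.complex.X n)

/-- `A` is `d`-Calabi-Yau: it is homologically smooth, that is, the bimodule `A` has a finite
resolution by finitely generated projective bimodules, and `RHom(A, A ⊗ A) ≅ A[-d]` in the
derived category of bimodules (`A[-d]` is `A` placed in cohomological degree `d`). -/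
def IsCalabiYau (d : ℕ) : Prop :=
  letI : HasDerivedCategory (ModuleCat.{u} (Env K A)) := HasDerivedCategory.standard _
  ∃ P : ProjectiveResolution (diagonal K A), IsPerfectResolution P ∧
    Nonempty (rHomDiagonal K A P ≅
      (DerivedCategory.singleFunctor (ModuleCat.{u} (Env K A)) (d : ℤ)).obj (diagonal K A))

end Bimodules

/-! ### Tilting modules and tilting ideals -/

section Tilting

variable (R : Type u) [Ring R]

/-- `X ∈ add M`: the module `X` is isomorphic to a direct summand of a finite direct sum of
copies of `M`. -/
def InAdd (M X : Type u) [AddCommGroup M] [Module R M] [AddCommGroup X] [Module R X] : Prop :=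
  ∃ (n : ℕ) (i : X →ₗ[R] (Fin n → M)) (p : (Fin n → M) →ₗ[R] X), p ∘ₗ i = LinearMap.id

/-- A partial (1-)tilting module: there is an exact sequence `0 → P₁ → P₀ → T → 0` with
`P₀, P₁ ∈ add R`, and `Extⁱ(T, T) = 0` for all `i > 0`. -/
structure IsPartialTilting (T : Type u) [AddCommGroup T] [Module R T] : Prop where
  resolution : ∃ (P₁ P₀ : ModuleCat.{u} R) (f : P₁ →ₗ[R] P₀) (g : P₀ →ₗ[R] T),
    InAdd R R P₁ ∧ InAdd R R P₀ ∧
      Function.Injective f ∧ Function.Exact f g ∧ Function.Surjective g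
  ext_eq_zero : ∀ i : ℕ, 0 < i →
    Subsingleton (Abelian.Ext (ModuleCat.of R T) (ModuleCat.of R T) i)

/-- A (1-)tilting module: a partial tilting module `T` for which there is an exact sequence
`0 → R → T₀ → T₁ → 0` with `T₀, T₁ ∈ add T`. -/
structure IsTilting (T : Type u) [AddCommGroup T] [Module R T] : Prop
    extends IsPartialTilting R T where
  coresolution : ∃ (T₀ T₁ : ModuleCat.{u} R) (f : R →ₗ[R] T₀) (g : T₀ →ₗ[R] T₁),
    InAdd R T T₀ ∧ InAdd R T T₁ ∧
      Function.Injective f ∧ Function.Exact f g ∧ Function.Surjective g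

variable {R}

/-- A two-sided ideal, as a submodule of the right `R`-module `R`. Right `R`-modules are
modules over `Rᵐᵒᵖ`. -/
def asRight (I : Ideal R) (h : I.IsTwoSided) : Submodule Rᵐᵒᵖ R where
  carrier := I
  add_mem' := I.add_mem
  zero_mem' := I.zero_mem
  smul_mem' b _ hx := h.mul_mem_of_left b.unop hx

/-- A tilting ideal: a two-sided ideal that is a tilting module both as a left module and as a
right module. -/
def IsTiltingIdeal (I : Ideal R) : Prop :=
  ∃ h : I.IsTwoSided, IsTilting R I ∧ IsTilting Rᵐᵒᵖ (asRight I h)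

/-- `End(I) = R`: right multiplications identify `Rᵒᵖ` with the endomorphism ring of the left
module `I`, and left multiplications identify `R` with the endomorphism ring of the right
module `I`. -/
def EndEqSelf (I : Ideal R) : Prop :=
  ∃ h : I.IsTwoSided,
    (∃ e : Rᵐᵒᵖ ≃+* Module.End R I,
      ∀ (a : R) (x : I), (e (MulOpposite.op a) x : R) = x * a) ∧
    (∃ e : R ≃+* Module.End Rᵐᵒᵖ (asRight I h),
      ∀ (a : R) (x : asRight I h), (e a x : R) = a * x)

end Tilting

/-! ### Finite-dimensional modules, rigid simple modules and products of annihilators -/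

section Simples

variable (K : Type v) [Field K] {A : Type u} [Ring A] [Algebra K A]

/-- An `A`-module that has finite dimension over `K`. -/
def FinDim (A : Type u) [Ring A] [Algebra K A] (M : Type u) [AddCommGroup M] [Module A M] : Prop :=
  Module.Finite K (RestrictScalars K A M)

/-- A finite-dimensional simple module `S` with `Ext¹(S, S) = 0`. -/
structure IsFinDimRigidSimple (S : ModuleCat.{u} A) : Prop where
  simple : IsSimpleModule A S
  finDim : FinDim K A S
  rigid : Subsingleton (Abelian.Ext S S 1)

/-- `M ∈ ℰ(𝒮)`: the module `M` is finite-dimensional and each of its composition factors (its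
subquotients `N' / N` for submodules `N < N'` with nothing in between) is isomorphic to a member
of `𝒮`. -/
def InSerre (𝒮 : Set (ModuleCat.{u} A)) (M : Type u) [AddCommGroup M] [Module A M] : Prop :=
  FinDim K A M ∧ ∀ N N' : Submodule A M, N ⋖ N' →
    ∃ S : ModuleCat.{u} A, S ∈ 𝒮 ∧ Nonempty ((N' ⧸ N.submoduleOf N') ≃ₗ[A] S)

/-- The product `I_{S₁} I_{S₂} ⋯ I_{Sᵣ}` of the annihilators of the modules in a list; it is `A`
for the empty list. -/
def annProd (l : List (ModuleCat.{u} A)) : Ideal A :=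
  l.foldr (fun (S : ModuleCat.{u} A) (J : Ideal A) => Module.annihilator A S * J) ⊤

/-- The set `ℐ(𝒮)` of all products of annihilators of finite sequences in `𝒮`. -/
def annProducts (𝒮 : Set (ModuleCat.{u} A)) : Set (Ideal A) :=
  {I | ∃ l : List (ModuleCat.{u} A), (∀ S ∈ l, S ∈ 𝒮) ∧ annProd l = I}

end Simples

end CYTilting

end

/-! The Calabi-Yau hypothesis enters only through five consequences for a finite-dimensional module
M, collected in `HasCYDuality`: M has a resolution of length two by finitely generated projectives;
Hom(M, A) = 0; Ext¹(M, A) = 0; Ext²(M, N) = 0 forces Hom(N, M) = 0; and Ext²(M, N) → Ext²(M, N') is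
injective as soon as every map N → M factors through N → N'. The last two are what is needed of the
duality Ext²(M, N)* ≅ Hom(N, M). They come from a bimodule resolution of length two whose dual again
resolves A. By it the second Hochschild cohomology of a bimodule X is X/[A, X]
(`CYResolution.exists_trace`); for X = Hom_K(M, N) this is Ext²(M, N), and the trace pairs it with
Hom_A(N, M). For X = Hom_K(M, A) ≅ A ⊗ M* the cohomology in degrees 0 and 1 vanishes by dimension
shifting in the right module M*. The same resolution serves the opposite algebra.

Let T be a left ideal of finite codimension. It has projective dimension at most one, and since Hom
and Ext¹ from A/T to A vanish, every map T → A is right multiplication by a unique element. So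
End(I) = A for two-sided I of finite codimension, and an isomorphism I → I' has the form x ↦ xa,
whence I' = Ia ⊆ I; by symmetry I = I'. Moreover T is partial tilting once Ext¹(T, T) = 0; call it
rigid then (`IsCofiniteRigid`).

For a rigid simple S, A/I_S lies in add S, so maps I_S → S extend to A and are therefore zero; hence
I_S² = I_S. If I is two-sided and idempotent of finite codimension and T is rigid, then IT is rigid
(`HasCYDuality.ext_one_mul`). Building a product from its right end gives rigidity on the left,
building it from its left end gives rigidity on the right. The tilting coresolution on one side is
Hom(-, I) applied to the projective resolution on the other side, because End(I) = A.

Conversely let T be rigid and T ≠ A. Since Ext²(A/T, T) comes from Ext¹(T, T) = 0, duality gives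
Hom(T, A/T) = 0. Choose a simple S inside A/T. Then Hom(T, S) = 0 forces T = I_S T₁ with T₁ = {a |
I_S a ⊆ T}. The ideal T₁ is again rigid (`HasCYDuality.isCofiniteRigid_leftColon`) and strictly
larger than T, so induction on the codimension finishes the proof. -/

open CategoryTheory
open scoped TensorProduct

universe w w'

noncomputable section

namespace CYTilting

open MulOpposite (op unop)

/-! ### Homology of a cochain complex isomorphic to a shifted module -/

section Homology

variable {R : Type u} [Ring R]

/-- The homology of a cochain complex which becomes isomorphic, in the derived category, to an
object `D` placed in degree `d`. -/
def homologyIsoOfSingle [HasDerivedCategory (ModuleCat.{u} R)]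
    {C : CochainComplex (ModuleCat.{u} R) ℕ} {D : ModuleCat.{u} R} {d : ℕ}
    (e : DerivedCategory.Q.obj (C.extend ComplexShape.embeddingUpNat) ≅
      (DerivedCategory.singleFunctor (ModuleCat.{u} R) (d : ℤ)).obj D) (i : ℕ) :
    C.homology i ≅
      ((HomologicalComplex.single (ModuleCat.{u} R) (ComplexShape.up ℤ) (d : ℤ)).obj D).homology
        (i : ℤ) :=
  (C.extendHomologyIso ComplexShape.embeddingUpNat (j := i) (j' := (i : ℤ)) rfl).symm ≪≫
    ((DerivedCategory.homologyFunctorFactors (ModuleCat.{u} R) (i : ℤ)).app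
      (C.extend ComplexShape.embeddingUpNat)).symm ≪≫
    (DerivedCategory.homologyFunctor (ModuleCat.{u} R) (i : ℤ)).mapIso e ≪≫
    (DerivedCategory.homologyFunctorFactors (ModuleCat.{u} R) (i : ℤ)).app
      ((HomologicalComplex.single (ModuleCat.{u} R) (ComplexShape.up ℤ) (d : ℤ)).obj D)

theorem exactAt_of_iso_single [HasDerivedCategory (ModuleCat.{u} R)]
    {C : CochainComplex (ModuleCat.{u} R) ℕ} {D : ModuleCat.{u} R} {d : ℕ}
    (e : DerivedCategory.Q.obj (C.extend ComplexShape.embeddingUpNat) ≅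
      (DerivedCategory.singleFunctor (ModuleCat.{u} R) (d : ℤ)).obj D) {i : ℕ} (hi : i ≠ d) :
    C.ExactAt i := by
  rw [HomologicalComplex.exactAt_iff_isZero_homology]
  refine (homologyIsoOfSingle e i).isZero_iff.2 ?_
  exact HomologicalComplex.isZero_single_obj_homology _ _ _ _ (by exact_mod_cast hi)

theorem nonempty_homology_iso_of_iso_single [HasDerivedCategory (ModuleCat.{u} R)]
    {C : CochainComplex (ModuleCat.{u} R) ℕ} {D : ModuleCat.{u} R} {d : ℕ}
    (e : DerivedCategory.Q.obj (C.extend ComplexShape.embeddingUpNat) ≅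
      (DerivedCategory.singleFunctor (ModuleCat.{u} R) (d : ℤ)).obj D) :
    Nonempty (C.homology d ≅ D) :=
  ⟨homologyIsoOfSingle e d ≪≫ HomologicalComplex.singleObjHomologySelfIso _ _ _⟩

/-- If the homology of a complex of modules is `D`, then `D` is the quotient of the cocycles by
the coboundaries. -/
theorem exists_cycles_map_of_homology_iso {C : CochainComplex (ModuleCat.{u} R) ℕ}
    {D : ModuleCat.{u} R} (i j k : ℕ) (hij : i + 1 = j) (hjk : j + 1 = k)
    (e : C.homology j ≅ D) :
    ∃ q : LinearMap.ker (C.d j k).hom →ₗ[R] D, Function.Surjective q ∧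
      ∀ x, q x = 0 ↔ ∃ y, C.d i j y = x := by
  subst hij hjk
  have e' : (C.sc' i (i + 1) (i + 1 + 1)).homology ≅ D :=
    (ShortComplex.homologyMapIso (C.isoSc' i (i + 1) (i + 1 + 1) (by simp) (by simp))).symm ≪≫ e
  let S := C.sc' i (i + 1) (i + 1 + 1)
  let q : S.moduleCatLeftHomologyData.H ≅ D := S.moduleCatHomologyIso.symm ≪≫ e'
  refine ⟨q.hom.hom ∘ₗ S.moduleCatLeftHomologyData.π.hom, ?_, ?_⟩
  · exact (ModuleCat.epi_iff_surjective q.hom).1 inferInstance |>.comp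
      (Submodule.mkQ_surjective _)
  · intro x
    have h1 : q.hom.hom (S.moduleCatLeftHomologyData.π.hom x) = 0 ↔
        S.moduleCatLeftHomologyData.π.hom x = 0 :=
      map_eq_zero_iff q.hom.hom ((ModuleCat.mono_iff_injective q.hom).1 inferInstance)
    refine h1.trans ?_
    refine (Submodule.Quotient.mk_eq_zero _).trans ?_
    constructor
    · rintro ⟨y, hy⟩
      exact ⟨y, congrArg Subtype.val hy⟩
    · rintro ⟨y, hy⟩
      exact ⟨y, Subtype.ext hy⟩

theorem exists_eq_of_exactAt {C : CochainComplex (ModuleCat.{u} R) ℕ} {j : ℕ}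
    (h : C.ExactAt (j + 1)) (x : C.X (j + 1)) (hx : C.d (j + 1) (j + 2) x = 0) :
    ∃ y, C.d j (j + 1) y = x :=
  (ShortComplex.moduleCat_exact_iff _).1
    ((HomologicalComplex.exactAt_iff' _ j (j + 1) (j + 2) (by simp) (by simp)).1 h) x hx

theorem eq_zero_of_exactAt_zero {C : CochainComplex (ModuleCat.{u} R) ℕ}
    (h : C.ExactAt 0) (x : C.X 0) (hx : C.d 0 1 x = 0) : x = 0 := by
  obtain ⟨y, hy⟩ := (ShortComplex.moduleCat_exact_iff _).1
    ((HomologicalComplex.exactAt_iff' _ 0 0 1 (by simp) (by simp)).1 h) x hx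
  rw [← hy]
  change C.d 0 0 y = 0
  rw [C.shape 0 0 (by simp)]
  rfl

end Homology

/-! ### Resolutions witnessing the Calabi-Yau property -/


variable {K : Type v} [Field K]

/-- A resolution `0 → P₂ → P₁ → P₀ → A → 0` by finitely generated projective bimodules whose dual
is a resolution `0 → P₀* → P₁* → P₂* → A → 0`. Bimodules are modules over a ring `E` identified
with `A ⊗ Aᵒᵖ` by `θ`. -/
structure CYResolution {A : Type u} [Ring A] [Algebra K A] {E : Type u} [Ring E] [Algebra K E]
    (θ : A ⊗[K] Aᵐᵒᵖ ≃ₐ[K] E) where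
  (P₀ P₁ P₂ : ModuleCat.{u} E)
  finite₀ : Module.Finite E P₀
  finite₁ : Module.Finite E P₁
  finite₂ : Module.Finite E P₂
  projective₀ : Module.Projective E P₀
  projective₁ : Module.Projective E P₁
  projective₂ : Module.Projective E P₂
  d₂ : P₂ →ₗ[E] P₁
  d₁ : P₁ →ₗ[E] P₀
  ε : P₀ →+ A
  ε_smul : ∀ a b p, ε (θ (a ⊗ₜ op b) • p) = a * ε p * b
  injective_d₂ : Function.Injective d₂
  exact₁ : Function.Exact d₂ d₁
  exact₀ : Function.Exact d₁ ε
  surjective_ε : Function.Surjective ε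
  π : (P₂ →ₗ[E] E) →+ A
  π_smul : ∀ a b f, π (op (θ (a ⊗ₜ op b)) • f) = b * π f * a
  dual_injective : ∀ f : P₀ →ₗ[E] E, f ∘ₗ d₁ = 0 → f = 0
  dual_exact₁ : ∀ f : P₁ →ₗ[E] E, f ∘ₗ d₂ = 0 → ∃ g : P₀ →ₗ[E] E, g ∘ₗ d₁ = f
  dual_exact₂ : ∀ f : P₂ →ₗ[E] E, π f = 0 ↔ ∃ g : P₁ →ₗ[E] E, g ∘ₗ d₂ = f
  surjective_π : Function.Surjective π

/-! ### Truncating a finite resolution to length two. -/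

section Truncation

variable {E : Type u} [Ring E]

/-- If all functionals on a finitely generated projective submodule `Z` of `P` extend to `P`, then
`P ⧸ Z` is projective whenever `P` is. -/
theorem projective_quotient_of_extend {P : Type u} [AddCommGroup P] [Module E P]
    [Module.Projective E P] (Z : Submodule E P) [Module.Finite E Z] [Module.Projective E Z]
    (h : ∀ f : Z →ₗ[E] E, ∃ g : P →ₗ[E] E, g ∘ₗ Z.subtype = f) :
    Module.Projective E (P ⧸ Z) := by
  -- Z is a summand of a free module; extending its coordinate functionals to P gives a retraction
  -- `r` of P onto Z, and `id - r` descends to a section of P → P/Z.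
  obtain ⟨n, f, g, -, -, hfg⟩ := Module.Finite.exists_comp_eq_id_of_projective E Z
  choose c hc using fun i => h (LinearMap.proj i ∘ₗ g)
  let r : P →ₗ[E] Z := f ∘ₗ LinearMap.pi c
  have hr : ∀ z : Z, r z = z := fun z => by
    have : LinearMap.pi c (z : P) = g z := by
      ext i
      exact LinearMap.congr_fun (hc i) z
    change f (LinearMap.pi c (z : P)) = z
    rw [this]
    exact LinearMap.congr_fun hfg z
  let s : (P ⧸ Z) →ₗ[E] P := Z.liftQ (LinearMap.id - Z.subtype ∘ₗ r) (fun z hz => by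
    have := hr ⟨z, hz⟩
    simp only [LinearMap.mem_ker, LinearMap.sub_apply, LinearMap.id_apply, LinearMap.comp_apply]
    rw [this]
    simp)
  refine Module.Projective.of_split s Z.mkQ ?_
  ext x
  simp [s]

end Truncation

section Truncation

theorem ker_le_range_of_exact {E : Type u} [Ring E] {D : ModuleCat.{u} E}
    (P : ProjectiveResolution D) (i : ℕ) (x : P.complex.X (i + 1))
    (hx : P.complex.d (i + 1) i x = 0) : ∃ y, P.complex.d (i + 2) (i + 1) y = x :=
  (ShortComplex.moduleCat_exact_iff _).1 (P.exact_succ i) x hx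

variable {K : Type v} [Field K] {A : Type u} [Ring A] [Algebra K A]

theorem exists_dual_eq_of_exactAt {P : ChainComplex (ModuleCat.{u} (Env K A)) ℕ} {j : ℕ}
    (h : (dualComplex K A P).ExactAt (j + 1)) (f : P.X (j + 1) →ₗ[Env K A] Env K A)
    (hf : f ∘ₗ (P.d (j + 2) (j + 1)).hom = 0) :
    ∃ g : P.X j →ₗ[Env K A] Env K A, g ∘ₗ (P.d (j + 1) j).hom = f :=
  exists_eq_of_exactAt h f hf

/-- In a finite resolution of finitely generated projective bimodules whose dual is exact in
degrees at least `3`, the second syzygy is projective. -/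
theorem projective_range_d {D : ModuleCat.{u} (Env K A)} (P : ProjectiveResolution D)
    (hP : IsPerfectResolution P)
    (hex : ∀ i, 3 ≤ i → (dualComplex K A P.complex).ExactAt i) (i : ℕ) (hi : 1 ≤ i) :
    Module.Projective (Env K A) (LinearMap.range (P.complex.d (i + 1) i).hom) := by
  obtain ⟨hfin, N, hN⟩ := hP
  -- Descending induction on i, with k bounding the distance to the top N of the resolution, beyond
  -- which everything is zero.
  suffices H : ∀ k i, 1 ≤ i → N ≤ i + k →
      Module.Projective (Env K A) (LinearMap.range (P.complex.d (i + 1) i).hom) from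
    H N i hi (by omega)
  intro k
  induction k with
  | zero =>
    intro i hi hNi
    have h0 : P.complex.d (i + 1) i = 0 := (hN (i + 1) (by omega)).eq_of_src _ _
    have : Subsingleton (LinearMap.range (P.complex.d (i + 1) i).hom) := by
      rw [h0]
      simp only [ModuleCat.hom_zero, LinearMap.range_zero]
      infer_instance
    infer_instance
  | succ k ih =>
    intro i hi hNi
    have := ih (i + 1) (by omega) (by omega)
    have := hfin (i + 2)
    have : Module.Projective (Env K A) (P.complex.X (i + 1)) :=
      (IsProjective.iff_projective _).2 (P.projective (i + 1))
    -- A functional on the image of d composes to a cocycle in degree i + 2 ≥ 3, where the dual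
    -- complex is exact, so it extends. The quotient by this image is the next image by exactness.
    have hq := projective_quotient_of_extend
      (LinearMap.range (P.complex.d (i + 1 + 1) (i + 1)).hom) (fun f => by
        obtain ⟨g, hg⟩ := exists_dual_eq_of_exactAt (hex (i + 1 + 1) (by omega))
          (f ∘ₗ (P.complex.d (i + 1 + 1) (i + 1)).hom.rangeRestrict) (by
            ext x
            have : (P.complex.d (i + 1 + 1) (i + 1)).hom.rangeRestrict
                ((P.complex.d (i + 1 + 2) (i + 1 + 1)).hom x) = 0 := by
              apply Subtype.ext
              exact ConcreteCategory.congr_hom (P.complex.d_comp_d (i + 3) (i + 2) (i + 1)) x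
            simp only [LinearMap.comp_apply]
            erw [this]
            simp)
        refine ⟨g, ?_⟩
        ext ⟨_, y, rfl⟩
        exact LinearMap.congr_fun hg y)
    have hker : LinearMap.range (P.complex.d (i + 1 + 1) (i + 1)).hom =
        LinearMap.ker (P.complex.d (i + 1) i).hom := by
      ext x
      constructor
      · rintro ⟨y, rfl⟩
        exact ConcreteCategory.congr_hom (P.complex.d_comp_d (i + 2) (i + 1) i) y
      · exact fun hx => ker_le_range_of_exact P i x hx
    exact Module.Projective.of_equiv ((Submodule.quotEquivOfEq _ _ hker).trans
      (LinearMap.quotKerEquivRange _))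

/-- The identification of the underlying type of the diagonal bimodule with `A`. -/
def diagonalEquiv : diagonal K A ≃+ A := AddEquiv.refl A

theorem diagonalEquiv_smul (a b : A) (x : diagonal K A) :
    diagonalEquiv ((a ⊗ₜ[K] op b : Env K A) • x) = a * diagonalEquiv x * b := by
  let _ : Module (Env K A) A := instModuleTensorProductMop K A
  change ((a ⊗ₜ[K] op b : Env K A) • diagonalEquiv x : A) = _
  rw [TensorProduct.Algebra.smul_def, MulOpposite.smul_eq_mul_unop, smul_eq_mul, mul_assoc]
  rfl

/-- The term in degree 2 is replaced by its image Z in degree 1, which is projective. As functionals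
on Z are exactly the 2-cocycles of the dual complex, modulo those that extend to degree 1 they give
its second cohomology, which is A. -/
theorem IsCalabiYau.nonempty_resolution (h : IsCalabiYau K A 2) :
    Nonempty (CYResolution (AlgEquiv.refl : A ⊗[K] Aᵐᵒᵖ ≃ₐ[K] Env K A)) := by
  let _ : HasDerivedCategory (ModuleCat.{u} (Env K A)) := HasDerivedCategory.standard _
  obtain ⟨P, hP, ⟨e⟩⟩ := h
  have hex : ∀ i, i ≠ 2 → (dualComplex K A P.complex).ExactAt i :=
    fun i hi => exactAt_of_iso_single e hi
  obtain ⟨e₂⟩ := nonempty_homology_iso_of_iso_single e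
  obtain ⟨q, hq, hq0⟩ := exists_cycles_map_of_homology_iso 1 2 3 rfl rfl e₂
  have hproj := projective_range_d P hP (fun i hi => hex i (by omega)) 1 le_rfl
  have hfin := hP.1
  let Z := LinearMap.range (P.complex.d 2 1).hom
  let c : P.complex.X 2 →ₗ[Env K A] Z := (P.complex.d 2 1).hom.rangeRestrict
  have hc : ∀ y, c ((P.complex.d 3 2).hom y) = 0 := fun y =>
    Subtype.ext (ConcreteCategory.congr_hom (P.complex.d_comp_d 3 2 1) y)
  have hcs : Function.Surjective c := LinearMap.surjective_rangeRestrict _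
  let κ : (Z →ₗ[Env K A] Env K A) → LinearMap.ker ((dualComplex K A P.complex).d 2 3).hom :=
    fun f => ⟨f ∘ₗ c, by
      change (f ∘ₗ c) ∘ₗ (P.complex.d 3 2).hom = 0
      ext y
      simp [hc]⟩
  have := hfin 2
  refine ⟨{ P₀ := P.complex.X 0, P₁ := P.complex.X 1, P₂ := ModuleCat.of _ Z,
            finite₀ := hfin 0, finite₁ := hfin 1
            finite₂ := inferInstanceAs (Module.Finite (Env K A) Z)
            projective₀ := (IsProjective.iff_projective _).2 (P.projective 0)
            projective₁ := (IsProjective.iff_projective _).2 (P.projective 1)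
            projective₂ := hproj
            d₂ := Z.subtype
            d₁ := (P.complex.d 1 0).hom
            ε := diagonalEquiv.toAddMonoidHom.comp (P.π.f 0).hom.toAddMonoidHom
            ε_smul := fun a b p => ?_
            injective_d₂ := Z.subtype_injective
            exact₁ := ?_
            exact₀ := ?_
            surjective_ε := diagonalEquiv.surjective.comp <| (ModuleCat.epi_iff_surjective (P.π.f 0)).1 inferInstance
            π := { toFun := fun f => diagonalEquiv (q (κ f))
                   map_zero' := ?_
                   map_add' := ?_ }
            π_smul := ?_
            dual_injective := ?_
            dual_exact₁ := ?_
            dual_exact₂ := ?_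
            surjective_π := ?_ }⟩
  · exact (congrArg diagonalEquiv ((P.π.f 0).hom.map_smul (a ⊗ₜ[K] op b : Env K A) p)).trans
      (diagonalEquiv_smul a b _)
  · intro x
    constructor
    · intro hx
      obtain ⟨y, hy⟩ := ker_le_range_of_exact P 0 x hx
      exact ⟨⟨x, y, hy⟩, rfl⟩
    · rintro ⟨⟨_, y, rfl⟩, rfl⟩
      exact ConcreteCategory.congr_hom (P.complex.d_comp_d 2 1 0) y
  · intro x
    constructor
    · intro hx
      exact (ShortComplex.moduleCat_exact_iff _).1 P.exact₀ x
        ((map_eq_zero_iff _ diagonalEquiv.injective).1 hx)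
    · rintro ⟨y, rfl⟩
      exact (congrArg diagonalEquiv
        (ConcreteCategory.congr_hom P.complex_d_comp_π_f_zero y)).trans (map_zero _)
  · have : κ 0 = 0 := Subtype.ext (LinearMap.zero_comp c)
    rw [this, map_zero, map_zero]
  · intro f g
    have : κ (f + g) = κ f + κ g := Subtype.ext (LinearMap.add_comp c g f)
    rw [this, map_add, map_add]
  · intro a b f
    have : κ (op (a ⊗ₜ[K] op b : Env K A) • f) = (b ⊗ₜ[K] op a : Env K A) • κ f := by
      refine Subtype.ext (LinearMap.ext fun y => ?_)
      exact (BimodDual.smul_apply K A _ (b ⊗ₜ[K] op a) (κ f).1 y).symm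
    change diagonalEquiv (q (κ (op (a ⊗ₜ[K] op b : Env K A) • f))) = _
    rw [this]
    exact (congrArg diagonalEquiv (q.map_smul _ _)).trans (diagonalEquiv_smul b a _)
  · intro f hf
    exact eq_zero_of_exactAt_zero (hex 0 (by omega)) f hf
  · intro f hf
    refine exists_dual_eq_of_exactAt (hex 1 (by omega)) f ?_
    ext y
    exact LinearMap.congr_fun hf (c y)
  · intro f
    refine (map_eq_zero_iff _ diagonalEquiv.injective).trans ((hq0 (κ f)).trans ?_)
    constructor
    · rintro ⟨g, hg⟩
      refine ⟨g, LinearMap.ext fun z => ?_⟩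
      obtain ⟨y, rfl⟩ := hcs z
      exact LinearMap.congr_fun hg y
    · rintro ⟨g, rfl⟩
      exact ⟨g, rfl⟩
  · intro x
    obtain ⟨⟨f, hf⟩, hx⟩ := hq (diagonalEquiv.symm x)
    have hf' : ∀ y, (show P.complex.X 2 →ₗ[Env K A] Env K A from f)
        ((P.complex.d 3 2).hom y) = 0 := fun y => LinearMap.congr_fun hf y
    -- A 2-cocycle vanishes on the image of the third differential, which is the kernel of `c`, so
    -- it descends to Z.
    have hle : LinearMap.ker c ≤
        LinearMap.ker (show P.complex.X 2 →ₗ[Env K A] Env K A from f) := by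
      intro z hz
      obtain ⟨y, rfl⟩ := ker_le_range_of_exact P 1 z (congrArg Subtype.val hz)
      exact hf' y
    let f' : Z →ₗ[Env K A] Env K A :=
      (LinearMap.ker c).liftQ (show P.complex.X 2 →ₗ[Env K A] Env K A from f) hle ∘ₗ
        (c.quotKerEquivOfSurjective hcs).symm.toLinearMap
    have hκ : κ f' = ⟨f, hf⟩ := by
      refine Subtype.ext (LinearMap.ext fun y => ?_)
      change (LinearMap.ker c).liftQ (show P.complex.X 2 →ₗ[Env K A] Env K A from f) hle
        ((c.quotKerEquivOfSurjective hcs).symm (c y)) = _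
      rw [← LinearMap.quotKerEquivOfSurjective_apply_mk c hcs y, LinearEquiv.symm_apply_apply]
      rfl
    refine ⟨f', ?_⟩
    change diagonalEquiv (q (κ f')) = x
    rw [hκ, hx, AddEquiv.apply_symm_apply]

end Truncation

/-! ### The opposite algebra, and second Hochschild cohomology as coinvariants. -/

section Second

variable {K : Type v} [Field K] {A : Type u} [Ring A] [Algebra K A]
  {E : Type u} [Ring E] [Algebra K E]

/-- The identification of the enveloping algebra of `Aᵒᵖ` with that of `A`. -/
def opEnv (θ : A ⊗[K] Aᵐᵒᵖ ≃ₐ[K] E) : Aᵐᵒᵖ ⊗[K] Aᵐᵒᵖᵐᵒᵖ ≃ₐ[K] E :=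
  ((Algebra.TensorProduct.congr AlgEquiv.refl (AlgEquiv.opOp K A).symm).trans
    (Algebra.TensorProduct.comm K Aᵐᵒᵖ A)).trans θ

theorem opEnv_tmul (θ : A ⊗[K] Aᵐᵒᵖ ≃ₐ[K] E) (a b : Aᵐᵒᵖ) :
    opEnv θ (a ⊗ₜ op b) = θ (unop b ⊗ₜ op (unop a)) := rfl

/-- The resolution for `Aᵒᵖ` obtained from a resolution for `A`. -/
def CYResolution.opposite {θ : A ⊗[K] Aᵐᵒᵖ ≃ₐ[K] E} (P : CYResolution θ) :
    CYResolution (opEnv θ) where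
  P₀ := P.P₀
  P₁ := P.P₁
  P₂ := P.P₂
  finite₀ := P.finite₀
  finite₁ := P.finite₁
  finite₂ := P.finite₂
  projective₀ := P.projective₀
  projective₁ := P.projective₁
  projective₂ := P.projective₂
  d₂ := P.d₂
  d₁ := P.d₁
  ε := MulOpposite.opAddEquiv.toAddMonoidHom.comp P.ε
  ε_smul a b p := by
    rw [opEnv_tmul]
    change op (P.ε _) = a * op (P.ε p) * b
    rw [P.ε_smul, mul_assoc]
    rfl
  injective_d₂ := P.injective_d₂
  exact₁ := P.exact₁
  exact₀ x := (map_eq_zero_iff MulOpposite.opAddEquiv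
    MulOpposite.opAddEquiv.injective).trans (P.exact₀ x)
  surjective_ε := MulOpposite.opAddEquiv.surjective.comp P.surjective_ε
  π := MulOpposite.opAddEquiv.toAddMonoidHom.comp P.π
  π_smul a b f := by
    rw [opEnv_tmul]
    change op (P.π _) = b * op (P.π f) * a
    rw [P.π_smul, mul_assoc]
    rfl
  dual_injective := P.dual_injective
  dual_exact₁ := P.dual_exact₁
  dual_exact₂ f := (map_eq_zero_iff MulOpposite.opAddEquiv
    MulOpposite.opAddEquiv.injective).trans (P.dual_exact₂ f)
  surjective_π := MulOpposite.opAddEquiv.surjective.comp P.surjective_π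

/-- The subgroup `[A, X]` of a bimodule `X`. -/
def commutators (θ : A ⊗[K] Aᵐᵒᵖ ≃ₐ[K] E) (X : Type w) [AddCommGroup X] [Module E X] :
    AddSubgroup X :=
  AddSubgroup.closure {x | ∃ (a : A) (y : X), θ (a ⊗ₜ 1) • y - θ (1 ⊗ₜ op a) • y = x}

theorem mem_commutators (θ : A ⊗[K] Aᵐᵒᵖ ≃ₐ[K] E) {X : Type w} [AddCommGroup X] [Module E X]
    (a : A) (y : X) : θ (a ⊗ₜ 1) • y - θ (1 ⊗ₜ op a) • y ∈ commutators θ X :=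
  AddSubgroup.subset_closure ⟨a, y, rfl⟩

variable {θ : A ⊗[K] Aᵐᵒᵖ ≃ₐ[K] E} (P : CYResolution θ) {X : Type w} [AddCommGroup X] [Module E X]

namespace CYResolution

/-- For e = b ⊗ c, `π_smul` turns the right action of e on f into c · π(f) · b, so the difference is
yc - cy with y = π(f) b x. -/
theorem π_smul_sub_mem (f : P.P₂ →ₗ[E] E) (e : E) (x : X) :
    θ (P.π f ⊗ₜ 1) • e • x - θ (P.π (op e • f) ⊗ₜ 1) • x ∈ commutators θ X := by
  obtain ⟨t, rfl⟩ := θ.surjective e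
  induction t with
  | zero => simp
  | tmul b c =>
    obtain ⟨c, rfl⟩ := MulOpposite.op_surjective c
    rw [P.π_smul]
    have h := mem_commutators θ c (θ ((P.π f * b) ⊗ₜ 1) • x)
    rw [← neg_sub]
    refine neg_mem ?_
    convert h using 2
    · rw [smul_smul, ← map_mul, Algebra.TensorProduct.tmul_mul_tmul, mul_one, mul_assoc]
    · rw [smul_smul, smul_smul, ← map_mul, ← map_mul, Algebra.TensorProduct.tmul_mul_tmul,
        Algebra.TensorProduct.tmul_mul_tmul, one_mul, one_mul, mul_one]
  | add s t hs ht =>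
    convert add_mem hs ht using 1
    rw [map_add, MulOpposite.op_add, add_smul, add_smul, map_add, TensorProduct.add_tmul, map_add,
      add_smul, smul_add]
    abel

/-- The homomorphisms `P₂ → X` which extend along `d₂`. -/
def boundaries (X : Type w) [AddCommGroup X] [Module E X] : AddSubgroup (P.P₂ →ₗ[E] X) where
  carrier := {φ | ∃ ψ : P.P₁ →ₗ[E] X, ψ ∘ₗ P.d₂ = φ}
  zero_mem' := ⟨0, LinearMap.zero_comp _⟩
  add_mem' := by
    rintro _ _ ⟨ψ, rfl⟩ ⟨ψ', rfl⟩
    exact ⟨ψ + ψ', LinearMap.add_comp _ _ _⟩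
  neg_mem' := by
    rintro _ ⟨ψ, rfl⟩
    exact ⟨-ψ, LinearMap.neg_comp _ _⟩

/-- The homomorphism `p ↦ f p • x`. -/
def smulHom {Q : Type*} [AddCommGroup Q] [Module E Q] (f : Q →ₗ[E] E) (x : X) : Q →ₗ[E] X :=
  (LinearMap.toSpanSingleton E X x) ∘ₗ f

theorem smulHom_apply {Q : Type*} [AddCommGroup Q] [Module E Q] (f : Q →ₗ[E] E) (x : X) (q : Q) :
    smulHom f x q = f q • x := rfl

theorem smulHom_mem_boundaries {f : P.P₂ →ₗ[E] E} (hf : P.π f = 0) (x : X) :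
    smulHom f x ∈ P.boundaries X := by
  obtain ⟨g, rfl⟩ := (P.dual_exact₂ f).1 hf
  exact ⟨smulHom g x, rfl⟩

end CYResolution

/-- Dual bases of finitely generated projective modules. -/
theorem exists_dual_basis (R : Type*) [Ring R] (Q : Type*) [AddCommGroup Q] [Module R Q]
    [Module.Finite R Q] [Module.Projective R Q] :
    ∃ (n : ℕ) (f : Fin n → (Q →ₗ[R] R)) (p : Fin n → Q), ∀ q, ∑ i, f i q • p i = q := by
  obtain ⟨n, f, g, -, -, hfg⟩ := Module.Finite.exists_comp_eq_id_of_projective R Q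
  refine ⟨n, fun i => LinearMap.proj i ∘ₗ g, fun i => f (Pi.single i 1), fun q => ?_⟩
  conv_rhs => rw [← LinearMap.id_apply (R := R) q, ← hfg]
  simp only [LinearMap.comp_apply, LinearMap.proj_apply, ← map_smul, ← map_sum]
  congr 1
  ext j
  simp [Finset.sum_apply, Pi.single_apply]

theorem eq_sum_smulHom {Q : Type*} [AddCommGroup Q] [Module E Q] {n : ℕ}
    {f : Fin n → (Q →ₗ[E] E)} {p : Fin n → Q} (h : ∀ q, ∑ i, f i q • p i = q)
    (φ : Q →ₗ[E] X) : φ = ∑ i, CYResolution.smulHom (f i) (φ (p i)) := by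
  ext q
  conv_lhs => rw [← h q]
  simp [CYResolution.smulHom_apply]

namespace CYResolution

/-- The second Hochschild cohomology of `X` is `X / [A, X]`, naturally in `X`. -/
theorem exists_trace :
    ∃ (n : ℕ) (c : Fin n → E) (p : Fin n → P.P₂), ∀ (X : Type w) [AddCommGroup X] [Module E X],
      (∀ φ : P.P₂ →ₗ[E] X, φ ∈ P.boundaries X ↔ ∑ j, c j • φ (p j) ∈ commutators θ X) ∧
      ∀ x : X, ∃ φ : P.P₂ →ₗ[E] X, ∑ j, c j • φ (p j) - x ∈ commutators θ X := by
  have := P.finite₂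
  have := P.projective₂
  have := P.finite₁
  have := P.projective₁
  obtain ⟨n, f, p, hp⟩ := exists_dual_basis E P.P₂
  obtain ⟨m, g, r, hr⟩ := exists_dual_basis E P.P₁
  obtain ⟨u, hu⟩ := P.surjective_π 1
  -- With a dual basis (f_j, p_j) of P₂, the class of φ is read off as Λ φ = ∑ π(f_j) φ(p_j); the
  -- coefficients do not depend on X, which yields naturality.
  refine ⟨n, fun j => θ (P.π (f j) ⊗ₜ 1), p, fun X _ _ => ?_⟩
  let Λ : (P.P₂ →ₗ[E] X) →+ X :=
    { toFun := fun φ => ∑ j, θ (P.π (f j) ⊗ₜ 1) • φ (p j)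
      map_zero' := by simp
      map_add' := fun φ ψ => by simp [Finset.sum_add_distrib] }
  have hΛ : ∀ φ, Λ φ = ∑ j, θ (P.π (f j) ⊗ₜ 1) • φ (p j) := fun _ => rfl
  -- Modulo commutators Λ sends h(-)x to π(h)x: expand h in the dual basis and move the coefficients
  -- across π.
  have key : ∀ (h : P.P₂ →ₗ[E] E) (x : X),
      Λ (smulHom h x) - θ (P.π h ⊗ₜ 1) • x ∈ commutators θ X := by
    intro h x
    have hh : h = ∑ j, op (h (p j)) • f j := by
      ext q
      conv_lhs => rw [← hp q]
      simp
    have : Λ (smulHom h x) - θ (P.π h ⊗ₜ 1) • x =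
        ∑ j, (θ (P.π (f j) ⊗ₜ 1) • h (p j) • x - θ (P.π (op (h (p j)) • f j) ⊗ₜ 1) • x) := by
      rw [Finset.sum_sub_distrib, ← Finset.sum_smul, ← map_sum, ← TensorProduct.sum_tmul,
        ← map_sum, ← hh]
      rfl
    rw [this]
    exact sum_mem fun j _ => P.π_smul_sub_mem (f j) (h (p j)) x
  have hux : ∀ x : X, Λ (smulHom u x) - x ∈ commutators θ X := fun x => by
    have := key u x
    rwa [hu, ← Algebra.TensorProduct.one_def, map_one, one_smul] at this
  -- As π(u) = 1, each functional f_j differs from the multiple of u by π(f_j) by an element of ker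
  -- π, that is, by a functional that extends to P₁. So x ↦ u(-)x inverts Λ modulo boundaries.
  have hφ : ∀ φ : P.P₂ →ₗ[E] X, φ - smulHom u (Λ φ) ∈ P.boundaries X := by
    intro φ
    have h1 : φ - smulHom u (Λ φ) =
        ∑ j, smulHom (f j - op (θ (P.π (f j) ⊗ₜ op 1)) • u) (φ (p j)) := by
      ext q
      have hq : φ q = ∑ j, f j q • φ (p j) := by
        conv_lhs => rw [← hp q]
        simp
      simp [smulHom_apply, hΛ, sub_smul, Finset.smul_sum, mul_smul, hq]
    rw [h1]
    refine sum_mem fun j _ => P.smulHom_mem_boundaries ?_ _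
    rw [map_sub, P.π_smul, hu]
    simp
  -- Both u·(a ⊗ 1) and u·(1 ⊗ a) are sent to a by π, so their difference extends to P₁.
  have hb : ∀ x ∈ commutators θ X, smulHom u x ∈ P.boundaries X := by
    intro x hx
    induction hx using AddSubgroup.closure_induction with
    | mem x hx =>
      obtain ⟨a, y, rfl⟩ := hx
      have h1 : smulHom u (θ (a ⊗ₜ 1) • y - θ (1 ⊗ₜ op a) • y) =
          smulHom (op (θ (a ⊗ₜ op 1)) • u - op (θ (1 ⊗ₜ op a)) • u) y := by
        ext q
        simp [smulHom_apply, sub_smul, mul_smul, smul_sub]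
      rw [h1]
      refine P.smulHom_mem_boundaries ?_ _
      rw [map_sub, P.π_smul, P.π_smul, hu]
      simp
    | zero =>
      convert zero_mem (P.boundaries X)
      ext q
      simp [smulHom_apply]
    | add x y _ _ hx hy =>
      convert add_mem hx hy
      ext q
      simp [smulHom_apply]
    | neg x _ hx =>
      convert neg_mem hx
      ext q
      simp [smulHom_apply]
  refine ⟨fun φ => ⟨?_, fun h => ?_⟩, fun x => ⟨smulHom u x, hux x⟩⟩
  · rintro ⟨ψ, rfl⟩
    change Λ (ψ ∘ₗ P.d₂) ∈ _
    have h1 : ψ ∘ₗ P.d₂ = ∑ k, smulHom (g k ∘ₗ P.d₂) (ψ (r k)) := by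
      conv_lhs => rw [eq_sum_smulHom hr ψ]
      ext q
      simp [smulHom_apply]
    rw [h1, map_sum]
    refine sum_mem fun k _ => ?_
    have := key (g k ∘ₗ P.d₂) (ψ (r k))
    rwa [(P.dual_exact₂ _).2 ⟨g k, rfl⟩, TensorProduct.zero_tmul, map_zero, zero_smul,
      sub_zero] at this
  · change Λ φ ∈ _ at h
    have := add_mem (hφ φ) (hb _ h)
    rwa [sub_add_cancel] at this

end CYResolution
end Second

/-! ### Tensor products over noncommutative rings -/

section BalTensor

variable {R : Type*} [Ring R]

/-- The relations defining `P ⊗_R M` as a quotient of `P ⊗_ℤ M`, for an `R`-bimodule `P`. -/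
def balRel (R : Type*) [Ring R] (P : Type*) [AddCommGroup P] [Module R P] [Module Rᵐᵒᵖ P]
    [SMulCommClass R Rᵐᵒᵖ P] (M : Type*) [AddCommGroup M] [Module R M] :
    Submodule R (P ⊗[ℤ] M) where
  carrier := AddSubgroup.closure
    {x | ∃ (a : R) (p : P) (m : M), (op a • p) ⊗ₜ[ℤ] m - p ⊗ₜ[ℤ] (a • m) = x}
  add_mem' := add_mem
  zero_mem' := zero_mem _
  smul_mem' := by
    intro r x hx
    simp only [SetLike.mem_coe] at hx ⊢
    induction hx using AddSubgroup.closure_induction with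
    | mem x hx =>
      obtain ⟨a, p, m, rfl⟩ := hx
      refine AddSubgroup.subset_closure ⟨a, r • p, m, ?_⟩
      rw [smul_sub, TensorProduct.smul_tmul', TensorProduct.smul_tmul', smul_comm r]
    | zero => rw [smul_zero]; exact zero_mem _
    | add x y _ _ hx hy => rw [smul_add]; exact add_mem hx hy
    | neg x _ hx => rw [smul_neg]; exact neg_mem hx

/-- The tensor product `P ⊗_R M` of an `R`-bimodule and an `R`-module. -/
def BalTensor (R : Type*) [Ring R] (P : Type*) [AddCommGroup P] [Module R P] [Module Rᵐᵒᵖ P]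
    [SMulCommClass R Rᵐᵒᵖ P] (M : Type*) [AddCommGroup M] [Module R M] : Type _ :=
  (P ⊗[ℤ] M) ⧸ balRel R P M

namespace BalTensor

variable {P : Type*} [AddCommGroup P] [Module R P] [Module Rᵐᵒᵖ P] [SMulCommClass R Rᵐᵒᵖ P]
  {P' : Type*} [AddCommGroup P'] [Module R P'] [Module Rᵐᵒᵖ P'] [SMulCommClass R Rᵐᵒᵖ P']
  {M : Type*} [AddCommGroup M] [Module R M] {N : Type*} [AddCommGroup N] [Module R N]

instance : AddCommGroup (BalTensor R P M) :=
  inferInstanceAs (AddCommGroup ((P ⊗[ℤ] M) ⧸ balRel R P M))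

instance : Module R (BalTensor R P M) :=
  inferInstanceAs (Module R ((P ⊗[ℤ] M) ⧸ balRel R P M))

/-- The pure tensors. -/
def mk (p : P) (m : M) : BalTensor R P M := Submodule.Quotient.mk (p ⊗ₜ[ℤ] m)

theorem mk_add (p : P) (m m' : M) : mk (R := R) p (m + m') = mk p m + mk p m' := by
  unfold mk
  rw [TensorProduct.tmul_add, Submodule.Quotient.mk_add]
  rfl

theorem add_mk (p p' : P) (m : M) : mk (R := R) (p + p') m = mk p m + mk p' m := by
  unfold mk
  rw [TensorProduct.add_tmul, Submodule.Quotient.mk_add]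
  rfl

theorem smul_mk (r : R) (p : P) (m : M) : r • mk (R := R) p m = mk (r • p) m := rfl

theorem op_smul_mk (a : R) (p : P) (m : M) : mk (R := R) (op a • p) m = mk p (a • m) :=
  (Submodule.Quotient.eq _).2 (AddSubgroup.subset_closure ⟨a, p, m, rfl⟩)

@[elab_as_elim]
theorem induction {motive : BalTensor R P M → Prop} (x : BalTensor R P M)
    (zero : motive 0) (mk : ∀ p m, motive (mk p m))
    (add : ∀ x y, motive x → motive y → motive (x + y)) : motive x := by
  obtain ⟨t, rfl⟩ := Submodule.Quotient.mk_surjective _ x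
  induction t with
  | zero => exact zero
  | tmul p m => exact mk p m
  | add s t hs ht => exact add _ _ hs ht

/-- The additive map out of a tensor product defined by a balanced biadditive map. -/
def liftAdd {G : Type*} [AddCommGroup G] (f : P →+ M →+ G)
    (hf : ∀ (a : R) p m, f (op a • p) m = f p (a • m)) : BalTensor R P M →+ G :=
  QuotientAddGroup.lift (balRel R P M).toAddSubgroup
    (TensorProduct.liftAddHom f (fun n p m => by simp)) (by
      intro x hx
      change x ∈ AddSubgroup.closure _ at hx
      induction hx using AddSubgroup.closure_induction with
      | mem x hx =>
        obtain ⟨a, p, m, rfl⟩ := hx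
        simp [hf]
      | zero => simp
      | add x y _ _ hx hy =>
        rw [AddMonoidHom.mem_ker] at hx hy ⊢
        rw [map_add, hx, hy, add_zero]
      | neg x _ hx =>
        rw [AddMonoidHom.mem_ker] at hx ⊢
        rw [map_neg, hx, neg_zero])

theorem liftAdd_mk {G : Type*} [AddCommGroup G] (f : P →+ M →+ G)
    (hf : ∀ (a : R) p m, f (op a • p) m = f p (a • m)) (p : P) (m : M) :
    liftAdd (R := R) f hf (mk p m) = f p m := by
  rfl

/-- The linear map out of a tensor product defined by a balanced biadditive map that is linear in
the first variable. -/
def lift (f : P →+ M →+ N) (hf : ∀ (a : R) p m, f (op a • p) m = f p (a • m))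
    (hR : ∀ (r : R) p m, f (r • p) m = r • f p m) : BalTensor R P M →ₗ[R] N where
  toFun := liftAdd f hf
  map_add' := map_add _
  map_smul' r x := by
    induction x using induction with
    | zero => simp
    | mk p m => rw [smul_mk, liftAdd_mk, liftAdd_mk, hR]; rfl
    | add x y hx hy => rw [smul_add, map_add, hx, hy, map_add, smul_add]

theorem lift_mk (f : P →+ M →+ N) (hf : ∀ (a : R) p m, f (op a • p) m = f p (a • m))
    (hR : ∀ (r : R) p m, f (r • p) m = r • f p m) (p : P) (m : M) :
    lift f hf hR (mk p m) = f p m := liftAdd_mk f hf p m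

/-- The biadditive map `(p, m) ↦ p ⊗ m`. -/
def mkHom : P →+ M →+ BalTensor R P M :=
  AddMonoidHom.mk' (fun p => AddMonoidHom.mk' (mk p) (mk_add p))
    (fun p q => by ext m; exact add_mk p q m)

/-- Functoriality for homomorphisms of right modules. -/
def mapAdd (h : P →+ P') (hh : ∀ (a : R) p, h (op a • p) = op a • h p) :
    BalTensor R P M →+ BalTensor R P' M :=
  liftAdd (mkHom.comp h) (fun a p m => by
    change mk (h (op a • p)) m = mk (h p) (a • m)
    rw [hh, op_smul_mk])

theorem mapAdd_mk (h : P →+ P') (hh : ∀ (a : R) p, h (op a • p) = op a • h p) (p : P) (m : M) :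
    mapAdd (R := R) h hh (mk p m) = mk (h p) m := liftAdd_mk _ _ p m

/-- Functoriality for bimodule homomorphisms. -/
def map (h : P →+ P') (hh : ∀ (a : R) p, h (op a • p) = op a • h p)
    (hR : ∀ (a : R) p, h (a • p) = a • h p) :
    BalTensor R P M →ₗ[R] BalTensor R P' M where
  toFun := mapAdd h hh
  map_add' := map_add _
  map_smul' r x := by
    induction x using induction with
    | zero => simp
    | mk p m => rw [smul_mk, mapAdd_mk, mapAdd_mk, hR]; rfl
    | add x y hx hy => rw [smul_add, map_add, hx, hy, map_add, smul_add]

theorem map_mk (h : P →+ P') (hh : ∀ (a : R) p, h (op a • p) = op a • h p)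
    (hR : ∀ (a : R) p, h (a • p) = a • h p) (p : P) (m : M) :
    map h hh hR (mk p m) = mk (h p) m := mapAdd_mk h hh p m

end BalTensor

end BalTensor

/-! ### Bimodules as left and right modules; the bimodule Hom_K(M, N). -/

section BiHom

variable {K : Type v} [Field K] {A : Type u} [Ring A] [Algebra K A]
  {E : Type u} [Ring E] [Algebra K E]

/-- A module over `E ≅ A ⊗ Aᵒᵖ`, regarded as a bimodule. -/
def AsBimod (_ : A ⊗[K] Aᵐᵒᵖ ≃ₐ[K] E) (Q : Type w) : Type w := Q

namespace AsBimod
variable (θ : A ⊗[K] Aᵐᵒᵖ ≃ₐ[K] E) (Q : Type w) [AddCommGroup Q] [Module E Q]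

instance : AddCommGroup (AsBimod θ Q) := inferInstanceAs (AddCommGroup Q)

instance : Module A (AsBimod θ Q) :=
  Module.compHom Q (θ.toRingEquiv.toRingHom.comp
    (Algebra.TensorProduct.includeLeftRingHom : A →+* A ⊗[K] Aᵐᵒᵖ))

instance : Module Aᵐᵒᵖ (AsBimod θ Q) :=
  Module.compHom Q (θ.toRingEquiv.toRingHom.comp
    ((Algebra.TensorProduct.includeRight : Aᵐᵒᵖ →ₐ[K] A ⊗[K] Aᵐᵒᵖ) : Aᵐᵒᵖ →+* A ⊗[K] Aᵐᵒᵖ))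

/-- The tautological identification. -/
def of : Q ≃+ AsBimod θ Q := AddEquiv.refl Q

variable {Q}

instance : SMulCommClass A Aᵐᵒᵖ (AsBimod θ Q) where
  smul_comm a b q := by
    change θ (a ⊗ₜ 1) • (θ (1 ⊗ₜ b) • (show Q from q)) = θ (1 ⊗ₜ b) • θ (a ⊗ₜ 1) • (show Q from q)
    rw [smul_smul, smul_smul, ← map_mul, ← map_mul]
    simp

end AsBimod

variable {M : Type w} [AddCommGroup M] [Module K M] [Module A M] [IsScalarTower K A M]
  {N : Type w'} [AddCommGroup N] [Module K N] [Module A N] [IsScalarTower K A N]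

/-- The bimodule `Hom_K(M, N)`. -/
def BiHom (_ : A ⊗[K] Aᵐᵒᵖ ≃ₐ[K] E) (M : Type w) [AddCommGroup M] [Module K M]
    (N : Type w') [AddCommGroup N] [Module K N] : Type (max w w') := M →ₗ[K] N

namespace BiHom
variable (θ : A ⊗[K] Aᵐᵒᵖ ≃ₐ[K] E) (M N)

instance : AddCommGroup (BiHom θ M N) := inferInstanceAs (AddCommGroup (M →ₗ[K] N))

/-- The action of `A ⊗ Aᵒᵖ` on `Hom_K(M, N)`. -/
def action : A ⊗[K] Aᵐᵒᵖ →ₐ[K] Module.End K (M →ₗ[K] N) :=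
  Algebra.TensorProduct.lift
    (AlgHom.ofLinearMap ((LinearMap.llcomp K M N N).comp (Algebra.lsmul K K N).toLinearMap)
      (by ext; simp) (by intros; ext; simp))
    (AlgHom.ofLinearMap ((LinearMap.llcomp K M M N).flip.comp
        ((Algebra.lsmul K K M).toLinearMap.comp
          (MulOpposite.opLinearEquiv K : A ≃ₗ[K] Aᵐᵒᵖ).symm.toLinearMap))
      (by ext; simp) (by intros; ext; simp))
    (fun a b => by
      rw [commute_iff_eq]
      ext
      simp)

theorem action_tmul (a b : A) (f : M →ₗ[K] N) (m : M) :
    action M N (a ⊗ₜ[K] op b) f m = a • f (b • m) := by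
  simp [action]

instance : Module E (BiHom θ M N) :=
  Module.compHom (M →ₗ[K] N) ((action M N).comp θ.symm.toAlgHom).toRingHom

variable {M N}

/-- The tautological identification. -/
def toLin : BiHom θ M N ≃+ (M →ₗ[K] N) := AddEquiv.refl _

theorem smul_apply (a b : A) (f : BiHom θ M N) (m : M) :
    toLin θ (θ (a ⊗ₜ[K] op b) • f) m = a • toLin θ f (b • m) := by
  change (action M N) (θ.symm (θ (a ⊗ₜ[K] op b))) (toLin θ f) m = _
  rw [θ.symm_apply_apply, action_tmul]

end BiHom

end BiHom

/-! ### The functor Q ⊗_A M and its adjunction with Hom_K(M, N). -/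

section Tens

variable {K : Type v} [Field K] {A : Type u} [Ring A] [Algebra K A]
  {E : Type u} [Ring E] [Algebra K E] (θ : A ⊗[K] Aᵐᵒᵖ ≃ₐ[K] E)

theorem env_tmul_eq (a : A) (b : Aᵐᵒᵖ) : θ (a ⊗ₜ b) = θ (a ⊗ₜ 1) * θ (1 ⊗ₜ b) := by
  rw [← map_mul, Algebra.TensorProduct.tmul_mul_tmul, mul_one, one_mul]

theorem env_algebraMap (k : K) :
    θ (1 ⊗ₜ op (algebraMap K A k)) = θ (algebraMap K A k ⊗ₜ 1) := by
  congr 1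
  rw [Algebra.algebraMap_eq_smul_one, TensorProduct.smul_tmul, MulOpposite.op_smul]
  rfl

variable (Q : Type u) [AddCommGroup Q] [Module E Q] {Q' : Type u} [AddCommGroup Q'] [Module E Q']
  (M : Type u) [AddCommGroup M] [Module A M]

/-- The tensor product `Q ⊗_A M` of a bimodule `Q` and an `A`-module `M`. -/
abbrev Tens : Type u := BalTensor A (AsBimod θ Q) M

variable {Q M}

/-- Pure tensors. -/
def tens (q : Q) (m : M) : Tens θ Q M := BalTensor.mk (AsBimod.of θ Q q) m

theorem tens_add (q : Q) (m m' : M) : tens θ q (m + m') = tens θ q m + tens θ q m' :=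
  BalTensor.mk_add _ _ _

theorem add_tens (q q' : Q) (m : M) : tens θ (q + q') m = tens θ q m + tens θ q' m :=
  BalTensor.add_mk (R := A) (AsBimod.of θ Q q) (AsBimod.of θ Q q') m

theorem smul_tens (a : A) (q : Q) (m : M) : a • tens θ q m = tens θ (θ (a ⊗ₜ 1) • q) m := rfl

theorem tens_smul (a : A) (q : Q) (m : M) : tens θ q (a • m) = tens θ (θ (1 ⊗ₜ op a) • q) m :=
  (BalTensor.op_smul_mk a (AsBimod.of θ Q q) m).symm

/-- Functoriality of the tensor product in the bimodule. -/
def tensMap (M : Type u) [AddCommGroup M] [Module A M] (h : Q →ₗ[E] Q') :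
    Tens θ Q M →ₗ[A] Tens θ Q' M :=
  BalTensor.map (P := AsBimod θ Q) (P' := AsBimod θ Q') h.toAddMonoidHom
    (fun a q => h.map_smul (θ (1 ⊗ₜ op a)) q) (fun a q => h.map_smul (θ (a ⊗ₜ 1)) q)

theorem tensMap_tens (h : Q →ₗ[E] Q') (q : Q) (m : M) :
    tensMap θ M h (tens θ q m) = tens θ (h q) m :=
  BalTensor.map_mk (P := AsBimod θ Q) (P' := AsBimod θ Q') h.toAddMonoidHom
    (fun a q => h.map_smul (θ (1 ⊗ₜ op a)) q) (fun a q => h.map_smul (θ (a ⊗ₜ 1)) q) _ m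

variable {N : Type u} [AddCommGroup N] [Module A N]

theorem tens_hom_ext {f g : Tens θ Q M →ₗ[A] N} (h : ∀ q m, f (tens θ q m) = g (tens θ q m)) :
    f = g := by
  ext x
  induction x using BalTensor.induction with
  | zero => simp
  | mk p m => exact h p m
  | add x y hx hy => rw [map_add, hx, hy, map_add]

section Adjunction

variable [Module K M] [IsScalarTower K A M] [Module K N] [IsScalarTower K A N]

/-- The bimodule homomorphism corresponding to a homomorphism `Q ⊗_A M → N`. -/
def toBi (f : Tens θ Q M →ₗ[A] N) : Q →ₗ[E] BiHom θ M N where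
  toFun q := (BiHom.toLin θ).symm
    { toFun := fun m => f (tens θ q m)
      map_add' := fun m m' => by rw [tens_add, map_add]
      map_smul' := fun k m => by
        rw [← algebraMap_smul A k m, tens_smul, env_algebraMap, ← smul_tens, map_smul,
          algebraMap_smul, RingHom.id_apply] }
  map_add' q q' := by
    apply (BiHom.toLin θ).injective
    ext m
    change f (tens θ (q + q') m) = f (tens θ q m) + f (tens θ q' m)
    rw [add_tens, map_add]
  map_smul' e q := by
    obtain ⟨t, rfl⟩ := θ.surjective e
    induction t with
    | zero =>
      apply (BiHom.toLin θ).injective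
      ext m
      simp only [map_zero, zero_smul]
      change f (tens θ (0 : Q) m) = 0
      have : tens θ (0 : Q) m = 0 := by simpa using add_tens θ (0 : Q) 0 m
      rw [this, map_zero]
    | tmul a b =>
      obtain ⟨b, rfl⟩ := MulOpposite.op_surjective b
      apply (BiHom.toLin θ).injective
      ext m
      rw [RingHom.id_apply, BiHom.smul_apply]
      change f (tens θ (θ (a ⊗ₜ op b) • q) m) = a • f (tens θ q (b • m))
      rw [tens_smul, ← map_smul, smul_tens, smul_smul, ← env_tmul_eq]
    | add s t hs ht =>
      rw [RingHom.id_apply] at hs ht ⊢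
      rw [map_add, add_smul _ _ ((BiHom.toLin θ).symm _), ← hs, ← ht]
      apply (BiHom.toLin θ).injective
      ext m
      change f (tens θ ((θ s + θ t) • q) m) =
        f (tens θ (θ s • q) m) + f (tens θ (θ t • q) m)
      rw [add_smul, add_tens, map_add]

theorem toBi_apply (f : Tens θ Q M →ₗ[A] N) (q : Q) (m : M) :
    BiHom.toLin θ (toBi θ f q) m = f (tens θ q m) := rfl

/-- The homomorphism `Q ⊗_A M → N` corresponding to a bimodule homomorphism. -/
def ofBi (φ : Q →ₗ[E] BiHom θ M N) : Tens θ Q M →ₗ[A] N :=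
  BalTensor.lift (P := AsBimod θ Q)
    (AddMonoidHom.mk' (fun q => (BiHom.toLin θ (φ q)).toAddMonoidHom)
      (fun q q' => by ext m; exact congrArg (fun t => BiHom.toLin θ t m) (φ.map_add q q')))
    (fun a q m => by
      change BiHom.toLin θ (φ (θ (1 ⊗ₜ op a) • (show Q from q))) m =
        BiHom.toLin θ (φ (show Q from q)) (a • m)
      rw [map_smul, BiHom.smul_apply, one_smul])
    (fun a q m => by
      change BiHom.toLin θ (φ (θ (a ⊗ₜ op 1) • (show Q from q))) m =
        a • BiHom.toLin θ (φ (show Q from q)) m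
      rw [map_smul, BiHom.smul_apply, one_smul])

theorem ofBi_tens (φ : Q →ₗ[E] BiHom θ M N) (q : Q) (m : M) :
    ofBi θ φ (tens θ q m) = BiHom.toLin θ (φ q) m :=
  BalTensor.lift_mk (P := AsBimod θ Q) _ _ _ _ m

theorem toBi_ofBi (φ : Q →ₗ[E] BiHom θ M N) : toBi θ (ofBi θ φ) = φ := by
  ext q
  apply (BiHom.toLin θ).injective
  ext m
  rw [toBi_apply, ofBi_tens]

theorem ofBi_toBi (f : Tens θ Q M →ₗ[A] N) : ofBi θ (toBi θ f) = f :=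
  tens_hom_ext θ fun q m => by rw [ofBi_tens, toBi_apply]

theorem toBi_comp_tensMap (f : Tens θ Q' M →ₗ[A] N) (h : Q →ₗ[E] Q') :
    toBi θ (f ∘ₗ tensMap θ M h) = toBi θ f ∘ₗ h := by
  ext q
  apply (BiHom.toLin θ).injective
  ext m
  rw [toBi_apply, LinearMap.comp_apply, tensMap_tens]
  rfl

theorem ofBi_comp (φ : Q' →ₗ[E] BiHom θ M N) (h : Q →ₗ[E] Q') :
    ofBi θ (φ ∘ₗ h) = ofBi θ φ ∘ₗ tensMap θ M h :=
  tens_hom_ext θ fun q m => by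
    rw [ofBi_tens, LinearMap.comp_apply, LinearMap.comp_apply, tensMap_tens, ofBi_tens]

namespace BiHom

variable {N' : Type u} [AddCommGroup N'] [Module A N'] [Module K N'] [IsScalarTower K A N']
  (M)

/-- Functoriality of `Hom_K(M, N)` in `N`. -/
def post (g : N →ₗ[A] N') : BiHom θ M N →ₗ[E] BiHom θ M N' where
  toFun f := (toLin θ).symm (g.restrictScalars K ∘ₗ toLin θ f)
  map_add' f f' := by
    apply (toLin θ).injective
    ext m
    simp
  map_smul' e f := by
    obtain ⟨t, rfl⟩ := θ.surjective e
    apply (toLin θ).injective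
    rw [AddEquiv.apply_symm_apply]
    induction t with
    | zero => ext; simp
    | tmul a b =>
      obtain ⟨b, rfl⟩ := MulOpposite.op_surjective b
      ext m
      rw [RingHom.id_apply, LinearMap.comp_apply, BiHom.smul_apply, BiHom.smul_apply]
      simp
    | add s t hs ht =>
      rw [RingHom.id_apply] at hs ht ⊢
      rw [map_add, add_smul, map_add, LinearMap.comp_add, hs, ht, add_smul, map_add]

theorem post_apply (g : N →ₗ[A] N') (f : BiHom θ M N) (m : M) :
    toLin θ (post θ M g f) m = g (toLin θ f m) := rfl

/-- A surjection of A-modules has a K-linear section, K being a field. -/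
theorem post_surjective (g : N →ₗ[A] N') (hg : Function.Surjective g) :
    Function.Surjective (post θ M g) := by
  intro f
  obtain ⟨s, hs⟩ := (g.restrictScalars K).exists_rightInverse_of_surjective
    (LinearMap.range_eq_top.2 hg)
  refine ⟨(toLin θ).symm (s ∘ₗ toLin θ f), ?_⟩
  apply (toLin θ).injective
  ext m
  rw [post_apply]
  exact LinearMap.congr_fun hs (toLin θ f m)

end BiHom

end Adjunction

/-- Maps from Q ⊗_A M to a module are bimodule maps from Q to Hom_K(M, -), and both Hom_K(M, -) and
maps out of Q preserve surjections. -/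
theorem projective_tens (M : Type u) [AddCommGroup M] [Module A M] [Module K M]
    [IsScalarTower K A M] (Q : Type u) [AddCommGroup Q] [Module E Q] [Module.Projective E Q] :
    Module.Projective A (Tens θ Q M) := by
  refine Module.Projective.of_lifting_property'' fun f hf => ?_
  let _ : Module K (Tens θ Q M) := Module.compHom _ (algebraMap K A)
  have : IsScalarTower K A (Tens θ Q M) := IsScalarTower.of_algebraMap_smul fun _ _ => rfl
  obtain ⟨h, hh⟩ := Module.projective_lifting_property (BiHom.post θ M f)
    (toBi θ (LinearMap.id (M := Tens θ Q M))) (BiHom.post_surjective θ M f hf)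
  refine ⟨ofBi θ h, tens_hom_ext θ fun q m => ?_⟩
  rw [LinearMap.comp_apply, ofBi_tens, ← BiHom.post_apply]
  exact congrArg (fun t => BiHom.toLin θ t m) (LinearMap.congr_fun hh q)

theorem finite_tens (M : Type u) [AddCommGroup M] [Module A M] [Module K M]
    [IsScalarTower K A M] [Module.Finite K M] (Q : Type u) [AddCommGroup Q] [Module E Q]
    [Module.Finite E Q] : Module.Finite A (Tens θ Q M) := by
  classical
  obtain ⟨s, hs⟩ := Module.Finite.fg_top (R := E) (M := Q)
  obtain ⟨t, ht⟩ := Module.Finite.fg_top (R := K) (M := M)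
  refine ⟨⟨Finset.image₂ (tens θ) s t, ?_⟩⟩
  rw [eq_top_iff]
  set W := Submodule.span A (Finset.image₂ (tens θ) s t : Set (Tens θ Q M)) with hW
  have h1 : ∀ q ∈ s, ∀ m : M, tens θ q m ∈ W := by
    intro q hq m
    have hm : m ∈ Submodule.span K (t : Set M) := ht ▸ Submodule.mem_top
    induction hm using Submodule.span_induction with
    | mem m hm => exact Submodule.subset_span (Finset.mem_coe.2 (Finset.mem_image₂_of_mem hq hm))
    | zero =>
      have : tens θ q (0 : M) = 0 := by simpa using tens_add θ q (0 : M) 0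
      rw [this]
      exact zero_mem _
    | add m m' _ _ h h' => rw [tens_add]; exact add_mem h h'
    | smul k m _ h =>
      rw [← algebraMap_smul A k m, tens_smul, env_algebraMap, ← smul_tens]
      exact W.smul_mem _ h
  -- The right action on a bimodule generator is absorbed into m, which is why the claim is kept for
  -- all m during the induction on q.
  have h2 : ∀ (q : Q) (m : M), tens θ q m ∈ W := by
    intro q
    have hq : q ∈ Submodule.span E (s : Set Q) := hs ▸ Submodule.mem_top
    induction hq using Submodule.span_induction with
    | mem q hq => exact h1 q hq
    | zero =>
      intro m
      have : tens θ (0 : Q) m = 0 := by simpa using add_tens θ (0 : Q) 0 m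
      rw [this]
      exact zero_mem _
    | add q q' _ _ h h' => intro m; rw [add_tens]; exact add_mem (h m) (h' m)
    | smul e q _ h =>
      obtain ⟨e, rfl⟩ := θ.surjective e
      induction e with
      | zero =>
        intro m
        have : tens θ (0 : Q) m = 0 := by simpa using add_tens θ (0 : Q) 0 m
        rw [map_zero, zero_smul, this]
        exact zero_mem _
      | tmul a b =>
        obtain ⟨b, rfl⟩ := MulOpposite.op_surjective b
        intro m
        rw [env_tmul_eq, mul_smul, ← smul_tens, ← tens_smul]
        exact W.smul_mem _ (h _)
      | add x y hx hy => intro m; rw [map_add, add_smul, add_tens]; exact add_mem (hx m) (hy m)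
  intro x _
  induction x using BalTensor.induction with
  | zero => exact zero_mem _
  | mk p m => exact h2 p m
  | add x y hx hy => exact add_mem (hx Submodule.mem_top) (hy Submodule.mem_top)

/-- Projective bimodules are projective as right modules. -/
theorem projective_right (Q : Type u) [AddCommGroup Q] [Module E Q] [Module.Projective E Q] :
    Module.Projective Aᵐᵒᵖ (AsBimod θ Q) := by
  -- As a right module the enveloping algebra is the base change of the K-vector space A, hence
  -- free.
  let e : Aᵐᵒᵖ ⊗[K] A ≃ₗ[Aᵐᵒᵖ] AsBimod θ E :=
    { ((TensorProduct.comm K Aᵐᵒᵖ A).toAddEquiv.trans θ.toAddEquiv).trans (AsBimod.of θ E) with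
      map_smul' := fun a x => by
        change θ (TensorProduct.comm K Aᵐᵒᵖ A (a • x)) =
          θ (1 ⊗ₜ a) * θ (TensorProduct.comm K Aᵐᵒᵖ A x)
        rw [← map_mul]
        congr 1
        induction x with
        | zero => simp
        | tmul b c => simp [TensorProduct.smul_tmul']
        | add x y hx hy => rw [smul_add, map_add, hx, hy, map_add, mul_add] }
  have : Module.Projective Aᵐᵒᵖ (AsBimod θ E) := Module.Projective.of_equiv e
  obtain ⟨s, hs⟩ := Module.projective_def'.1 (inferInstance : Module.Projective E Q)
  let i : AsBimod θ Q →ₗ[Aᵐᵒᵖ] (Q →₀ AsBimod θ E) :=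
    { toFun := fun q => (s q : Q →₀ E)
      map_add' := fun q q' => s.map_add q q'
      map_smul' := fun a q => s.map_smul (θ (1 ⊗ₜ a)) q }
  let p : (Q →₀ AsBimod θ E) →ₗ[Aᵐᵒᵖ] AsBimod θ Q :=
    { toFun := fun x => Finsupp.linearCombination E (id : Q → Q) (show Q →₀ E from x)
      map_add' := fun q q' => (Finsupp.linearCombination E (id : Q → Q)).map_add (show Q →₀ E from q) q'
      map_smul' := fun a q =>
        (Finsupp.linearCombination E (id : Q → Q)).map_smul (θ (1 ⊗ₜ a)) (show Q →₀ E from q) }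
  have : Module.Projective Aᵐᵒᵖ (Q →₀ AsBimod θ E) := by
    classical
    exact Module.Projective.of_equiv (finsuppLequivDFinsupp Aᵐᵒᵖ (ι := Q) (M := AsBimod θ E)).symm
  exact Module.Projective.of_split i p (LinearMap.ext fun q => LinearMap.congr_fun hs q)

end Tens

/-! ### Exactness of the resolution tensored with a module. -/

section Tens

variable {K : Type v} [Field K] {A : Type u} [Ring A] [Algebra K A]
  {E : Type u} [Ring E] [Algebra K E] {θ : A ⊗[K] Aᵐᵒᵖ ≃ₐ[K] E}

/-- The right linear map underlying a bimodule homomorphism. -/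
def AsBimod.mapRight (θ : A ⊗[K] Aᵐᵒᵖ ≃ₐ[K] E) {Q Q' : Type u} [AddCommGroup Q] [Module E Q]
    [AddCommGroup Q'] [Module E Q'] (h : Q →ₗ[E] Q') : AsBimod θ Q →ₗ[Aᵐᵒᵖ] AsBimod θ Q' where
  toFun := h
  map_add' := h.map_add
  map_smul' a q := h.map_smul (θ (1 ⊗ₜ a)) q

namespace CYResolution

variable (P : CYResolution θ)

/-- The augmented complex of bimodules `P₂ → P₁ → P₀ → A` is contractible as a complex of right
modules. -/
theorem exists_homotopy : ∃ (p₀ : P.P₀) (h₀ : AsBimod θ P.P₀ →ₗ[Aᵐᵒᵖ] AsBimod θ P.P₁)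
    (h₁ : AsBimod θ P.P₁ →ₗ[Aᵐᵒᵖ] AsBimod θ P.P₂), P.ε p₀ = 1 ∧
    (∀ x : P.P₀, P.d₁ (h₀ x) = x - θ (1 ⊗ₜ op (P.ε x)) • p₀) ∧
    (∀ x : P.P₁, P.d₂ (h₁ x) = x - (show P.P₁ from h₀ (P.d₁ x))) := by
  obtain ⟨p₀, hp₀⟩ := P.surjective_ε 1
  have hε : ∀ (a : Aᵐᵒᵖ) (x : P.P₀), P.ε (θ (1 ⊗ₜ a) • x) = P.ε x * unop a := fun a x => by
    have := P.ε_smul 1 (unop a) x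
    rwa [one_mul] at this
  let d₁' := AsBimod.mapRight θ P.d₁
  let d₂' := AsBimod.mapRight θ P.d₂
  -- The map x ↦ x - p₀ ε(x) subtracts the right linear section a ↦ p₀a of the augmentation, so it
  -- lands in ker ε = im d₁ and lifts along d₁ because P₀ is projective on the right.
  let k : AsBimod θ P.P₀ →ₗ[Aᵐᵒᵖ] AsBimod θ P.P₀ :=
    { toFun := fun x => (show P.P₀ from x) - θ (1 ⊗ₜ op (P.ε x)) • p₀
      map_add' := fun x y => by
        change ((show P.P₀ from x) + (show P.P₀ from y)) -
          θ (1 ⊗ₜ op (P.ε ((show P.P₀ from x) + (show P.P₀ from y)))) • p₀ =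
          ((show P.P₀ from x) - θ (1 ⊗ₜ op (P.ε x)) • p₀) +
            ((show P.P₀ from y) - θ (1 ⊗ₜ op (P.ε y)) • p₀)
        rw [map_add, MulOpposite.op_add, TensorProduct.tmul_add, map_add, add_smul]
        abel
      map_smul' := fun a x => by
        change θ (1 ⊗ₜ a) • (show P.P₀ from x) -
          θ (1 ⊗ₜ op (P.ε (θ (1 ⊗ₜ a) • (show P.P₀ from x)))) • p₀ =
          θ (1 ⊗ₜ a) • ((show P.P₀ from x) - θ (1 ⊗ₜ op (P.ε x)) • p₀)
        rw [hε, smul_sub, smul_smul, ← map_mul, Algebra.TensorProduct.tmul_mul_tmul, one_mul,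
          MulOpposite.op_mul, MulOpposite.op_unop] }
  have hk : ∀ x, k x ∈ LinearMap.range d₁' := by
    intro x
    refine (P.exact₀ _).1 ?_
    change P.ε ((show P.P₀ from x) - θ (1 ⊗ₜ op (P.ε x)) • p₀) = 0
    rw [map_sub, hε, hp₀]
    simp
  have := P.projective₀
  have := projective_right θ P.P₀
  obtain ⟨h₀, hh₀⟩ := Module.projective_lifting_property d₁'.rangeRestrict
    (k.codRestrict _ hk) d₁'.surjective_rangeRestrict
  have e₀ : ∀ x : P.P₀, P.d₁ (h₀ x) = x - θ (1 ⊗ₜ op (P.ε x)) • p₀ := fun x =>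
    congrArg Subtype.val (LinearMap.congr_fun hh₀ (AsBimod.of θ P.P₀ x))
  let l : AsBimod θ P.P₁ →ₗ[Aᵐᵒᵖ] AsBimod θ P.P₁ := LinearMap.id - h₀ ∘ₗ d₁'
  have hl : ∀ x, l x ∈ LinearMap.range d₂' := by
    intro x
    refine (P.exact₁ _).1 ?_
    change P.d₁ ((show P.P₁ from x) - (show P.P₁ from h₀ (P.d₁ x))) = 0
    rw [map_sub]
    have h1 := e₀ (P.d₁ x)
    have h2 : P.ε (P.d₁ x) = 0 := (P.exact₀ _).2 ⟨_, rfl⟩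
    rw [h2] at h1
    simp only [MulOpposite.op_zero, TensorProduct.tmul_zero, map_zero, zero_smul, sub_zero] at h1
    exact sub_eq_zero.2 h1.symm
  let e := LinearEquiv.ofInjective d₂' P.injective_d₂
  refine ⟨p₀, h₀, e.symm.toLinearMap ∘ₗ l.codRestrict _ hl, hp₀, e₀, ?_⟩
  intro x
  exact congrArg Subtype.val
    (e.apply_symm_apply (l.codRestrict _ hl (AsBimod.of θ P.P₁ x)))

variable (M : Type u) [AddCommGroup M] [Module A M]

/-- The augmentation `P₀ ⊗_A M → M`. -/
def tensAug : Tens θ P.P₀ M →ₗ[A] M :=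
  BalTensor.lift (P := AsBimod θ P.P₀)
    (AddMonoidHom.mk' (fun q => AddMonoidHom.mk' (fun m => P.ε q • m) (smul_add _))
      (fun q q' => by
        ext m
        change P.ε ((show P.P₀ from q) + (show P.P₀ from q')) • m = P.ε q • m + P.ε q' • m
        rw [map_add, add_smul]))
    (fun a q m => by
      change P.ε (θ (1 ⊗ₜ op a) • (show P.P₀ from q)) • m = P.ε q • a • m
      rw [P.ε_smul, one_mul, mul_smul])
    (fun a q m => by
      change P.ε (θ (a ⊗ₜ op 1) • (show P.P₀ from q)) • m = a • P.ε q • m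
      rw [P.ε_smul, mul_one, mul_smul])

variable {M} in
theorem tensAug_tens (q : P.P₀) (m : M) : P.tensAug M (tens θ q m) = P.ε q • m :=
  BalTensor.lift_mk (P := AsBimod θ P.P₀) _ _ _ _ m

/-- A contracting homotopy by right linear maps survives - ⊗_A M, although only as additive maps;
this is enough for exactness. -/
theorem tens_exact : Function.Injective (tensMap θ M P.d₂) ∧
    Function.Exact (tensMap θ M P.d₂) (tensMap θ M P.d₁) ∧
    Function.Exact (tensMap θ M P.d₁) (P.tensAug M) ∧ Function.Surjective (P.tensAug M) := by
  obtain ⟨p₀, h₀, h₁, hp₀, e₀, e₁⟩ := P.exists_homotopy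
  let H₀ : Tens θ P.P₀ M →+ Tens θ P.P₁ M :=
    BalTensor.mapAdd h₀.toAddMonoidHom fun a p => h₀.map_smul (op a) p
  let H₁ : Tens θ P.P₁ M →+ Tens θ P.P₂ M :=
    BalTensor.mapAdd h₁.toAddMonoidHom fun a p => h₁.map_smul (op a) p
  have hH₀ : ∀ (q : P.P₀) (m : M), H₀ (tens θ q m) = tens θ (Q := P.P₁) (h₀ q) m :=
    fun q m => BalTensor.mapAdd_mk _ _ _ _
  have hH₁ : ∀ (q : P.P₁) (m : M), H₁ (tens θ q m) = tens θ (Q := P.P₂) (h₁ q) m :=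
    fun q m => BalTensor.mapAdd_mk _ _ _ _
  have sub_tens : ∀ {Q : Type u} [AddCommGroup Q] [Module E Q] (q q' : Q) (m : M),
      tens θ (q - q') m = tens θ q m - tens θ q' m := fun q q' m => by
    rw [eq_sub_iff_add_eq, ← add_tens, sub_add_cancel]
  have r₀ : ∀ x, tensMap θ M P.d₁ (H₀ x) = x - tens θ p₀ (P.tensAug M x) := by
    intro x
    induction x using BalTensor.induction with
    | zero =>
      have : tens θ p₀ (0 : M) = 0 := by simpa using tens_add θ p₀ (0 : M) 0
      simp [this]
    | mk q m =>
      refine (congrArg _ (hH₀ q m)).trans ((tensMap_tens θ P.d₁ _ m).trans ?_)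
      refine (congrArg (fun t => tens θ t m) (e₀ q)).trans ?_
      refine (sub_tens _ _ m).trans ?_
      rw [← tens_smul]
      refine congrArg₂ _ rfl ?_
      exact congrArg (tens θ p₀) (P.tensAug_tens q m).symm
    | add x y hx hy => rw [map_add, map_add, hx, hy, map_add, tens_add]; abel
  have r₁ : ∀ x, tensMap θ M P.d₂ (H₁ x) = x - H₀ (tensMap θ M P.d₁ x) := by
    intro x
    induction x using BalTensor.induction with
    | zero => simp
    | mk q m =>
      refine (congrArg _ (hH₁ q m)).trans ((tensMap_tens θ P.d₂ _ m).trans ?_)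
      refine (congrArg (fun t => tens θ t m) (e₁ q)).trans ?_
      refine (sub_tens _ _ m).trans ?_
      refine congrArg₂ _ rfl ?_
      exact ((congrArg H₀ (tensMap_tens θ P.d₁ q m)).trans (hH₀ _ m)).symm
    | add x y hx hy => rw [map_add, map_add, hx, hy, map_add, map_add]; abel
  have r₂ : ∀ x, H₁ (tensMap θ M P.d₂ x) = x := by
    intro x
    induction x using BalTensor.induction with
    | zero => simp
    | mk q m =>
      refine (congrArg _ (tensMap_tens θ P.d₂ q m)).trans ((hH₁ _ m).trans ?_)
      refine congrArg (fun t => tens θ t m) ?_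
      apply P.injective_d₂
      refine (e₁ _).trans ?_
      rw [(P.exact₁ _).2 ⟨q, rfl⟩]
      erw [map_zero h₀]
      exact sub_zero _
    | add x y hx hy => rw [map_add, map_add, hx, hy]
  have c₁ : tensMap θ M P.d₁ ∘ₗ tensMap θ M P.d₂ = 0 := tens_hom_ext θ fun q m => by
    rw [LinearMap.comp_apply, tensMap_tens, tensMap_tens, (P.exact₁ _).2 ⟨q, rfl⟩]
    simpa using add_tens θ (0 : P.P₀) 0 m
  have c₀ : P.tensAug M ∘ₗ tensMap θ M P.d₁ = 0 := tens_hom_ext θ fun q m => by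
    rw [LinearMap.comp_apply, tensMap_tens, tensAug_tens, (P.exact₀ _).2 ⟨q, rfl⟩]
    simp
  refine ⟨fun x y h => by rw [← r₂ x, h, r₂ y], fun x => ⟨fun hx => ⟨H₁ x, ?_⟩, ?_⟩,
    fun x => ⟨fun hx => ⟨H₀ x, ?_⟩, ?_⟩, fun m => ⟨tens θ p₀ m, ?_⟩⟩
  · rw [r₁, hx, map_zero, sub_zero]
  · rintro ⟨y, rfl⟩
    exact LinearMap.congr_fun c₁ y
  · have : tens θ p₀ (0 : M) = 0 := by simpa using tens_add θ p₀ (0 : M) 0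
    rw [r₀, hx, this, sub_zero]
  · rintro ⟨y, rfl⟩
    exact LinearMap.congr_fun c₀ y
  · rw [tensAug_tens, hp₀, one_smul]

end CYResolution
end Tens

/-! ### Trace duality between Hom_K(M, N) modulo commutators and Hom_A(N, M). -/

section Duality

variable {K : Type v} [Field K] {A : Type u} [Ring A] [Algebra K A]
  {E : Type u} [Ring E] [Algebra K E] {θ : A ⊗[K] Aᵐᵒᵖ ≃ₐ[K] E}
  {M : Type u} [AddCommGroup M] [Module A M] [Module K M] [IsScalarTower K A M]
  {N : Type u} [AddCommGroup N] [Module A N] [Module K N] [IsScalarTower K A N]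

/-- Cyclicity of the trace: for A-linear g, tr(g a y) = tr(a g y) = tr(g y a). -/
theorem trace_comp_eq_zero_of_mem_commutators {x : BiHom θ M N}
    (hx : x ∈ commutators θ (BiHom θ M N))
    (g : N →ₗ[A] M) : LinearMap.trace K M (g.restrictScalars K ∘ₗ BiHom.toLin θ x) = 0 := by
  induction hx using AddSubgroup.closure_induction with
  | mem x hx =>
    obtain ⟨a, y, rfl⟩ := hx
    have h1 : g.restrictScalars K ∘ₗ BiHom.toLin θ (θ (a ⊗ₜ 1) • y) =
        Algebra.lsmul K K M a * (g.restrictScalars K ∘ₗ BiHom.toLin θ y) := by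
      ext m
      simpa using congrArg g (BiHom.smul_apply θ a 1 y m)
    have h2 : g.restrictScalars K ∘ₗ BiHom.toLin θ (θ (1 ⊗ₜ op a) • y) =
        (g.restrictScalars K ∘ₗ BiHom.toLin θ y) * Algebra.lsmul K K M a := by
      ext m
      simpa using congrArg g (BiHom.smul_apply θ 1 a y m)
    rw [map_sub, LinearMap.comp_sub, map_sub, h1, h2, LinearMap.trace_mul_comm, sub_self]
  | zero => simp
  | add x y _ _ hx hy => rw [map_add, LinearMap.comp_add, map_add, hx, hy, add_zero]
  | neg x _ hx => rw [map_neg, LinearMap.comp_neg, map_neg, hx, neg_zero]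

theorem trace_comp_toSpanSingleton [Module.Finite K M] (g : N →ₗ[K] M) (ν : M →ₗ[K] K) (n : N) :
    LinearMap.trace K M (g ∘ₗ ν.smulRight n) = ν (g n) := by
  have : g ∘ₗ ν.smulRight n = dualTensorHom K M M (ν ⊗ₜ g n) := by
    ext m
    simp
  rw [this, LinearMap.trace_eq_contract_apply, contractLeft_apply]

/-- The commutators are defined as an additive subgroup only; stability under K makes them a
subspace, so that linear functionals separate points from them. -/
theorem smul_mem_commutators (k : K) {x : BiHom θ M N} (hx : x ∈ commutators θ (BiHom θ M N)) :
    (BiHom.toLin θ).symm (k • BiHom.toLin θ x) ∈ commutators θ (BiHom θ M N) := by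
  induction hx using AddSubgroup.closure_induction with
  | mem x hx =>
    obtain ⟨a, y, rfl⟩ := hx
    convert mem_commutators θ a ((BiHom.toLin θ).symm (k • BiHom.toLin θ y)) using 1
    apply (BiHom.toLin θ).injective
    ext m
    rw [map_sub, map_sub, AddEquiv.apply_symm_apply, LinearMap.sub_apply, LinearMap.smul_apply,
      LinearMap.sub_apply]
    have h1 := BiHom.smul_apply θ a 1 y m
    have h2 := BiHom.smul_apply θ 1 a y m
    have h3 := BiHom.smul_apply θ a 1 ((BiHom.toLin θ).symm (k • BiHom.toLin θ y)) m
    have h4 := BiHom.smul_apply θ 1 a ((BiHom.toLin θ).symm (k • BiHom.toLin θ y)) m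
    rw [MulOpposite.op_one] at h1 h3
    rw [h1, h2, h3, h4]
    simp only [one_smul, AddEquiv.apply_symm_apply, LinearMap.smul_apply, smul_comm a k, smul_sub]
  | zero => simp
  | add x y _ _ hx hy =>
    rw [map_add, smul_add, map_add]
    exact add_mem hx hy
  | neg x _ hx =>
    rw [map_neg, smul_neg, map_neg]
    exact neg_mem hx

/-- For finite-dimensional M every functional on Hom_K(M, N) is y ↦ tr(g y) for some K-linear g : N
→ M. If it kills the commutators then g is A-linear, so a functional separating x from the
commutators contradicts the assumption. -/
theorem mem_commutators_of_trace [Module.Finite K M] {x : BiHom θ M N}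
    (hx : ∀ g : N →ₗ[A] M, LinearMap.trace K M (g.restrictScalars K ∘ₗ BiHom.toLin θ x) = 0) :
    x ∈ commutators θ (BiHom θ M N) := by
  let C : Submodule K (M →ₗ[K] N) :=
    { carrier := {y | (BiHom.toLin θ).symm y ∈ commutators θ (BiHom θ M N)}
      add_mem' := fun {a b} ha hb => by
        rw [Set.mem_ofPred_eq, map_add]
        exact add_mem ha hb
      zero_mem' := by simp
      smul_mem' := fun k y hy => smul_mem_commutators k hy }
  by_contra hxC
  obtain ⟨l, hl, hlC⟩ := Submodule.exists_le_ker_of_notMem (p := C) (v := BiHom.toLin θ x) hxC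
  have hC : ∀ (a : A) (y : M →ₗ[K] N),
      l (Algebra.lsmul K K N a ∘ₗ y) = l (y ∘ₗ Algebra.lsmul K K M a) := by
    intro a y
    rw [← sub_eq_zero, ← map_sub]
    refine hlC ?_
    change (BiHom.toLin θ).symm _ ∈ commutators θ (BiHom θ M N)
    convert mem_commutators θ a ((BiHom.toLin θ).symm y) using 1
    apply (BiHom.toLin θ).injective
    ext m
    have h1 := BiHom.smul_apply θ a 1 ((BiHom.toLin θ).symm y) m
    have h2 := BiHom.smul_apply θ 1 a ((BiHom.toLin θ).symm y) m
    rw [MulOpposite.op_one] at h1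
    rw [map_sub, LinearMap.sub_apply, h1, h2]
    simp
  let b := Module.finBasis K M
  -- In a basis b_i of M, the i-th coordinate of g₀(n) is the value of l on the rank-one map b_i* ⊗
  -- n; expanding y in such maps gives tr(g₀ y) = l(y).
  let g₀ : N →ₗ[K] M := ∑ i, (l ∘ₗ LinearMap.smulRightₗ (b.coord i)).smulRight (b i)
  have hg₀ : ∀ y : M →ₗ[K] N, LinearMap.trace K M (g₀ ∘ₗ y) = l y := by
    intro y
    rw [LinearMap.trace_eq_matrix_trace K b, Matrix.trace]
    have hy : y = ∑ i, (b.coord i).smulRight (y (b i)) := by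
      refine b.ext fun j => ?_
      simp [Finsupp.single_apply]
    conv_rhs => rw [hy, map_sum]
    refine Finset.sum_congr rfl fun i _ => ?_
    simp [LinearMap.toMatrix_apply, g₀, Finsupp.single_apply]
  let g : N →ₗ[A] M :=
    { g₀ with
      map_smul' := fun a n => by
        change g₀ (a • n) = a • g₀ n
        refine (Module.forall_dual_apply_eq_zero_iff K (g₀ (a • n) - a • g₀ n)).1 (fun ν => ?_) |>
          sub_eq_zero.1
        -- On the rank-one map ν ⊗ n the invariance of l reads ν(g₀(an)) = ν(a g₀(n)); the
        -- functionals ν separate points of M.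
        have h1 := hC a (ν.smulRight n)
        rw [← hg₀, ← hg₀] at h1
        rw [map_sub, sub_eq_zero]
        have e1 : (Algebra.lsmul K K N a ∘ₗ ν.smulRight n) = ν.smulRight (a • n) := by
          ext m
          exact smul_comm a (ν m) n
        have e2 : LinearMap.trace K M (g₀ ∘ₗ ν.smulRight n ∘ₗ Algebra.lsmul K K M a) =
            ν (a • g₀ n) := by
          rw [← LinearMap.comp_assoc, ← Module.End.mul_eq_comp, LinearMap.trace_mul_comm,
            Module.End.mul_eq_comp, ← LinearMap.comp_assoc, trace_comp_toSpanSingleton]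
          simp
        rw [e1, trace_comp_toSpanSingleton] at h1
        rw [h1, e2] }
  have := hx g
  have e : g.restrictScalars K = g₀ := rfl
  rw [e, hg₀] at this
  exact hl this

namespace CYResolution
variable (P : CYResolution θ)

/-- The map `Ext²(M, N) → Ext²(M, N')` is injective if all homomorphisms `N → M` factor through
`N'`, in terms of the resolution of `M`. -/
theorem exists_extension_of_comp [Module.Finite K M] {N' : Type u} [AddCommGroup N'] [Module A N']
    [Module K N'] [IsScalarTower K A N'] (q : N →ₗ[A] N')
    (hq : ∀ g : N →ₗ[A] M, ∃ g' : N' →ₗ[A] M, g' ∘ₗ q = g) (f : Tens θ P.P₂ M →ₗ[A] N)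
    (hf : ∃ ψ : Tens θ P.P₁ M →ₗ[A] N', ψ ∘ₗ tensMap θ M P.d₂ = q ∘ₗ f) :
    ∃ ψ : Tens θ P.P₁ M →ₗ[A] N, ψ ∘ₗ tensMap θ M P.d₂ = f := by
  obtain ⟨n, c, p, H⟩ := CYResolution.exists_trace.{u, v, u} P
  obtain ⟨ψ, hψ⟩ := hf
  have h1 : BiHom.post θ M q ∘ₗ toBi θ f ∈ P.boundaries (BiHom θ M N') :=
    ⟨toBi θ ψ, by rw [← toBi_comp_tensMap, hψ]; rfl⟩
  rw [(H _).1] at h1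
  have h2 : ∑ j, c j • (BiHom.post θ M q ∘ₗ toBi θ f) (p j) =
      BiHom.post θ M q (∑ j, c j • toBi θ f (p j)) := by simp
  rw [h2] at h1
  have h3 : toBi θ f ∈ P.boundaries (BiHom θ M N) := by
    rw [(H _).1]
    -- Since g = g' q, the trace test for the class of f against g is the test for the class of q f
    -- against g', and the latter class is zero.
    refine mem_commutators_of_trace fun g => ?_
    obtain ⟨g', rfl⟩ := hq g
    exact trace_comp_eq_zero_of_mem_commutators h1 g'
  obtain ⟨χ, hχ⟩ := h3
  refine ⟨ofBi θ χ, ?_⟩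
  rw [← ofBi_comp, hχ, ofBi_toBi]

/-- When the second cohomology vanishes, every K-linear map M → N is a sum of commutators, so tr(g
y) = 0 for all y; rank-one maps y then detect g = 0. -/
theorem hom_eq_zero_of_forall_exists_extension [Module.Finite K M]
    (h : ∀ f : Tens θ P.P₂ M →ₗ[A] N, ∃ ψ : Tens θ P.P₁ M →ₗ[A] N, ψ ∘ₗ tensMap θ M P.d₂ = f)
    (g : N →ₗ[A] M) : g = 0 := by
  obtain ⟨n, c, p, H⟩ := CYResolution.exists_trace.{u, v, u} P
  have hx : ∀ x : BiHom θ M N, x ∈ commutators θ (BiHom θ M N) := by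
    intro x
    obtain ⟨φ, hφ⟩ := (H (BiHom θ M N)).2 x
    obtain ⟨ψ, hψ⟩ := h (ofBi θ φ)
    have h1 : φ ∈ P.boundaries (BiHom θ M N) :=
      ⟨toBi θ ψ, by rw [← toBi_comp_tensMap, hψ, toBi_ofBi]⟩
    rw [(H _).1] at h1
    simpa using sub_mem h1 hφ
  ext n
  refine (Module.forall_dual_apply_eq_zero_iff K (g n)).1 fun ν => ?_
  have := trace_comp_eq_zero_of_mem_commutators (hx ((BiHom.toLin θ).symm (ν.smulRight n))) g
  rwa [AddEquiv.apply_symm_apply, trace_comp_toSpanSingleton] at this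

end CYResolution

end Duality

/-! ### Bimodules A ⊗_K W and their coinvariants. -/

section OutTens

variable {K : Type v} [Field K] {A : Type u} [Ring A] [Algebra K A]
  {E : Type u} [Ring E] [Algebra K E]

/-- The bimodule `A ⊗_K W`, for a right `A`-module `W`. -/
def OutTens (_ : A ⊗[K] Aᵐᵒᵖ ≃ₐ[K] E) (W : Type w) [AddCommGroup W] [Module K W] :
    Type (max u w) := A ⊗[K] W

namespace OutTens

variable (θ : A ⊗[K] Aᵐᵒᵖ ≃ₐ[K] E)
  (W : Type w) [AddCommGroup W] [Module K W] [Module Aᵐᵒᵖ W] [IsScalarTower K Aᵐᵒᵖ W]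
  {W' : Type w'} [AddCommGroup W'] [Module K W'] [Module Aᵐᵒᵖ W'] [IsScalarTower K Aᵐᵒᵖ W']

instance : AddCommGroup (OutTens θ W) := inferInstanceAs (AddCommGroup (A ⊗[K] W))

/-- The tautological identification. -/
def of : A ⊗[K] W ≃+ OutTens θ W := AddEquiv.refl _

/-- The action of `A ⊗ Aᵒᵖ` on `A ⊗_K W`. -/
def action : A ⊗[K] Aᵐᵒᵖ →ₐ[K] Module.End K (A ⊗[K] W) :=
  (Module.endTensorEndAlgHom (R := K) (A := K) (M := A) (N := W)).comp
    (Algebra.TensorProduct.map (Algebra.lsmul K K A) (Algebra.lsmul K K W))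

instance : Module E (OutTens θ W) :=
  Module.compHom (A ⊗[K] W) ((action W).comp θ.symm.toAlgHom).toRingHom

variable {W}

theorem smul_of_tmul (a b c : A) (w : W) :
    θ (a ⊗ₜ op b) • of θ W (c ⊗ₜ w) = of θ W ((a * c) ⊗ₜ (op b • w)) := by
  change of θ W ((action W) (θ.symm (θ (a ⊗ₜ[K] op b))) (c ⊗ₜ w)) = _
  rw [θ.symm_apply_apply]
  simp [action, Module.endTensorEndAlgHom_apply]

@[elab_as_elim]
theorem induction {W : Type w} [AddCommGroup W] [Module K W] {motive : OutTens θ W → Prop}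
    (x : OutTens θ W)
    (zero : motive 0) (tmul : ∀ a w, motive (of θ W (a ⊗ₜ w)))
    (add : ∀ x y, motive x → motive y → motive (x + y)) : motive x := by
  obtain ⟨t, rfl⟩ := (of θ W).surjective x
  induction t with
  | zero => exact zero
  | tmul p m => exact tmul p m
  | add s t hs ht => exact add _ _ hs ht

/-- Functoriality. -/
def map (h : W →ₗ[Aᵐᵒᵖ] W') : OutTens θ W →ₗ[E] OutTens θ W' where
  toFun x := of θ W' ((h.restrictScalars K).lTensor A ((of θ W).symm x))
  map_add' x y := by rw [map_add, map_add, map_add]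
  map_smul' e x := by
    obtain ⟨t, rfl⟩ := θ.surjective e
    rw [RingHom.id_apply]
    induction t with
    | zero => simp
    | tmul a b =>
      obtain ⟨b, rfl⟩ := MulOpposite.op_surjective b
      induction x using induction with
      | zero => simp
      | tmul c w => simp [smul_of_tmul]
      | add x y hx hy => rw [smul_add, map_add, map_add, map_add, hx, hy, map_add, map_add,
          map_add, smul_add]
    | add s t hs ht => rw [map_add, add_smul, map_add, map_add, map_add, hs, ht, add_smul]

theorem map_of_tmul (h : W →ₗ[Aᵐᵒᵖ] W') (a : A) (w : W) :
    map θ h (of θ W (a ⊗ₜ w)) = of θ W' (a ⊗ₜ h w) := by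
  change of θ W' ((h.restrictScalars K).lTensor A ((of θ W).symm _)) = _
  simp

theorem map_injective (h : W →ₗ[Aᵐᵒᵖ] W') (hh : Function.Injective h) :
    Function.Injective (map θ h) := fun _ _ hxy =>
  (of θ W).symm.injective (Module.Flat.lTensor_preserves_injective_linearMap
    (M := A) (h.restrictScalars K) hh ((of θ W').injective hxy))

theorem map_surjective (h : W →ₗ[Aᵐᵒᵖ] W') (hh : Function.Surjective h) :
    Function.Surjective (map θ h) := fun x => by
  obtain ⟨y, hy⟩ := LinearMap.lTensor_surjective A (g := h.restrictScalars K) hh ((of θ W').symm x)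
  refine ⟨of θ W y, ?_⟩
  change of θ W' ((h.restrictScalars K).lTensor A ((of θ W).symm (of θ W y))) = _
  rw [AddEquiv.symm_apply_apply, hy, AddEquiv.apply_symm_apply]

theorem map_exact {W'' : Type*} [AddCommGroup W''] [Module K W''] [Module Aᵐᵒᵖ W'']
    [IsScalarTower K Aᵐᵒᵖ W''] (h : W →ₗ[Aᵐᵒᵖ] W') (h' : W' →ₗ[Aᵐᵒᵖ] W'')
    (he : Function.Exact h h') (hh : Function.Surjective h') :
    Function.Exact (map θ h) (map θ h') := by
  intro x
  have := lTensor_exact A (f := h.restrictScalars K) (g := h'.restrictScalars K) he hh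
    ((of θ W').symm x)
  refine Iff.trans ?_ (this.trans ?_)
  · exact (map_eq_zero_iff (of θ W'') (of θ W'').injective)
  · constructor
    · rintro ⟨y, hy⟩
      refine ⟨of θ W y, (of θ W').symm.injective ?_⟩
      exact hy
    · rintro ⟨y, hy⟩
      exact ⟨(of θ W).symm y, congrArg (of θ W').symm hy⟩

variable (W) in
/-- The isomorphism from `A ⊗_K W` modulo commutators to `W`. -/
def contract : OutTens θ W →+ W :=
  (TensorProduct.lift (LinearMap.flip
    { toFun := fun w => ((Algebra.lsmul K K W).toLinearMap.flip w).comp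
        (MulOpposite.opLinearEquiv K : A ≃ₗ[K] Aᵐᵒᵖ).toLinearMap
      map_add' := fun w w' => by ext; simp
      map_smul' := fun k w => by ext a; exact smul_comm (op a) k w } :
      A →ₗ[K] W →ₗ[K] W)).toAddMonoidHom.comp
    (of θ W).symm.toAddMonoidHom

theorem contract_of_tmul (a : A) (w : W) : contract θ W (of θ W (a ⊗ₜ w)) = op a • w := by
  simp [contract]

theorem contract_map (h : W →ₗ[Aᵐᵒᵖ] W') (x : OutTens θ W) :
    contract θ W' (map θ h x) = h (contract θ W x) := by
  induction x using induction with
  | zero => simp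
  | tmul a w => rw [map_of_tmul, contract_of_tmul, contract_of_tmul, map_smul]
  | add x y hx hy => rw [map_add, map_add, hx, hy, map_add, map_add]

/-- Modulo commutators a ⊗ w equals 1 ⊗ wa, so the coinvariants of A ⊗ W are W itself. In particular
second Hochschild cohomology is exact in W. -/
theorem mem_commutators_iff (x : OutTens θ W) :
    x ∈ commutators θ (OutTens θ W) ↔ contract θ W x = 0 := by
  constructor
  · intro hx
    induction hx using AddSubgroup.closure_induction with
    | mem x hx =>
      obtain ⟨a, y, rfl⟩ := hx
      rw [← MulOpposite.op_one]
      induction y using induction with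
      | zero => simp
      | tmul c w =>
        rw [smul_of_tmul, smul_of_tmul, map_sub, contract_of_tmul, contract_of_tmul, one_mul,
          MulOpposite.op_one, one_smul, MulOpposite.op_mul, mul_smul, sub_self]
      | add x y hx hy =>
        rw [smul_add, smul_add, add_sub_add_comm, map_add, hx, hy, add_zero]
    | zero => simp
    | add x y _ _ hx hy => rw [map_add, hx, hy, add_zero]
    | neg x _ hx => rw [map_neg, hx, neg_zero]
  · intro hx
    have h : ∀ y : OutTens θ W, y - of θ W (1 ⊗ₜ contract θ W y) ∈ commutators θ (OutTens θ W) := by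
      intro y
      induction y using induction with
      | zero => simp
      | tmul a w =>
        convert mem_commutators θ a (of θ W (1 ⊗ₜ w)) using 1
        rw [contract_of_tmul, ← MulOpposite.op_one, smul_of_tmul, smul_of_tmul]
        simp
      | add x y hx hy =>
        convert add_mem hx hy using 1
        rw [map_add, TensorProduct.tmul_add, map_add]
        abel
    have := h x
    rwa [hx, TensorProduct.tmul_zero, map_zero, sub_zero] at this

/-- `A ⊗_K W` is free if `W` is free. -/
def finsuppEquiv (ι : Type w) [DecidableEq ι] : OutTens θ (ι →₀ Aᵐᵒᵖ) ≃ₗ[E] (ι →₀ E) where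
  __ := (of θ (ι →₀ Aᵐᵒᵖ)).symm.trans ((TensorProduct.finsuppRight K K A Aᵐᵒᵖ ι).toAddEquiv.trans
    (Finsupp.mapRange.addEquiv θ.toAddEquiv))
  map_smul' e x := by
    obtain ⟨t, rfl⟩ := θ.surjective e
    change Finsupp.mapRange.addEquiv θ.toAddEquiv (TensorProduct.finsuppRight K K A Aᵐᵒᵖ ι
      ((of θ (ι →₀ Aᵐᵒᵖ)).symm _)) = θ t • Finsupp.mapRange.addEquiv θ.toAddEquiv
        (TensorProduct.finsuppRight K K A Aᵐᵒᵖ ι ((of θ (ι →₀ Aᵐᵒᵖ)).symm x))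
    induction t with
    | zero => simp
    | tmul a b =>
      obtain ⟨b, rfl⟩ := MulOpposite.op_surjective b
      induction x using induction with
      | zero => simp
      | tmul c w =>
        ext i
        simp [smul_of_tmul, TensorProduct.finsuppRight_apply_tmul_apply, ← map_mul]
      | add x y hx hy => rw [smul_add, map_add, map_add, map_add, hx, hy, map_add, map_add,
          map_add, smul_add]
    | add s t hs ht => rw [map_add, add_smul, map_add, map_add, map_add, hs, ht, add_smul]

end OutTens

/-! ### Vanishing of Hochschild cohomology of A ⊗_K W in degrees 0 and 1. -/

section Vanishing

variable {θ : A ⊗[K] Aᵐᵒᵖ ≃ₐ[K] E} (P : CYResolution θ)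

namespace CYResolution

/-- P₁ is finitely generated, so φ involves only finitely many coordinates, and exactness of the
dual complex applies to each of them. -/
theorem exists_finsupp_extension (ι : Type w) (φ : P.P₁ →ₗ[E] (ι →₀ E)) (hφ : φ ∘ₗ P.d₂ = 0) :
    ∃ ψ : P.P₀ →ₗ[E] (ι →₀ E), ψ ∘ₗ P.d₁ = φ := by
  classical
  have := P.finite₁
  obtain ⟨s, hs⟩ := Module.Finite.fg_top (R := E) (M := P.P₁)
  let T : Finset ι := s.biUnion fun p => (φ p).support
  have hT : ∀ i ∉ T, ∀ p, φ p i = 0 := by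
    intro i hi p
    have hp : p ∈ Submodule.span E (s : Set P.P₁) := hs ▸ Submodule.mem_top
    induction hp using Submodule.span_induction with
    | mem p hp =>
      by_contra h
      exact hi (Finset.mem_biUnion.2 ⟨p, hp, Finsupp.mem_support_iff.2 h⟩)
    | zero => simp
    | add p q _ _ hp hq => simp [hp, hq]
    | smul e p _ hp => simp [hp]
  choose g hg using fun i => P.dual_exact₁ (Finsupp.lapply i ∘ₗ φ) (by
    rw [LinearMap.comp_assoc, hφ, LinearMap.comp_zero])
  refine ⟨∑ i ∈ T, Finsupp.lsingle i ∘ₗ g i, ?_⟩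
  ext p j
  have hgj : ∀ j, g j (P.d₁ p) = φ p j := fun j => LinearMap.congr_fun (hg j) p
  simp only [LinearMap.comp_apply, LinearMap.sum_apply, Finsupp.lsingle_apply, Finsupp.coe_finsetSum,
    Finset.sum_apply, Finsupp.single_apply, hgj, Finset.sum_ite_eq']
  split_ifs with h
  · rfl
  · exact (hT j h p).symm

theorem finsupp_eq_zero (ι : Type w) (φ : P.P₀ →ₗ[E] (ι →₀ E)) (hφ : φ ∘ₗ P.d₁ = 0) : φ = 0 := by
  ext p i
  have := P.dual_injective (Finsupp.lapply i ∘ₗ φ) (by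
    rw [LinearMap.comp_assoc, hφ, LinearMap.comp_zero])
  exact LinearMap.congr_fun this p

/-- A lift of a homomorphism to a submodule. -/
theorem exists_lift_of_exact {X Y Z Q : Type*} [AddCommGroup X] [Module E X] [AddCommGroup Y]
    [Module E Y] [AddCommGroup Z] [Module E Z] [AddCommGroup Q] [Module E Q] (i : X →ₗ[E] Y)
    (q : Y →ₗ[E] Z) (hi : Function.Injective i) (hiq : Function.Exact i q) (f : Q →ₗ[E] Y)
    (hf : q ∘ₗ f = 0) : ∃ g : Q →ₗ[E] X, i ∘ₗ g = f := by
  have h : ∀ x, f x ∈ LinearMap.range i := fun x => (hiq _).1 (LinearMap.congr_fun hf x)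
  refine ⟨(LinearEquiv.ofInjective i hi).symm.toLinearMap ∘ₗ f.codRestrict _ h, ?_⟩
  ext x
  exact congrArg Subtype.val ((LinearEquiv.ofInjective i hi).apply_symm_apply
    (f.codRestrict _ h x))

section Chase

variable {P} {X Y Z : Type w} [AddCommGroup X] [Module E X] [AddCommGroup Y] [Module E Y]
  [AddCommGroup Z] [Module E Z] {i : X →ₗ[E] Y} {q : Y →ₗ[E] Z}

/-- Dimension shifting for the first Hochschild cohomology. -/
theorem exists_extension_of_exact (hi : Function.Injective i) (hiq : Function.Exact i q)
    (hq : Function.Surjective q)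
    (hY : ∀ φ : P.P₁ →ₗ[E] Y, φ ∘ₗ P.d₂ = 0 → ∃ ψ : P.P₀ →ₗ[E] Y, ψ ∘ₗ P.d₁ = φ)
    (hX : ∀ x, i x ∈ commutators θ Y → x ∈ commutators θ X)
    (φ : P.P₁ →ₗ[E] Z) (hφ : φ ∘ₗ P.d₂ = 0) : ∃ ψ : P.P₀ →ₗ[E] Z, ψ ∘ₗ P.d₁ = φ := by
  obtain ⟨n, c, p, H⟩ := CYResolution.exists_trace.{u, v, w} P
  have := P.projective₁
  obtain ⟨f, hf⟩ := Module.projective_lifting_property q φ hq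
  obtain ⟨χ, hχ⟩ := exists_lift_of_exact i q hi hiq (f ∘ₗ P.d₂) (by
    rw [← LinearMap.comp_assoc, hf, hφ])
  have hχb : χ ∈ P.boundaries X := by
    -- The obstruction χ is a degree-two class of X that dies in Y, hence is trivial since
    -- coinvariants of X inject into those of Y.
    rw [(H _).1]
    apply hX
    have : f ∘ₗ P.d₂ ∈ P.boundaries Y := ⟨f, rfl⟩
    rw [(H _).1, ← hχ] at this
    simpa using this
  obtain ⟨ρ, hρ⟩ := hχb
  obtain ⟨ψ, hψ⟩ := hY (f - i ∘ₗ ρ) (by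
    rw [LinearMap.sub_comp, LinearMap.comp_assoc, hρ, hχ, sub_self])
  refine ⟨q ∘ₗ ψ, ?_⟩
  rw [LinearMap.comp_assoc, hψ, ← hf]
  ext x
  rw [LinearMap.comp_apply, LinearMap.sub_apply, map_sub, LinearMap.comp_apply,
    (hiq _).2 ⟨_, rfl⟩, sub_zero]
  rfl

/-- Dimension shifting for the zeroth Hochschild cohomology. -/
theorem eq_zero_of_exact (hi : Function.Injective i) (hiq : Function.Exact i q)
    (hq : Function.Surjective q) (hY : ∀ φ : P.P₀ →ₗ[E] Y, φ ∘ₗ P.d₁ = 0 → φ = 0)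
    (hX : ∀ φ : P.P₁ →ₗ[E] X, φ ∘ₗ P.d₂ = 0 → ∃ ψ : P.P₀ →ₗ[E] X, ψ ∘ₗ P.d₁ = φ)
    (φ : P.P₀ →ₗ[E] Z) (hφ : φ ∘ₗ P.d₁ = 0) : φ = 0 := by
  have := P.projective₀
  obtain ⟨f, hf⟩ := Module.projective_lifting_property q φ hq
  obtain ⟨χ, hχ⟩ := exists_lift_of_exact i q hi hiq (f ∘ₗ P.d₁) (by
    rw [← LinearMap.comp_assoc, hf, hφ])
  obtain ⟨ρ, hρ⟩ := hX χ (by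
    ext x
    apply hi
    have h1 := LinearMap.congr_fun hχ (P.d₂ x)
    have h2 : P.d₁ (P.d₂ x) = 0 := (P.exact₁ _).2 ⟨x, rfl⟩
    simpa [h2] using h1)
  have h0 := hY (f - i ∘ₗ ρ) (by
    rw [LinearMap.sub_comp, LinearMap.comp_assoc, hρ, hχ, sub_self])
  rw [← hf, sub_eq_zero.1 h0]
  ext x
  exact (hiq _).2 ⟨_, rfl⟩

end Chase

theorem exists_outTens_finsupp_extension (ι : Type w) (φ : P.P₁ →ₗ[E] OutTens θ (ι →₀ Aᵐᵒᵖ))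
    (hφ : φ ∘ₗ P.d₂ = 0) : ∃ ψ : P.P₀ →ₗ[E] OutTens θ (ι →₀ Aᵐᵒᵖ), ψ ∘ₗ P.d₁ = φ := by
  classical
  let e := OutTens.finsuppEquiv θ ι
  obtain ⟨ψ, hψ⟩ := P.exists_finsupp_extension ι (e.toLinearMap ∘ₗ φ) (by
      rw [LinearMap.comp_assoc, hφ, LinearMap.comp_zero])
  refine ⟨e.symm.toLinearMap ∘ₗ ψ, ?_⟩
  rw [LinearMap.comp_assoc, hψ]
  ext x
  exact e.symm_apply_apply _

theorem outTens_finsupp_eq_zero (ι : Type w) (φ : P.P₀ →ₗ[E] OutTens θ (ι →₀ Aᵐᵒᵖ))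
    (hφ : φ ∘ₗ P.d₁ = 0) : φ = 0 := by
  classical
  let e := OutTens.finsuppEquiv θ ι
  have h0 := P.finsupp_eq_zero ι (e.toLinearMap ∘ₗ φ) (by
      rw [LinearMap.comp_assoc, hφ, LinearMap.comp_zero])
  ext x
  exact e.injective ((LinearMap.congr_fun h0 x).trans (map_zero e).symm)

/-- Degree-two cohomology of A ⊗ W is W, so an injection W₁ → W₂ stays injective on it, and the
connecting map out of the degree-one cohomology of A ⊗ W₃ is zero. -/
theorem exists_outTens_extension_of_exact {W₁ W₂ W₃ : Type w} [AddCommGroup W₁] [Module K W₁]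
    [Module Aᵐᵒᵖ W₁] [IsScalarTower K Aᵐᵒᵖ W₁] [AddCommGroup W₂] [Module K W₂]
    [Module Aᵐᵒᵖ W₂] [IsScalarTower K Aᵐᵒᵖ W₂] [AddCommGroup W₃] [Module K W₃]
    [Module Aᵐᵒᵖ W₃] [IsScalarTower K Aᵐᵒᵖ W₃] {i : W₁ →ₗ[Aᵐᵒᵖ] W₂} {q : W₂ →ₗ[Aᵐᵒᵖ] W₃}
    (hi : Function.Injective i) (hiq : Function.Exact i q) (hq : Function.Surjective q)
    (hY : ∀ φ : P.P₁ →ₗ[E] OutTens θ W₂, φ ∘ₗ P.d₂ = 0 →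
      ∃ ψ : P.P₀ →ₗ[E] OutTens θ W₂, ψ ∘ₗ P.d₁ = φ)
    (φ : P.P₁ →ₗ[E] OutTens θ W₃) (hφ : φ ∘ₗ P.d₂ = 0) :
    ∃ ψ : P.P₀ →ₗ[E] OutTens θ W₃, ψ ∘ₗ P.d₁ = φ := by
  refine exists_extension_of_exact (OutTens.map_injective θ i hi) (OutTens.map_exact θ i q hiq hq)
    (OutTens.map_surjective θ q hq) hY (fun x hx => ?_) φ hφ
  rw [OutTens.mem_commutators_iff] at hx ⊢
  rw [OutTens.contract_map] at hx
  exact hi (hx.trans (map_zero i).symm)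

theorem outTens_eq_zero_of_exact {W₁ W₂ W₃ : Type w} [AddCommGroup W₁] [Module K W₁]
    [Module Aᵐᵒᵖ W₁] [IsScalarTower K Aᵐᵒᵖ W₁] [AddCommGroup W₂] [Module K W₂]
    [Module Aᵐᵒᵖ W₂] [IsScalarTower K Aᵐᵒᵖ W₂] [AddCommGroup W₃] [Module K W₃]
    [Module Aᵐᵒᵖ W₃] [IsScalarTower K Aᵐᵒᵖ W₃] {i : W₁ →ₗ[Aᵐᵒᵖ] W₂} {q : W₂ →ₗ[Aᵐᵒᵖ] W₃}
    (hi : Function.Injective i) (hiq : Function.Exact i q) (hq : Function.Surjective q)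
    (hY : ∀ φ : P.P₀ →ₗ[E] OutTens θ W₂, φ ∘ₗ P.d₁ = 0 → φ = 0)
    (hX : ∀ φ : P.P₁ →ₗ[E] OutTens θ W₁, φ ∘ₗ P.d₂ = 0 →
      ∃ ψ : P.P₀ →ₗ[E] OutTens θ W₁, ψ ∘ₗ P.d₁ = φ)
    (φ : P.P₀ →ₗ[E] OutTens θ W₃) (hφ : φ ∘ₗ P.d₁ = 0) : φ = 0 :=
  eq_zero_of_exact (OutTens.map_injective θ i hi) (OutTens.map_exact θ i q hiq hq)
    (OutTens.map_surjective θ q hq) hY hX φ hφ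

/-- Dimension shifting along the presentation of W by the free right module on its underlying set,
for which A ⊗ W is a free bimodule. -/
theorem exists_outTens_extension (W : Type (max u w)) [AddCommGroup W] [Module K W]
    [Module Aᵐᵒᵖ W] [IsScalarTower K Aᵐᵒᵖ W] (φ : P.P₁ →ₗ[E] OutTens θ W) (hφ : φ ∘ₗ P.d₂ = 0) :
    ∃ ψ : P.P₀ →ₗ[E] OutTens θ W, ψ ∘ₗ P.d₁ = φ :=
  P.exists_outTens_extension_of_exact (Submodule.subtype_injective _)
    (LinearMap.exact_subtype_ker_map (Finsupp.linearCombination Aᵐᵒᵖ (id : W → W)))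
    (Finsupp.linearCombination_id_surjective _ _) (P.exists_outTens_finsupp_extension W) φ hφ

/-- The same shift one degree lower, using the vanishing in degree one for the kernel of the
presentation. -/
theorem outTens_eq_zero (W : Type (max u w)) [AddCommGroup W] [Module K W]
    [Module Aᵐᵒᵖ W] [IsScalarTower K Aᵐᵒᵖ W] (φ : P.P₀ →ₗ[E] OutTens θ W) (hφ : φ ∘ₗ P.d₁ = 0) :
    φ = 0 :=
  P.outTens_eq_zero_of_exact (Submodule.subtype_injective _)
    (LinearMap.exact_subtype_ker_map (Finsupp.linearCombination Aᵐᵒᵖ (id : W → W)))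
    (Finsupp.linearCombination_id_surjective _ _) (P.outTens_finsupp_eq_zero W)
    (CYResolution.exists_outTens_extension.{u, v, w} P _) φ hφ

end CYResolution

end Vanishing

/-! ### Hom_K(M, A) as A ⊗_K M*. -/

section Dual

variable (θ : A ⊗[K] Aᵐᵒᵖ ≃ₐ[K] E)
  (M : Type u) [AddCommGroup M] [Module A M] [Module K M] [IsScalarTower K A M]

/-- The dual of a left module, as a right module. -/
def RightDual (K : Type v) [Field K] (A : Type u) [Ring A] (M : Type u) [AddCommGroup M]
    [Module A M] [Module K M] : Type (max u v) := M →ₗ[K] K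

instance : AddCommGroup (RightDual K A M) := inferInstanceAs (AddCommGroup (M →ₗ[K] K))

instance : Module K (RightDual K A M) := inferInstanceAs (Module K (M →ₗ[K] K))

/-- Right multiplication by `A` on the dual. -/
def RightDual.action : Aᵐᵒᵖ →ₐ[K] Module.End K (M →ₗ[K] K) :=
  AlgHom.ofLinearMap ((LinearMap.llcomp K M M K).flip.comp
        ((Algebra.lsmul K K M).toLinearMap.comp
          (MulOpposite.opLinearEquiv K : A ≃ₗ[K] Aᵐᵒᵖ).symm.toLinearMap))
      (by ext; simp) (by intros; ext; simp)

instance : Module Aᵐᵒᵖ (RightDual K A M) :=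
  Module.compHom (M →ₗ[K] K) (RightDual.action (K := K) (A := A) M).toRingHom

instance : IsScalarTower K Aᵐᵒᵖ (RightDual K A M) :=
  IsScalarTower.of_algebraMap_smul fun k f => by
    change RightDual.action M (algebraMap K Aᵐᵒᵖ k) f = k • f
    rw [AlgHom.commutes]
    rfl

/-- `A ⊗_K DM ≅ Hom_K(M, A)` for `M` finite-dimensional. -/
def dualEquiv [Module.Finite K M] : OutTens θ (RightDual K A M) ≃ₗ[E] BiHom θ M A where
  __ := (OutTens.of θ (RightDual K A M)).symm.trans
    (((TensorProduct.comm K A (M →ₗ[K] K)).trans (dualTensorHomEquiv K M A)).toAddEquiv.trans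
      (BiHom.toLin θ).symm)
  map_smul' e x := by
    obtain ⟨t, rfl⟩ := θ.surjective e
    let F : OutTens θ (RightDual K A M) →+ BiHom θ M A :=
      ((OutTens.of θ (RightDual K A M)).symm.trans
      (((TensorProduct.comm K A (M →ₗ[K] K)).trans (dualTensorHomEquiv K M A)).toAddEquiv.trans
      (BiHom.toLin θ).symm)).toAddMonoidHom
    have hF : ∀ (a : A) (f : M →ₗ[K] K) (m : M),
        BiHom.toLin θ (F (OutTens.of θ (RightDual K A M) (a ⊗ₜ[K] f))) m = f m • a := by
      intro a f m
      change dualTensorHomEquiv K M A (TensorProduct.comm K A (M →ₗ[K] K) (a ⊗ₜ f)) m = f m • a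
      simp
    change F (θ t • x) = θ t • F x
    induction t with
    | zero => simp
    | tmul a b =>
      obtain ⟨b, rfl⟩ := MulOpposite.op_surjective b
      induction x using OutTens.induction with
      | zero => simp
      | tmul c f =>
        apply (BiHom.toLin θ).injective
        ext m
        rw [OutTens.smul_of_tmul, BiHom.smul_apply]
        refine (hF (a * c) (RightDual.action M (op b) f) m).trans ?_
        rw [hF c f (b • m), smul_eq_mul, mul_smul_comm]
        rfl
      | add x y hx hy => rw [smul_add, map_add, hx, hy, map_add, smul_add]
    | add s t hs ht => rw [map_add, add_smul, map_add, hs, ht, add_smul]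

end Dual

/-! ### Vanishing of Hom(M, A) and Ext¹(M, A) for finite-dimensional M. -/

section HomToRing

variable {θ : A ⊗[K] Aᵐᵒᵖ ≃ₐ[K] E} (P : CYResolution θ)
  {M : Type u} [AddCommGroup M] [Module A M] [Module K M] [IsScalarTower K A M]
  [Module.Finite K M]

/-- By adjunction and Hom_K(M, A) ≅ A ⊗ M*, a 1-cocycle for Ext¹(M, A) is a Hochschild 1-cocycle
with values in A ⊗ M*. -/
theorem CYResolution.exists_ring_extension (f : Tens θ P.P₁ M →ₗ[A] A)
    (hf : f ∘ₗ tensMap θ M P.d₂ = 0) :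
    ∃ g : Tens θ P.P₀ M →ₗ[A] A, g ∘ₗ tensMap θ M P.d₁ = f := by
  let e := dualEquiv θ M
  obtain ⟨ψ, hψ⟩ := CYResolution.exists_outTens_extension.{u, v, v} P _ (e.symm.toLinearMap ∘ₗ toBi θ f) (by
    rw [LinearMap.comp_assoc, ← toBi_comp_tensMap, hf]
    ext q
    exact map_zero e.symm)
  refine ⟨ofBi θ (e.toLinearMap ∘ₗ ψ), ?_⟩
  rw [← ofBi_comp, LinearMap.comp_assoc, hψ, ← ofBi_toBi θ f]
  congr 1
  ext q
  rw [ofBi_toBi]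
  exact e.apply_symm_apply _

theorem CYResolution.ring_hom_eq_zero (f : Tens θ P.P₀ M →ₗ[A] A)
    (hf : f ∘ₗ tensMap θ M P.d₁ = 0) : f = 0 := by
  let e := dualEquiv θ M
  have h := CYResolution.outTens_eq_zero.{u, v, v} P _ (e.symm.toLinearMap ∘ₗ toBi θ f) (by
    rw [LinearMap.comp_assoc, ← toBi_comp_tensMap, hf]
    ext q
    exact map_zero e.symm)
  have h0 : toBi θ f = 0 := by
    ext q
    exact e.symm.injective ((LinearMap.congr_fun h q).trans (map_zero e.symm).symm)
  rw [← ofBi_toBi θ f, h0]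
  exact tens_hom_ext θ fun q m => by rw [ofBi_tens]; rfl

end HomToRing

end OutTens

/-! ### Extension groups and short exact sequences of modules -/

section Ext

open Abelian

variable {R : Type u} [Ring R]

section ShortExact

variable {X Y Z : Type u} [AddCommGroup X] [Module R X] [AddCommGroup Y] [Module R Y]
  [AddCommGroup Z] [Module R Z]

/-- The short complex of modules defined by an exact pair of linear maps. -/
abbrev shortComplexOf (f : X →ₗ[R] Y) (g : Y →ₗ[R] Z) (h : Function.Exact f g) :
    ShortComplex (ModuleCat.{u} R) :=
  ShortComplex.mk (ModuleCat.ofHom f) (ModuleCat.ofHom g) (by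
    ext x
    exact (h _).2 ⟨x, rfl⟩)

theorem shortExact_of {f : X →ₗ[R] Y} {g : Y →ₗ[R] Z} (hf : Function.Injective f)
    (h : Function.Exact f g) (hg : Function.Surjective g) :
    (shortComplexOf f g h).ShortExact where
  exact := (ShortComplex.moduleCat_exact_iff _).2 fun x hx => (h x).1 hx
  mono_f := (ModuleCat.mono_iff_injective _).2 hf
  epi_g := (ModuleCat.epi_iff_surjective _).2 hg

end ShortExact

section

variable {S : ShortComplex (ModuleCat.{u} R)}

theorem extClass_comp_mk₀_eq_zero_iff (hS : S.ShortExact) {N : ModuleCat.{u} R} (f : S.X₁ ⟶ N) :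
    hS.extClass.comp (Ext.mk₀ f) (add_zero 1) = 0 ↔ ∃ f' : S.X₂ ⟶ N, S.f ≫ f' = f := by
  constructor
  · intro h
    obtain ⟨x, hx⟩ := Ext.contravariant_sequence_exact₁ hS N (Ext.mk₀ f) (add_zero 1) h
    obtain ⟨f', rfl⟩ := (Ext.mk₀_bijective S.X₂ N).2 x
    refine ⟨f', (Ext.mk₀_bijective _ _).1 ?_⟩
    rw [← hx, Ext.mk₀_comp_mk₀]
  · rintro ⟨f', rfl⟩
    rw [← Ext.mk₀_comp_mk₀, ← Ext.comp_assoc_of_second_deg_zero, hS.extClass_comp, Ext.zero_comp]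

theorem extClass_comp_injective (hS : S.ShortExact) {N : ModuleCat.{u} R} {n : ℕ}
    [Subsingleton (Ext S.X₂ N n)] {m : ℕ} (hm : 1 + n = m) {x : Ext S.X₁ N n} (hx : hS.extClass.comp x hm = 0) : x = 0 := by
  obtain ⟨y, rfl⟩ := Ext.contravariant_sequence_exact₁ hS N x hm hx
  rw [Subsingleton.elim y 0, Ext.comp_zero]

theorem subsingleton_ext_one_of_forall_extend (hS : S.ShortExact) {N : ModuleCat.{u} R}
    [Subsingleton (Ext S.X₂ N 1)] (h : ∀ f : S.X₁ ⟶ N, ∃ f' : S.X₂ ⟶ N, S.f ≫ f' = f) :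
    Subsingleton (Ext S.X₃ N 1) := by
  refine subsingleton_of_forall_eq 0 fun x => ?_
  obtain ⟨y, rfl⟩ := Ext.contravariant_sequence_exact₃ hS N x (Subsingleton.elim _ _)
    (add_zero 1)
  obtain ⟨f, rfl⟩ := (Ext.mk₀_bijective S.X₁ N).2 y
  exact (extClass_comp_mk₀_eq_zero_iff hS f).2 (h f)

theorem exists_extend_of_subsingleton_ext_one (hS : S.ShortExact) {N : ModuleCat.{u} R}
    [Subsingleton (Ext S.X₃ N 1)] (f : S.X₁ ⟶ N) : ∃ f' : S.X₂ ⟶ N, S.f ≫ f' = f :=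
  (extClass_comp_mk₀_eq_zero_iff hS f).1 (Subsingleton.elim _ _)

end

theorem subsingleton_ext_of_projective (X : Type u) [AddCommGroup X] [Module R X]
    [Module.Projective R X] (N : ModuleCat.{u} R) (n : ℕ) (hn : 0 < n) :
    Subsingleton (Ext (ModuleCat.of R X) N n) := by
  have : Projective (ModuleCat.of R X) := (IsProjective.iff_projective X).1 inferInstance
  obtain ⟨m, rfl⟩ := Nat.exists_eq_succ_of_ne_zero hn.ne'
  exact Ext.subsingleton_of_projective _ _ _

end Ext

/-! ### Homological consequences of the Calabi-Yau property -/

/-- The homological properties of finite-dimensional modules over a `2`-Calabi-Yau algebra. -/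
structure HasCYDuality (K : Type v) [Field K] (R : Type u) [Ring R] [Algebra K R] : Prop where
  exists_resolution : ∀ M : ModuleCat.{u} R, FinDim K R M →
    ∃ (Q₂ Q₁ Q₀ : ModuleCat.{u} R) (f₂ : Q₂ →ₗ[R] Q₁) (f₁ : Q₁ →ₗ[R] Q₀) (f₀ : Q₀ →ₗ[R] M),
      (Module.Finite R Q₂ ∧ Module.Projective R Q₂) ∧
      (Module.Finite R Q₁ ∧ Module.Projective R Q₁) ∧
      (Module.Finite R Q₀ ∧ Module.Projective R Q₀) ∧
      Function.Injective f₂ ∧ Function.Exact f₂ f₁ ∧ Function.Exact f₁ f₀ ∧ Function.Surjective f₀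
  ext_two_injective : ∀ M : ModuleCat.{u} R, FinDim K R M → ∀ (N N' : ModuleCat.{u} R) (q : N ⟶ N'),
    (∀ g : N ⟶ M, ∃ g' : N' ⟶ M, q ≫ g' = g) → ∀ x : Abelian.Ext M N 2,
      x.comp (Abelian.Ext.mk₀ q) (add_zero 2) = 0 → x = 0
  hom_eq_zero : ∀ M : ModuleCat.{u} R, FinDim K R M → ∀ N : ModuleCat.{u} R,
    Subsingleton (Abelian.Ext M N 2) → ∀ g : N ⟶ M, g = 0
  hom_ring_eq_zero : ∀ M : ModuleCat.{u} R, FinDim K R M → ∀ g : M ⟶ ModuleCat.of R R, g = 0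
  ext_one_ring : ∀ M : ModuleCat.{u} R, FinDim K R M →
    Subsingleton (Abelian.Ext M (ModuleCat.of R R) 1)

section FromResolution

open Abelian

variable {K : Type v} [Field K] {A : Type u} [Ring A] [Algebra K A]
  {E : Type u} [Ring E] [Algebra K E] {θ : A ⊗[K] Aᵐᵒᵖ ≃ₐ[K] E}

theorem CYResolution.hasCYDuality (P : CYResolution θ) : HasCYDuality K A := by
  have key : ∀ M : ModuleCat.{u} A, FinDim K A M → ∃ (Q₂ Q₁ Q₀ : ModuleCat.{u} A)
      (f₂ : Q₂ →ₗ[A] Q₁) (f₁ : Q₁ →ₗ[A] Q₀) (f₀ : Q₀ →ₗ[A] M),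
      (Module.Finite A Q₂ ∧ Module.Projective A Q₂) ∧
      (Module.Finite A Q₁ ∧ Module.Projective A Q₁) ∧
      (Module.Finite A Q₀ ∧ Module.Projective A Q₀) ∧
      (Function.Injective f₂ ∧ Function.Exact f₂ f₁ ∧ Function.Exact f₁ f₀ ∧
        Function.Surjective f₀) ∧
      (∀ (N N' : ModuleCat.{u} A) (q : N →ₗ[A] N'),
        (∀ g : N →ₗ[A] M, ∃ g' : N' →ₗ[A] M, g' ∘ₗ q = g) → ∀ f : Q₂ →ₗ[A] N,
        (∃ ψ : Q₁ →ₗ[A] N', ψ ∘ₗ f₂ = q ∘ₗ f) → ∃ ψ : Q₁ →ₗ[A] N, ψ ∘ₗ f₂ = f) ∧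
      (∀ (N : ModuleCat.{u} A), (∀ f : Q₂ →ₗ[A] N, ∃ ψ : Q₁ →ₗ[A] N, ψ ∘ₗ f₂ = f) →
        ∀ g : N →ₗ[A] M, g = 0) ∧
      (∀ f : Q₁ →ₗ[A] A, f ∘ₗ f₂ = 0 → ∃ g : Q₀ →ₗ[A] A, g ∘ₗ f₁ = f) ∧
      (∀ f : Q₀ →ₗ[A] A, f ∘ₗ f₁ = 0 → f = 0) := by
    intro M hM
    let inst (N : ModuleCat.{u} A) : Module K N := Module.compHom N (algebraMap K A)
    have tower (N : ModuleCat.{u} A) : IsScalarTower K A N :=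
      IsScalarTower.of_algebraMap_smul fun _ _ => rfl
    have : Module.Finite K M := hM
    have := P.finite₀
    have := P.finite₁
    have := P.finite₂
    have := P.projective₀
    have := P.projective₁
    have := P.projective₂
    exact ⟨ModuleCat.of A (Tens θ P.P₂ M), ModuleCat.of A (Tens θ P.P₁ M),
      ModuleCat.of A (Tens θ P.P₀ M), tensMap θ M P.d₂, tensMap θ M P.d₁, P.tensAug M,
      ⟨finite_tens θ M P.P₂, projective_tens θ M P.P₂⟩,
      ⟨finite_tens θ M P.P₁, projective_tens θ M P.P₁⟩,
      ⟨finite_tens θ M P.P₀, projective_tens θ M P.P₀⟩, P.tens_exact M,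
      fun N N' q hq f hf => P.exists_extension_of_comp q hq f hf,
      fun N h g => P.hom_eq_zero_of_forall_exists_extension h g,
      fun f hf => P.exists_ring_extension f hf, fun f hf => P.ring_hom_eq_zero f hf⟩
  -- The first syzygy Ω is inserted so that the resolution splits into two short exact sequences,
  -- through which statements about cocycles on Q₂ become statements about Ext².
  have key' : ∀ M : ModuleCat.{u} A, FinDim K A M → ∃ (Q₂ Q₁ Ω Q₀ : ModuleCat.{u} A)
      (f₂ : Q₂ →ₗ[A] Q₁) (s : Q₁ →ₗ[A] Ω) (i : Ω →ₗ[A] Q₀) (f₀ : Q₀ →ₗ[A] M)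
      (_ : Module.Projective A Q₁) (_ : Module.Projective A Q₀)
      (_ : Function.Injective f₂) (_ : Function.Exact f₂ s) (_ : Function.Surjective s)
      (_ : Function.Injective i) (_ : Function.Exact i f₀) (_ : Function.Surjective f₀),
      (∀ (N N' : ModuleCat.{u} A) (q : N →ₗ[A] N'),
        (∀ g : N →ₗ[A] M, ∃ g' : N' →ₗ[A] M, g' ∘ₗ q = g) → ∀ f : Q₂ →ₗ[A] N,
        (∃ ψ : Q₁ →ₗ[A] N', ψ ∘ₗ f₂ = q ∘ₗ f) → ∃ ψ : Q₁ →ₗ[A] N, ψ ∘ₗ f₂ = f) ∧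
      (∀ (N : ModuleCat.{u} A), (∀ f : Q₂ →ₗ[A] N, ∃ ψ : Q₁ →ₗ[A] N, ψ ∘ₗ f₂ = f) →
        ∀ g : N →ₗ[A] M, g = 0) ∧
      (∀ f : Q₁ →ₗ[A] A, f ∘ₗ f₂ = 0 → ∃ g : Q₀ →ₗ[A] A, g ∘ₗ i ∘ₗ s = f) ∧
      (∀ f : Q₀ →ₗ[A] A, f ∘ₗ i = 0 → f = 0) := by
    intro M hM
    obtain ⟨Q₂, Q₁, Q₀, f₂, f₁, f₀, -, h₁, h₀, ⟨e₂, e₁, e₀, es⟩, c₁, c₂, c₃, c₄⟩ := key M hM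
    refine ⟨Q₂, Q₁, ModuleCat.of A (LinearMap.range f₁), Q₀, f₂, f₁.rangeRestrict,
      (LinearMap.range f₁).subtype, f₀, h₁.2, h₀.2, e₂, fun x => ?_,
      f₁.surjective_rangeRestrict, Submodule.subtype_injective _, fun x => ?_, es, c₁, c₂, c₃, ?_⟩
    · exact Subtype.ext_iff.trans (e₁ x)
    · rw [e₀ x]
      constructor
      · rintro ⟨y, rfl⟩
        exact ⟨⟨_, y, rfl⟩, rfl⟩
      · rintro ⟨⟨_, y, rfl⟩, rfl⟩
        exact ⟨y, rfl⟩
    · intro f hf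
      refine c₄ f (LinearMap.ext fun x => ?_)
      exact LinearMap.congr_fun hf ⟨f₁ x, x, rfl⟩
  refine ⟨fun M hM => ?_, fun M hM N N' q hq x hx => ?_, fun M hM N hN g => ?_, fun M hM g => ?_,
    fun M hM => ?_⟩
  · obtain ⟨Q₂, Q₁, Q₀, f₂, f₁, f₀, h₂, h₁, h₀, h, -⟩ := key M hM
    exact ⟨Q₂, Q₁, Q₀, f₂, f₁, f₀, h₂, h₁, h₀, h⟩
  · obtain ⟨Q₂, Q₁, Ω, Q₀, f₂, s, i, f₀, p₁, p₀, i₂, e₁, s₁, i₁, e₀, s₀, c, -⟩ := key' M hM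
    let S₀ := shortExact_of i₁ e₀ s₀
    let S₁ := shortExact_of i₂ e₁ s₁
    have hQ₀ (N : ModuleCat.{u} A) (n : ℕ) := subsingleton_ext_of_projective Q₀ N (n + 1) (by omega)
    have hQ₁ (N : ModuleCat.{u} A) := subsingleton_ext_of_projective Q₁ N 1 (by omega)
    -- Every class in Ext²(M, N) is the Yoneda product of the two extension classes with a map f :
    -- Q₂ → N.
    obtain ⟨y, rfl⟩ := Ext.contravariant_sequence_exact₃ S₀ N x (Subsingleton.elim _ _)
      (show 1 + 1 = 2 from rfl)
    obtain ⟨z, rfl⟩ := Ext.contravariant_sequence_exact₃ S₁ N y (Subsingleton.elim _ _)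
      (show 1 + 0 = 1 from rfl)
    obtain ⟨f, rfl⟩ := (Ext.mk₀_bijective _ N).2 z
    rw [Ext.comp_assoc_of_third_deg_zero, Ext.comp_assoc_of_third_deg_zero,
      Ext.mk₀_comp_mk₀] at hx
    have h1 := extClass_comp_injective S₀ _ hx
    obtain ⟨ψ, hψ⟩ := (extClass_comp_mk₀_eq_zero_iff S₁ _).1 h1
    obtain ⟨χ, hχ⟩ := c N N' q.hom (fun g => by
      obtain ⟨g', hg'⟩ := hq (ModuleCat.ofHom g)
      exact ⟨g'.hom, congrArg ModuleCat.Hom.hom hg'⟩) f.hom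
      ⟨ψ.hom, congrArg ModuleCat.Hom.hom hψ⟩
    rw [(extClass_comp_mk₀_eq_zero_iff S₁ f).2 ⟨ModuleCat.ofHom χ, ModuleCat.hom_ext hχ⟩,
      Ext.comp_zero]
  · obtain ⟨Q₂, Q₁, Ω, Q₀, f₂, s, i, f₀, p₁, p₀, i₂, e₁, s₁, i₁, e₀, s₀, -, c, -⟩ := key' M hM
    let S₀ := shortExact_of i₁ e₀ s₀
    let S₁ := shortExact_of i₂ e₁ s₁
    have hQ₀ (N : ModuleCat.{u} A) (n : ℕ) := subsingleton_ext_of_projective Q₀ N (n + 1) (by omega)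
    refine ModuleCat.hom_ext (c N (fun f => ?_) g.hom)
    have h0 : S₀.extClass.comp (S₁.extClass.comp (Ext.mk₀ (ModuleCat.ofHom f)) (add_zero 1))
      (show 1 + 1 = 2 from rfl) = 0 := Subsingleton.elim _ _
    have h1 := extClass_comp_injective S₀ _ h0
    obtain ⟨ψ, hψ⟩ := (extClass_comp_mk₀_eq_zero_iff S₁ _).1 h1
    exact ⟨ψ.hom, congrArg ModuleCat.Hom.hom hψ⟩
  · obtain ⟨Q₂, Q₁, Ω, Q₀, f₂, s, i, f₀, p₁, p₀, i₂, e₁, s₁, i₁, e₀, s₀, -, -, -, c⟩ := key' M hM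
    have h := c (g.hom ∘ₗ f₀) (by
      ext x
      change g.hom (f₀ (i x)) = 0
      rw [(e₀ _).2 ⟨x, rfl⟩, map_zero])
    ext m
    obtain ⟨y, rfl⟩ := s₀ m
    exact LinearMap.congr_fun h y
  · obtain ⟨Q₂, Q₁, Ω, Q₀, f₂, s, i, f₀, p₁, p₀, i₂, e₁, s₁, i₁, e₀, s₀, -, -, c, -⟩ := key' M hM
    let S₀ := shortExact_of i₁ e₀ s₀
    have hQ₀ (N : ModuleCat.{u} A) (n : ℕ) := subsingleton_ext_of_projective Q₀ N (n + 1) (by omega)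
    refine subsingleton_ext_one_of_forall_extend S₀ fun f => ?_
    obtain ⟨g, hg⟩ := c (f.hom ∘ₗ s) (by
      ext x
      change f.hom (s (f₂ x)) = 0
      rw [(e₁ _).2 ⟨x, rfl⟩, map_zero])
    refine ⟨ModuleCat.ofHom g, ModuleCat.hom_ext (LinearMap.ext fun y => ?_)⟩
    obtain ⟨z, rfl⟩ := s₁ y
    exact LinearMap.congr_fun hg z

theorem IsCalabiYau.hasCYDuality (h : IsCalabiYau K A 2) :
    HasCYDuality K A ∧ HasCYDuality K Aᵐᵒᵖ := by
  obtain ⟨P⟩ := h.nonempty_resolution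
  exact ⟨P.hasCYDuality, P.opposite.hasCYDuality⟩

end FromResolution

/-! ### Finite-dimensional modules -/

section FinDim

variable {K : Type v} [Field K] {R : Type u} [Ring R] [Algebra K R]
  {M N L : Type u} [AddCommGroup M] [Module R M] [AddCommGroup N] [Module R N]
  [AddCommGroup L] [Module R L]

theorem finDim_iff [Module K M] [IsScalarTower K R M] : FinDim K R M ↔ Module.Finite K M := by
  let e : RestrictScalars K R M ≃ₗ[K] M :=
    { (RestrictScalars.addEquiv K R M) with
      map_smul' := fun c x => by
        change RestrictScalars.addEquiv K R M (c • x) = c • RestrictScalars.addEquiv K R M x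
        rw [RestrictScalars.addEquiv_map_smul, algebraMap_smul] }
  exact Module.Finite.equiv_iff e

theorem isScalarTower_compHom (M : Type u) [AddCommGroup M] [Module R M] :
    letI : Module K M := Module.compHom M (algebraMap K R)
    IsScalarTower K R M :=
  letI : Module K M := Module.compHom M (algebraMap K R)
  IsScalarTower.of_algebraMap_smul fun _ _ => rfl

theorem FinDim.of_surjective (h : FinDim K R M) (f : M →ₗ[R] N) (hf : Function.Surjective f) :
    FinDim K R N := by
  let _ : Module K M := Module.compHom M (algebraMap K R)
  let _ : Module K N := Module.compHom N (algebraMap K R)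
  have := isScalarTower_compHom (K := K) (R := R) M
  have := isScalarTower_compHom (K := K) (R := R) N
  rw [finDim_iff] at h ⊢
  exact Module.Finite.of_surjective (f.restrictScalars K) hf

theorem FinDim.of_injective (h : FinDim K R N) (f : M →ₗ[R] N) (hf : Function.Injective f) :
    FinDim K R M := by
  let _ : Module K M := Module.compHom M (algebraMap K R)
  let _ : Module K N := Module.compHom N (algebraMap K R)
  have := isScalarTower_compHom (K := K) (R := R) M
  have := isScalarTower_compHom (K := K) (R := R) N
  rw [finDim_iff] at h ⊢
  exact Module.Finite.of_injective (f.restrictScalars K) hf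

theorem FinDim.of_exact (hM : FinDim K R M) (hL : FinDim K R L) (f : M →ₗ[R] N) (g : N →ₗ[R] L)
    (h : Function.Exact f g) : FinDim K R N := by
  let _ : Module K M := Module.compHom M (algebraMap K R)
  let _ : Module K N := Module.compHom N (algebraMap K R)
  let _ : Module K L := Module.compHom L (algebraMap K R)
  have := isScalarTower_compHom (K := K) (R := R) M
  have := isScalarTower_compHom (K := K) (R := R) N
  have := isScalarTower_compHom (K := K) (R := R) L
  rw [finDim_iff] at hM hL ⊢
  let g' := g.restrictScalars K
  have h1 : Module.Finite K (N ⧸ LinearMap.ker g') :=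
    Module.Finite.equiv g'.quotKerEquivRange.symm
  have h2 : Module.Finite K (LinearMap.ker g') := by
    refine Module.Finite.of_surjective ((f.restrictScalars K).codRestrict (LinearMap.ker g')
      fun x => (h _).2 ⟨x, rfl⟩) ?_
    rintro ⟨y, hy⟩
    obtain ⟨x, hx⟩ := (h y).1 hy
    exact ⟨x, Subtype.ext hx⟩
  exact Module.Finite.of_submodule_quotient (LinearMap.ker g')

theorem FinDim.pi (h : FinDim K R M) (n : ℕ) : FinDim K R (Fin n → M) := by
  let _ : Module K M := Module.compHom M (algebraMap K R)
  have := isScalarTower_compHom (K := K) (R := R) M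
  rw [finDim_iff] at h ⊢
  infer_instance

/-- A finite K-spanning family works because scalars from K are central: what kills the family kills
its span. -/
theorem FinDim.exists_faithful_family (h : FinDim K R M) :
    ∃ (n : ℕ) (s : Fin n → M), ∀ a : R, (∀ i, a • s i = 0) → ∀ m : M, a • m = 0 := by
  let _ : Module K M := Module.compHom M (algebraMap K R)
  have := isScalarTower_compHom (K := K) (R := R) M
  rw [finDim_iff] at h
  obtain ⟨n, s, hs⟩ := Module.Finite.exists_fin (R := K) (M := M)
  refine ⟨n, s, fun a ha m => ?_⟩
  have hm : m ∈ Submodule.span K (Set.range s) := by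
    rw [hs]; trivial
  induction hm using Submodule.span_induction with
  | mem x hx =>
    obtain ⟨i, rfl⟩ := hx
    exact ha i
  | zero => simp
  | add x y _ _ hx hy => rw [smul_add, hx, hy, add_zero]
  | smul c x _ hx =>
    rw [← algebraMap_smul R c x, smul_smul, ← Algebra.commutes, mul_smul, hx, smul_zero]

theorem FinDim.of_finite_of_smul_eq_zero [Module.Finite R M] {I : Ideal R}
    (hI : FinDim K R (R ⧸ I)) [I.IsTwoSided] (h : ∀ a ∈ I, ∀ m : M, a • m = 0) :
    FinDim K R M := by
  obtain ⟨n, s, hs⟩ := Module.Finite.exists_fin (R := R) (M := M)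
  let φ (m : M) : (R ⧸ I) →ₗ[R] M := Submodule.liftQ I (LinearMap.toSpanSingleton R M m)
    fun a ha => h a ha m
  refine (hI.pi n).of_surjective (∑ i, φ (s i) ∘ₗ LinearMap.proj i) ?_
  rw [← LinearMap.range_eq_top, eq_top_iff, ← hs, Submodule.span_le]
  rintro _ ⟨i, rfl⟩
  refine ⟨Pi.single i (Submodule.Quotient.mk 1), ?_⟩
  rw [LinearMap.sum_apply, Finset.sum_eq_single i]
  · rw [LinearMap.comp_apply, LinearMap.proj_apply, Pi.single_eq_same]
    exact one_smul R (s i)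
  · intro j _ hj
    simp [Pi.single_eq_of_ne hj]
  · simp

end FinDim

section

variable {R : Type u} [Ring R]

theorem inAdd_self_of_projective (P : Type u) [AddCommGroup P] [Module R P] [Module.Finite R P]
    [Module.Projective R P] : InAdd R R P := by
  obtain ⟨n, f, g, -, -, h⟩ := Module.Finite.exists_comp_eq_id_of_projective R P
  exact ⟨n, g, f, h⟩

theorem projective_of_inAdd_self (P : Type u) [AddCommGroup P] [Module R P] (h : InAdd R R P) :
    Module.Projective R P := by
  obtain ⟨n, i, p, h⟩ := h
  exact Module.Projective.of_split i p h

end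

/-! ### Left ideals of finite codimension -/

section Cofinite

open Abelian

variable {K : Type v} [Field K] {R : Type u} [Ring R] [Algebra K R]

/-- Schanuel's argument comparing Q₀ → R/T with R → R/T: the kernel of Q₁ ⊕ R → Q₀ is projective,
the second coordinate maps it onto T, and the kernel of that map is Q₂. -/
theorem HasCYDuality.exists_resolution_ideal (h : HasCYDuality K R) {T : Ideal R}
    (hT : FinDim K R (R ⧸ T)) :
    ∃ (P₁ P₀ : ModuleCat.{u} R) (f : P₁ →ₗ[R] P₀) (g : P₀ →ₗ[R] T),
      InAdd R R P₁ ∧ InAdd R R P₀ ∧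
        Function.Injective f ∧ Function.Exact f g ∧ Function.Surjective g := by
  obtain ⟨Q₂, Q₁, Q₀, f₂, f₁, f₀, ⟨_, _⟩, ⟨_, _⟩, ⟨_, _⟩, i₂, e₁, e₀, s₀⟩ :=
    h.exists_resolution (ModuleCat.of R (R ⧸ T)) hT
  obtain ⟨s, hs⟩ := Module.projective_lifting_property f₀ T.mkQ s₀
  have hs' (a : R) : f₀ (s a) = T.mkQ a := LinearMap.congr_fun hs a
  let φ : (Q₁ × R) →ₗ[R] Q₀ := f₁.coprod s
  have hφ : Function.Surjective φ := by
    intro q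
    obtain ⟨a, ha⟩ := T.mkQ_surjective (f₀ q)
    obtain ⟨x, hx⟩ := (e₀ (q - s a)).1 (by rw [map_sub, hs', ha, sub_self])
    exact ⟨(x, a), by simp [φ, hx]⟩
  obtain ⟨σ, hσ⟩ := Module.projective_lifting_property φ LinearMap.id hφ
  have hσ' (q : Q₀) : φ (σ q) = q := LinearMap.congr_fun hσ q
  let r : (Q₁ × R) →ₗ[R] LinearMap.ker φ :=
    (LinearMap.id - σ ∘ₗ φ).codRestrict (LinearMap.ker φ) fun x => by simp [hσ']
  have hr : r ∘ₗ (LinearMap.ker φ).subtype = LinearMap.id := by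
    ext1 x
    refine Subtype.ext ?_
    simp [r]
  have : Module.Projective R (LinearMap.ker φ) := Module.Projective.of_split _ _ hr
  have : Module.Finite R (LinearMap.ker φ) := Module.Finite.of_surjective r fun x =>
    ⟨x, LinearMap.congr_fun hr x⟩
  refine ⟨Q₂, ModuleCat.of R (LinearMap.ker φ),
    (LinearMap.inl R Q₁ R ∘ₗ f₂).codRestrict _ fun x => ?_,
    (LinearMap.snd R Q₁ R ∘ₗ (LinearMap.ker φ).subtype).codRestrict T fun x => ?_,
    inAdd_self_of_projective _, inAdd_self_of_projective _, fun x y hxy => ?_, fun x => ?_,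
    fun a => ?_⟩
  · simpa [φ] using (e₁ _).2 ⟨x, rfl⟩
  · obtain ⟨⟨x, a⟩, hx⟩ := x
    have h0 : f₁ x + s a = 0 := by simpa [φ] using hx
    have h1 := congrArg f₀ h0
    rw [map_add, map_zero, (e₀ _).2 ⟨x, rfl⟩, zero_add, hs'] at h1
    exact (Submodule.Quotient.mk_eq_zero T).1 h1
  · exact i₂ (congrArg (fun z : LinearMap.ker φ => z.1.1) hxy)
  · obtain ⟨⟨x, a⟩, hx⟩ := x
    have h0 : f₁ x + s a = 0 := by simpa [φ] using hx
    constructor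
    · intro ha
      have ha' : a = 0 := congrArg (fun z : T => (z : R)) ha
      subst ha'
      rw [map_zero, add_zero] at h0
      obtain ⟨y, hy⟩ := (e₁ x).1 h0
      exact ⟨y, Subtype.ext (Prod.ext hy rfl)⟩
    · rintro ⟨y, hy⟩
      exact Subtype.ext (congrArg (fun z : LinearMap.ker φ => z.1.2) hy).symm
  · obtain ⟨x, hx⟩ := (e₀ (s a)).1 (by
      rw [hs']
      exact (Submodule.Quotient.mk_eq_zero T).2 a.2)
    exact ⟨⟨(-x, a), by simp [φ, hx]⟩, rfl⟩

theorem subsingleton_ext_of_resolution {M : Type u} [AddCommGroup M] [Module R M]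
    (h : ∃ (P₁ P₀ : ModuleCat.{u} R) (f : P₁ →ₗ[R] P₀) (g : P₀ →ₗ[R] M),
      InAdd R R P₁ ∧ InAdd R R P₀ ∧
        Function.Injective f ∧ Function.Exact f g ∧ Function.Surjective g)
    (N : ModuleCat.{u} R) {i : ℕ} (hi : 1 < i) : Subsingleton (Ext (ModuleCat.of R M) N i) := by
  obtain ⟨P₁, P₀, f, g, h₁, h₀, hf, hfg, hg⟩ := h
  have := projective_of_inAdd_self P₁ h₁
  have := projective_of_inAdd_self P₀ h₀
  have := subsingleton_ext_of_projective P₁ N (i - 1) (by omega)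
  have := subsingleton_ext_of_projective P₀ N i (by omega)
  refine subsingleton_of_forall_eq 0 fun x => ?_
  obtain ⟨y, rfl⟩ := Ext.contravariant_sequence_exact₃ (shortExact_of hf hfg hg) N x
    (Subsingleton.elim _ _) (show 1 + (i - 1) = i by omega)
  rw [Subsingleton.elim y 0, Ext.comp_zero]

theorem HasCYDuality.finite_ideal (h : HasCYDuality K R) {T : Ideal R}
    (hT : FinDim K R (R ⧸ T)) : Module.Finite R T := by
  obtain ⟨P₁, P₀, f, g, -, ⟨n, i, p, hp⟩, -, -, hg⟩ := h.exists_resolution_ideal hT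
  have : Module.Finite R P₀ :=
    Module.Finite.of_surjective p fun x => ⟨i x, LinearMap.congr_fun hp x⟩
  exact Module.Finite.of_surjective g hg

theorem HasCYDuality.isPartialTilting (h : HasCYDuality K R) {T : Ideal R}
    (hT : FinDim K R (R ⧸ T))
    (hE : Subsingleton (Ext (ModuleCat.of R T) (ModuleCat.of R T) 1)) :
    IsPartialTilting R T := by
  refine ⟨h.exists_resolution_ideal hT, fun i hi => ?_⟩
  rcases Nat.lt_or_ge 1 i with h1 | h1
  · exact subsingleton_ext_of_resolution (h.exists_resolution_ideal hT) _ h1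
  · obtain rfl : i = 1 := by omega
    exact hE

theorem exact_inclusion_mkQ {T' T : Ideal R} (hT : T' ≤ T) :
    Function.Exact (Submodule.inclusion hT) (T'.submoduleOf T).mkQ := by
  intro x
  rw [Submodule.mkQ_apply, Submodule.Quotient.mk_eq_zero, Submodule.submoduleOf,
    Submodule.mem_comap]
  exact ⟨fun hx => ⟨⟨x, hx⟩, rfl⟩, by rintro ⟨y, rfl⟩; exact y.2⟩

theorem shortExact_inclusion {T' T : Ideal R} (hT : T' ≤ T) :
    (shortComplexOf (Submodule.inclusion hT) (T'.submoduleOf T).mkQ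
      (exact_inclusion_mkQ hT)).ShortExact :=
  shortExact_of (Submodule.inclusion_injective hT) _ (Submodule.mkQ_surjective _)

theorem shortExact_ideal (T : Ideal R) :
    (shortComplexOf T.subtype T.mkQ (LinearMap.exact_subtype_mkQ T)).ShortExact :=
  shortExact_of T.subtype_injective _ T.mkQ_surjective

theorem map_eq_zero_of_mem_mul {I T : Ideal R} {V : Type u} [AddCommGroup V] [Module R V]
    (hV : ∀ a ∈ I, ∀ v : V, a • v = 0) (f : T →ₗ[R] V) (x : T) (hx : (x : R) ∈ I * T) :
    f x = 0 := by
  obtain ⟨x, hxT⟩ := x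
  change x ∈ I * T at hx
  induction hx using Submodule.mul_induction_on' with
  | mem_mul_mem a ha t ht =>
    have : (⟨a * t, hxT⟩ : T) = a • ⟨t, ht⟩ := rfl
    rw [this, map_smul, hV a ha]
  | add x hx y hy h1 h2 =>
    have : (⟨x + y, hxT⟩ : T) = ⟨x, Ideal.mul_le_right hx⟩ + ⟨y, Ideal.mul_le_right hy⟩ := rfl
    rw [this, map_add, h1, h2, add_zero]

theorem smul_quotient_mul_eq_zero {I T : Ideal R} (a : R) (ha : a ∈ I)
    (v : T ⧸ (I * T).submoduleOf T) : a • v = 0 := by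
  obtain ⟨t, rfl⟩ := Submodule.Quotient.mk_surjective _ v
  rw [← Submodule.Quotient.mk_smul, Submodule.Quotient.mk_eq_zero]
  exact Ideal.mul_mem_mul ha t.2

/-- T is finitely generated, so T/IT is finitely generated over the finite-dimensional ring R/I;
then R/IT is an extension of R/T by T/IT. -/
theorem HasCYDuality.finDim_quotient_mul (h : HasCYDuality K R) {I T : Ideal R} [I.IsTwoSided]
    (hI : FinDim K R (R ⧸ I)) (hT : FinDim K R (R ⧸ T)) : FinDim K R (R ⧸ I * T) := by
  have := h.finite_ideal hT
  have hV : FinDim K R (T ⧸ (I * T).submoduleOf T) :=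
    FinDim.of_finite_of_smul_eq_zero hI smul_quotient_mul_eq_zero
  refine hV.of_exact hT (Submodule.mapQ _ _ T.subtype le_rfl)
    (Submodule.factor Ideal.mul_le_right) fun x => ?_
  obtain ⟨x, rfl⟩ := Submodule.Quotient.mk_surjective _ x
  change (Submodule.Quotient.mk x : R ⧸ T) = 0 ↔ _
  rw [Submodule.Quotient.mk_eq_zero]
  constructor
  · intro hx
    exact ⟨Submodule.Quotient.mk ⟨x, hx⟩, rfl⟩
  · rintro ⟨y, hy⟩
    obtain ⟨y, rfl⟩ := Submodule.Quotient.mk_surjective _ y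
    have h1 := (Submodule.Quotient.eq _).1 hy
    have h2 := T.sub_mem y.2 (Ideal.mul_le_right h1)
    simpa using h2

/-- Put V = T/IT, which I kills. The argument moves x from Ext¹(IT, IT) to Ext¹(IT, T), then to
Ext²(V, T), shows that it vanishes there, and retraces the steps. -/
theorem HasCYDuality.ext_one_mul (h : HasCYDuality K R) {I T : Ideal R} [I.IsTwoSided]
    (hI : FinDim K R (R ⧸ I)) (hII : I * I = I) (hT : FinDim K R (R ⧸ T))
    (hE : Subsingleton (Ext (ModuleCat.of R T) (ModuleCat.of R T) 1)) :
    Subsingleton (Ext (ModuleCat.of R (I * T : Ideal R)) (ModuleCat.of R (I * T : Ideal R)) 1) := by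
  have := h.finite_ideal hT
  have hle : I * T ≤ T := Ideal.mul_le_right
  have hV : FinDim K R (T ⧸ (I * T).submoduleOf T) :=
    FinDim.of_finite_of_smul_eq_zero hI smul_quotient_mul_eq_zero
  let S := shortExact_inclusion hle
  refine subsingleton_of_forall_eq 0 fun x => ?_
  -- Maps T → V kill IT and so factor through V, hence Ext²(V, T) → Ext²(V, V) is injective by
  -- duality; and the class dies in Ext²(V, V) because IT → T → V is zero.
  have hy : S.extClass.comp (x.comp (Ext.mk₀ (ModuleCat.ofHom (Submodule.inclusion hle)))
      (add_zero 1)) (show 1 + 1 = 2 from rfl) = 0 := by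
    refine h.ext_two_injective (ModuleCat.of R (T ⧸ (I * T).submoduleOf T)) hV _ _
      (ModuleCat.ofHom ((I * T).submoduleOf T).mkQ) (fun g => ?_) _ ?_
    · refine ⟨ModuleCat.ofHom (Submodule.liftQ _ g.hom fun t ht => ?_), ?_⟩
      · exact map_eq_zero_of_mem_mul (T := T) smul_quotient_mul_eq_zero g.hom t ht
      · ext t
        rfl
    · rw [Ext.comp_assoc_of_third_deg_zero, Ext.comp_assoc_of_third_deg_zero, Ext.mk₀_comp_mk₀,
        show ModuleCat.ofHom (Submodule.inclusion hle) ≫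
          ModuleCat.ofHom ((I * T).submoduleOf T).mkQ = 0 from
          (shortComplexOf _ _ (exact_inclusion_mkQ hle)).zero,
        Ext.mk₀_zero, Ext.comp_zero, Ext.comp_zero]
  have hE' : Subsingleton (Ext (shortComplexOf (Submodule.inclusion hle) _
    (exact_inclusion_mkQ hle)).X₂ (ModuleCat.of R T) 1) := hE
  -- Ext¹(T, T) = 0 makes Ext¹(IT, T) → Ext²(V, T) injective. So x comes from a map IT → V, which is
  -- zero as IT = I(IT) and IV = 0.
  have hx := extClass_comp_injective S _ hy
  obtain ⟨z, rfl⟩ := Ext.covariant_sequence_exact₁ _ S x hx (zero_add 1)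
  obtain ⟨g, rfl⟩ := (Ext.mk₀_bijective _ _).2 z
  suffices g = 0 by rw [this, Ext.mk₀_zero, Ext.zero_comp]
  ext t
  refine map_eq_zero_of_mem_mul (I := I) (T := I * T) smul_quotient_mul_eq_zero g.hom t ?_
  rw [← mul_assoc, hII]
  exact t.2

/-- Restriction Hom(R, R) → Hom(T, R) is bijective: Ext¹(R/T, R) = 0 gives existence, Hom(R/T, R) =
0 gives uniqueness. -/
theorem HasCYDuality.exists_eq_mul (h : HasCYDuality K R) {T : Ideal R}
    (hT : FinDim K R (R ⧸ T)) (f : T →ₗ[R] R) : ∃! a : R, ∀ t : T, f t = t * a := by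
  have : Subsingleton (Ext (shortComplexOf T.subtype T.mkQ (LinearMap.exact_subtype_mkQ T)).X₃
    (ModuleCat.of R R) 1) := h.ext_one_ring (ModuleCat.of R (R ⧸ T)) hT
  obtain ⟨g, hg⟩ := exists_extend_of_subsingleton_ext_one (shortExact_ideal T)
    (ModuleCat.ofHom f)
  refine ⟨g.hom 1, fun t => ?_, fun b hb => ?_⟩
  · have h1 : g.hom (t : R) = f t := LinearMap.congr_fun (congrArg ModuleCat.Hom.hom hg) t
    rw [← h1, ← smul_eq_mul, ← map_smul, smul_eq_mul, mul_one]
  · have h1 : ∀ t ∈ T, t * (b - g.hom 1) = 0 := fun t ht => by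
      have h2 : g.hom t = f ⟨t, ht⟩ := LinearMap.congr_fun (congrArg ModuleCat.Hom.hom hg) ⟨t, ht⟩
      rw [mul_sub, ← hb ⟨t, ht⟩, ← h2, ← smul_eq_mul t, ← map_smul, smul_eq_mul, mul_one, sub_self]
    have h3 := h.hom_ring_eq_zero (ModuleCat.of R (R ⧸ T)) hT (ModuleCat.ofHom
      (Submodule.liftQ T (LinearMap.toSpanSingleton R R (b - g.hom 1)) fun t ht => h1 t ht))
    have h4 := LinearMap.congr_fun (congrArg ModuleCat.Hom.hom h3) (Submodule.Quotient.mk 1)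
    have h5 : (1 : R) • (b - g.hom 1) = 0 := h4
    rwa [one_smul, sub_eq_zero] at h5

end Cofinite

/-! ### Annihilators of rigid simple modules -/

section Rigid

open Abelian

variable {K : Type v} [Field K] {R : Type u} [Ring R] [Algebra K R]

theorem InAdd.subsingleton_ext {M X : Type u} [AddCommGroup M] [Module R M] [AddCommGroup X]
    [Module R X] (h : InAdd R M X) {N : ModuleCat.{u} R} {n : ℕ}
    (hM : Subsingleton (Ext (ModuleCat.of R M) N n)) :
    Subsingleton (Ext (ModuleCat.of R X) N n) := by
  obtain ⟨m, i, p, hp⟩ := h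
  refine subsingleton_of_forall_eq 0 fun x => ?_
  have h0 : ∀ y : Ext (ModuleCat.of R (Fin m → M)) N n, y = 0 := by
    intro y
    have h1 : 𝟙 (ModuleCat.of R (Fin m → M)) = ∑ j : Fin m,
        ModuleCat.ofHom (LinearMap.proj j : (Fin m → M) →ₗ[R] M) ≫
          ModuleCat.ofHom (LinearMap.single R (fun _ : Fin m => M) j) := by
      refine ModuleCat.hom_ext ?_
      rw [ModuleCat.hom_sum]
      refine LinearMap.ext fun x => ?_
      rw [LinearMap.sum_apply]
      exact (Finset.univ_sum_single x).symm
    rw [← Ext.mk₀_id_comp y, h1, Ext.mk₀_sum, Ext.sum_comp]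
    refine Finset.sum_eq_zero fun j _ => ?_
    rw [← Ext.mk₀_comp_mk₀_assoc,
      Subsingleton.elim ((Ext.mk₀ (ModuleCat.ofHom (LinearMap.single R _ j))).comp y _) 0,
      Ext.comp_zero]
  have h2 : ModuleCat.ofHom i ≫ ModuleCat.ofHom p = 𝟙 (ModuleCat.of R X) :=
    ModuleCat.hom_ext hp
  rw [← Ext.mk₀_id_comp x, ← h2, ← Ext.mk₀_comp_mk₀_assoc, h0 ((Ext.mk₀ _).comp x _),
    Ext.comp_zero]

section Simple

variable {S : Type u} [AddCommGroup S] [Module R S]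

/-- Let R act on a finite family in S whose annihilator is that of S. -/
theorem FinDim.exists_embedding (h : FinDim K R S) :
    ∃ (n : ℕ) (f : (R ⧸ Module.annihilator R S) →ₗ[R] (Fin n → S)), Function.Injective f := by
  obtain ⟨n, s, hs⟩ := h.exists_faithful_family
  let φ : R →ₗ[R] (Fin n → S) := LinearMap.pi fun i => LinearMap.toSpanSingleton R S (s i)
  have hφ : Module.annihilator R S ≤ LinearMap.ker φ := fun a ha => by
    refine LinearMap.mem_ker.2 (funext fun i => ?_)
    exact Module.mem_annihilator.1 ha (s i)
  refine ⟨n, Submodule.liftQ _ φ hφ, LinearMap.ker_eq_bot.1 ?_⟩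
  exact Submodule.ker_liftQ_eq_bot _ _ hφ fun a ha =>
    Module.mem_annihilator.2 (hs a fun i => congrFun ha i)

theorem FinDim.quotient_annihilator (h : FinDim K R S) :
    FinDim K R (R ⧸ Module.annihilator R S) := by
  obtain ⟨n, f, hf⟩ := h.exists_embedding
  exact (h.pi n).of_injective f hf

variable [IsSimpleModule R S]

theorem FinDim.isSemisimpleModule_quotient (h : FinDim K R S) :
    IsSemisimpleModule R (R ⧸ Module.annihilator R S) := by
  obtain ⟨n, f, hf⟩ := h.exists_embedding
  exact IsSemisimpleModule.of_injective f hf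

theorem FinDim.inAdd_quotient (h : FinDim K R S) :
    InAdd R S (R ⧸ Module.annihilator R S) := by
  obtain ⟨n, f, hf⟩ := h.exists_embedding
  obtain ⟨p, hp⟩ := IsSemisimpleModule.extension_property f hf LinearMap.id
  exact ⟨n, f, p, hp⟩

/-- X is a quotient, hence a summand, of the semisimple module R/Ann S, which embeds in a power of
S; some coordinate X → S is nonzero and Schur's lemma applies. -/
theorem FinDim.nonempty_equiv_of_smul_eq_zero (h : FinDim K R S) {X : Type u} [AddCommGroup X]
    [Module R X] [IsSimpleModule R X] (hX : ∀ a ∈ Module.annihilator R S, ∀ x : X, a • x = 0) :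
    Nonempty (X ≃ₗ[R] S) := by
  obtain ⟨n, f, hf⟩ := h.exists_embedding
  have := h.isSemisimpleModule_quotient
  have := IsSimpleModule.nontrivial R X
  obtain ⟨x, hx⟩ := exists_ne (0 : X)
  let φ : (R ⧸ Module.annihilator R S) →ₗ[R] X :=
    Submodule.liftQ _ (LinearMap.toSpanSingleton R X x) fun a ha => hX a ha x
  have hφ : Function.Surjective φ := fun y => by
    obtain ⟨a, ha⟩ := IsSimpleModule.toSpanSingleton_surjective R hx y
    exact ⟨Submodule.Quotient.mk a, ha⟩
  obtain ⟨σ, hσ⟩ := IsSemisimpleModule.lifting_property φ hφ LinearMap.id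
  have hne : f (σ x) ≠ 0 := fun h0 => hx (by
    have h1 : σ x = 0 := hf (h0.trans (map_zero f).symm)
    have h2 : φ (σ x) = x := LinearMap.congr_fun hσ x
    rw [← h2, h1, map_zero])
  obtain ⟨i, hi⟩ := Function.ne_iff.1 hne
  have hb := LinearMap.bijective_of_ne_zero
    (f := (LinearMap.proj i : (Fin n → S) →ₗ[R] S) ∘ₗ f ∘ₗ σ)
    fun h0 => hi (LinearMap.congr_fun h0 x)
  exact ⟨LinearEquiv.ofBijective _ hb⟩

theorem FinDim.exists_hom_ne_zero (h : FinDim K R S) {V : Type u} [AddCommGroup V]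
    [Module R V] [Module.Finite R V] [Nontrivial V]
    (hV : ∀ a ∈ Module.annihilator R S, ∀ v : V, a • v = 0) : ∃ f : V →ₗ[R] S, f ≠ 0 := by
  obtain ⟨N, hN, -⟩ := (eq_top_or_exists_le_coatom (⊥ : Submodule R V)).resolve_left bot_ne_top
  have : IsSimpleModule R (V ⧸ N) := isSimpleModule_iff_isCoatom.2 hN
  obtain ⟨e⟩ := h.nonempty_equiv_of_smul_eq_zero (X := V ⧸ N) fun a ha x => by
    obtain ⟨v, rfl⟩ := N.mkQ_surjective x
    rw [← map_smul, hV a ha, map_zero]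
  refine ⟨e.toLinearMap ∘ₗ N.mkQ, fun h0 => hN.1 (eq_top_iff.2 fun v _ => ?_)⟩
  have h1 : e (N.mkQ v) = 0 := LinearMap.congr_fun h0 v
  rw [map_eq_zero_iff e e.injective] at h1
  exact (Submodule.Quotient.mk_eq_zero N).1 h1

/-- The quotient of T by Ann(S) T' is finitely generated and killed by Ann S, so if nonzero it would
map nontrivially to S. This serves both for the idempotence of Ann S and for splitting off a factor
from a rigid ideal. -/
theorem FinDim.eq_mul_of_forall_hom_eq_zero (h : FinDim K R S) {T T' : Ideal R}
    [Module.Finite R T] (hle : Module.annihilator R S * T' ≤ T)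
    (hT : ∀ t ∈ T, ∀ a ∈ Module.annihilator R S, a * t ∈ Module.annihilator R S * T')
    (h0 : ∀ f : T →ₗ[R] S, (∀ t : T, (t : R) ∈ Module.annihilator R S * T' → f t = 0) → f = 0) :
    T = Module.annihilator R S * T' := by
  refine le_antisymm ?_ hle
  by_contra hne
  let N := (Module.annihilator R S * T').submoduleOf T
  have : Nontrivial (T ⧸ N) := by
    refine Submodule.Quotient.nontrivial_iff.2 fun hN => hne fun t ht => ?_
    have : (⟨t, ht⟩ : T) ∈ N := by rw [hN]; trivial
    exact this
  obtain ⟨f, hf⟩ := h.exists_hom_ne_zero (V := T ⧸ N) fun a ha v => by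
    obtain ⟨t, rfl⟩ := N.mkQ_surjective v
    rw [← map_smul]
    exact (Submodule.Quotient.mk_eq_zero N).2 (hT t t.2 a ha)
  refine hf ((LinearMap.cancel_right N.mkQ_surjective).1 ?_)
  rw [h0 (f ∘ₗ N.mkQ) fun t ht => ?_, LinearMap.zero_comp]
  rw [LinearMap.comp_apply, Submodule.mkQ_apply, (Submodule.Quotient.mk_eq_zero N).2 ht, map_zero]

end Simple

/-- Rigidity of S gives Ext¹(R/I, S) = 0 for I = Ann S, so a map I → S extends to R and has the form
t ↦ ts, which is zero. -/
theorem HasCYDuality.annihilator_mul_self (h : HasCYDuality K R) {S : ModuleCat.{u} R}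
    (hS : IsFinDimRigidSimple K S) :
    Module.annihilator R S * Module.annihilator R S = Module.annihilator R S := by
  have := hS.simple
  have := hS.rigid
  have := h.finite_ideal hS.finDim.quotient_annihilator
  have hE : Subsingleton (Ext (shortComplexOf (Module.annihilator R S).subtype
    (Module.annihilator R S).mkQ (LinearMap.exact_subtype_mkQ _)).X₃ S 1) :=
    hS.finDim.inAdd_quotient.subsingleton_ext hS.rigid
  refine (hS.finDim.eq_mul_of_forall_hom_eq_zero (T' := Module.annihilator R S)
    Ideal.mul_le_right (fun t ht a ha => Ideal.mul_mem_mul ha ht) fun f _ => ?_).symm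
  obtain ⟨g, hg⟩ := exists_extend_of_subsingleton_ext_one
    (shortExact_ideal (Module.annihilator R S)) (ModuleCat.ofHom f)
  ext t
  have h1 : g.hom (t : R) = f t := LinearMap.congr_fun (congrArg ModuleCat.Hom.hom hg) t
  have h2 : g.hom (t : R) = (t : R) • g.hom 1 := by rw [← map_smul, smul_eq_mul, mul_one]
  rw [← h1, h2]
  exact Module.mem_annihilator.1 t.2 _

/-- A left ideal of finite codimension without self-extensions. -/
structure IsCofiniteRigid (K : Type v) [Field K] [Algebra K R] (T : Ideal R) : Prop where
  finDim : FinDim K R (R ⧸ T)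
  ext_one : Subsingleton (Ext (ModuleCat.of R T) (ModuleCat.of R T) 1)

theorem IsCofiniteRigid.top : IsCofiniteRigid K (⊤ : Ideal R) := by
  refine ⟨?_, ?_⟩
  · have : Subsingleton (R ⧸ (⊤ : Ideal R)) := Submodule.Quotient.subsingleton_iff.2 rfl
    exact finDim_iff.2 inferInstance
  · have : Module.Projective R (⊤ : Ideal R) := Module.Projective.of_equiv Submodule.topEquiv.symm
    exact subsingleton_ext_of_projective _ _ 1 one_pos

theorem IsCofiniteRigid.mul (h : HasCYDuality K R) {I T : Ideal R} (hT : IsCofiniteRigid K T)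
    (hI' : I.IsTwoSided) (hI : FinDim K R (R ⧸ I)) (hII : I * I = I) :
    IsCofiniteRigid K (I * T) :=
  ⟨h.finDim_quotient_mul hI hT.finDim, h.ext_one_mul hI hII hT.finDim hT.ext_one⟩

theorem IsCofiniteRigid.isPartialTilting (h : HasCYDuality K R) {T : Ideal R}
    (hT : IsCofiniteRigid K T) : IsPartialTilting R T :=
  h.isPartialTilting hT.finDim hT.ext_one

/-- An isomorphism I → I' is right multiplication by some a, so I' = Ia lies in the two-sided ideal
I; the inverse gives the other inclusion. -/
theorem HasCYDuality.eq_of_equiv (h : HasCYDuality K R) {I I' : Ideal R} (hI : I.IsTwoSided)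
    (hI' : I'.IsTwoSided) (hF : FinDim K R (R ⧸ I)) (hF' : FinDim K R (R ⧸ I'))
    (e : I ≃ₗ[R] I') : I = I' := by
  have key : ∀ {J J' : Ideal R}, J.IsTwoSided → FinDim K R (R ⧸ J) → (J ≃ₗ[R] J') → J' ≤ J := by
    intro J J' hJ hF e x hx
    obtain ⟨a, ha, -⟩ := h.exists_eq_mul hF (J'.subtype ∘ₗ e.toLinearMap)
    have h1 := ha (e.symm ⟨x, hx⟩)
    simp only [LinearMap.comp_apply, LinearEquiv.coe_coe, LinearEquiv.apply_symm_apply,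
      Submodule.subtype_apply] at h1
    rw [h1]
    exact hJ.mul_mem_of_left _ (Subtype.coe_prop _)
  exact le_antisymm (key hI' hF' e.symm) (key hI hF e)

end Rigid

/-! ### Products of annihilators -/

section Products

variable {K : Type v} [Field K] {R : Type u} [Ring R] [Algebra K R]

instance annProd_isTwoSided (l : List (ModuleCat.{u} R)) : (annProd l).IsTwoSided := by
  induction l with
  | nil => exact inferInstanceAs (⊤ : Ideal R).IsTwoSided
  | cons S l ih => exact inferInstanceAs (Module.annihilator R S * annProd l).IsTwoSided

theorem annProd_cons (S : ModuleCat.{u} R) (l : List (ModuleCat.{u} R)) :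
    annProd (S :: l) = Module.annihilator R S * annProd l := rfl

theorem annProd_append_singleton (l : List (ModuleCat.{u} R)) (S : ModuleCat.{u} R) :
    annProd (l ++ [S]) = annProd l * Module.annihilator R S := by
  induction l with
  | nil =>
    change Module.annihilator R S * ⊤ = ⊤ * Module.annihilator R S
    rw [Ideal.mul_top, Ideal.top_mul]
  | cons S' l ih => rw [List.cons_append, annProd_cons, ih, annProd_cons, mul_assoc]

theorem isCofiniteRigid_annProd (h : HasCYDuality K R) (l : List (ModuleCat.{u} R))
    (hl : ∀ S ∈ l, IsFinDimRigidSimple K S) : IsCofiniteRigid K (annProd l) := by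
  induction l with
  | nil => exact IsCofiniteRigid.top
  | cons S l ih =>
    have hS := hl S List.mem_cons_self
    exact (ih fun S' hS' => hl S' (List.mem_cons_of_mem _ hS')).mul h inferInstance
      hS.finDim.quotient_annihilator (h.annihilator_mul_self hS)

/-- The annihilator of a simple module is prime, so it contains a factor of any product of two-sided
ideals that it contains. -/
theorem exists_mem_of_annProd_smul_eq_zero {X : Type u} [AddCommGroup X] [Module R X]
    [IsSimpleModule R X] (l : List (ModuleCat.{u} R))
    (hX : ∀ a ∈ annProd l, ∀ x : X, a • x = 0) :
    ∃ S ∈ l, ∀ a ∈ Module.annihilator R S, ∀ x : X, a • x = 0 := by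
  induction l with
  | nil =>
    have := IsSimpleModule.nontrivial R X
    obtain ⟨x, hx⟩ := exists_ne (0 : X)
    exact absurd (by simpa using hX 1 Submodule.mem_top x) hx
  | cons S l ih =>
    by_cases hl : ∀ a ∈ annProd l, ∀ x : X, a • x = 0
    · obtain ⟨S', hS', h'⟩ := ih hl
      exact ⟨S', List.mem_cons_of_mem _ hS', h'⟩
    · push Not at hl
      obtain ⟨b, hb, x, hx⟩ := hl
      refine ⟨S, List.mem_cons_self, fun a ha y => ?_⟩
      obtain ⟨c, rfl⟩ := IsSimpleModule.toSpanSingleton_surjective R hx y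
      rw [LinearMap.toSpanSingleton_apply, smul_smul, smul_smul]
      exact hX _ (Ideal.mul_mem_mul (Ideal.IsTwoSided.mul_mem_of_left c ha) hb) x

theorem inSerre_annProd (h : HasCYDuality K R) {𝒮 : Set (ModuleCat.{u} R)}
    (h𝒮 : ∀ S ∈ 𝒮, IsFinDimRigidSimple K S) (l : List (ModuleCat.{u} R)) (hl : ∀ S ∈ l, S ∈ 𝒮) :
    InSerre K 𝒮 (R ⧸ annProd l) := by
  refine ⟨(isCofiniteRigid_annProd h l fun S hS => h𝒮 S (hl S hS)).finDim, fun N N' hN => ?_⟩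
  have : IsSimpleModule R (N' ⧸ N.submoduleOf N') := (covBy_iff_quot_is_simple hN.le).1 hN
  obtain ⟨S, hS, hS'⟩ := exists_mem_of_annProd_smul_eq_zero
    (X := N' ⧸ N.submoduleOf N') l fun a ha x => by
      obtain ⟨⟨y, hy⟩, rfl⟩ := (N.submoduleOf N').mkQ_surjective x
      obtain ⟨b, rfl⟩ := (annProd l).mkQ_surjective y
      have h0 : a • (annProd l).mkQ b = 0 := by
        rw [← map_smul]
        exact (Submodule.Quotient.mk_eq_zero _).2 (Ideal.IsTwoSided.mul_mem_of_left b ha)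
      have h1 : a • (⟨(annProd l).mkQ b, hy⟩ : N') = 0 := Subtype.ext h0
      rw [← map_smul, h1, map_zero]
  have := (h𝒮 S (hl S hS)).simple
  exact ⟨S, hl S hS, (h𝒮 S (hl S hS)).finDim.nonempty_equiv_of_smul_eq_zero hS'⟩

end Products

/-! ### Tilting modules -/

section Tilting

open Abelian

variable {R : Type u} [Ring R] {T T' : Type u} [AddCommGroup T] [Module R T]
  [AddCommGroup T'] [Module R T']

theorem InAdd.of_equiv (e : T ≃ₗ[R] T') {X : Type u} [AddCommGroup X] [Module R X]
    (h : InAdd R T X) : InAdd R T' X := by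
  obtain ⟨n, i, p, hp⟩ := h
  let E : (Fin n → T) ≃ₗ[R] (Fin n → T') := LinearEquiv.piCongrRight fun _ => e
  refine ⟨n, E.toLinearMap ∘ₗ i, p ∘ₗ E.symm.toLinearMap, LinearMap.ext fun x => ?_⟩
  have := LinearMap.congr_fun hp x
  simpa using this

theorem IsPartialTilting.of_equiv (h : IsPartialTilting R T) (e : T ≃ₗ[R] T') :
    IsPartialTilting R T' := by
  obtain ⟨P₁, P₀, f, g, h₁, h₀, hf, hfg, hg⟩ := h.resolution
  refine ⟨⟨P₁, P₀, f, e.toLinearMap ∘ₗ g, h₁, h₀, hf, fun x => ?_, e.surjective.comp hg⟩,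
    fun i hi => ?_⟩
  · rw [LinearMap.comp_apply, LinearEquiv.coe_coe, map_eq_zero_iff e e.injective, hfg x]
  · refine subsingleton_of_forall_eq 0 fun x => ?_
    have := h.ext_eq_zero i hi
    let α : ModuleCat.of R T ⟶ ModuleCat.of R T' := ModuleCat.ofHom e.toLinearMap
    let β : ModuleCat.of R T' ⟶ ModuleCat.of R T := ModuleCat.ofHom e.symm.toLinearMap
    have hβα : β ≫ α = 𝟙 _ := ModuleCat.hom_ext (LinearMap.ext fun x => e.apply_symm_apply x)
    have hx : x.comp (Ext.mk₀ β) (add_zero i) = 0 := by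
      rw [← Ext.mk₀_id_comp (x.comp (Ext.mk₀ β) _), ← hβα, ← Ext.mk₀_comp_mk₀_assoc,
        Subsingleton.elim ((Ext.mk₀ α).comp (x.comp (Ext.mk₀ β) _) _) 0, Ext.comp_zero]
    rw [← Ext.comp_mk₀_id x, ← hβα, ← Ext.mk₀_comp_mk₀, ← Ext.comp_assoc_of_second_deg_zero, hx,
      Ext.zero_comp]

theorem IsTilting.of_equiv (h : IsTilting R T) (e : T ≃ₗ[R] T') : IsTilting R T' := by
  obtain ⟨T₀, T₁, f, g, h₀, h₁, h'⟩ := h.coresolution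
  exact ⟨h.toIsPartialTilting.of_equiv e, T₀, T₁, f, g, h₀.of_equiv e, h₁.of_equiv e, h'⟩

end Tilting

section Coresolution

open Abelian

variable {R R' : Type u} [Ring R] [Ring R'] {T : Type u} [AddCommGroup T] [Module R T]
  [Module R' T] [SMulCommClass R' R T]

/-- Hom(-, T) turns summands of R'ⁿ into summands of Tⁿ; the remaining action of R on T makes this
R-linear. -/
theorem InAdd.linearMap {Q : Type u} [AddCommGroup Q] [Module R' Q] (h : InAdd R' R' Q) :
    InAdd R T (Q →ₗ[R'] T) := by
  obtain ⟨n, i, p, hp⟩ := h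
  refine ⟨n,
    { toFun := fun φ j => φ (p (Pi.single j 1))
      map_add' := fun _ _ => rfl
      map_smul' := fun _ _ => rfl },
    { toFun := fun t => ∑ j, (LinearMap.toSpanSingleton R' T (t j)) ∘ₗ LinearMap.proj j ∘ₗ i
      map_add' := fun t t' => ?_
      map_smul' := fun a t => ?_ }, LinearMap.ext fun φ => LinearMap.ext fun q => ?_⟩
  · ext q
    simp [LinearMap.sum_apply, Finset.sum_add_distrib]
  · ext q
    simp only [LinearMap.sum_apply, LinearMap.comp_apply, LinearMap.toSpanSingleton_apply,
      Pi.smul_apply, RingHom.id_apply, LinearMap.smul_apply, Finset.smul_sum]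
    exact Finset.sum_congr rfl fun j _ => smul_comm _ _ _
  · have h1 : p (i q) = q := LinearMap.congr_fun hp q
    conv_rhs => rw [LinearMap.id_apply, ← h1, pi_eq_sum_univ (i q), map_sum, map_sum]
    simp only [LinearMap.comp_apply, LinearMap.coe_mk, AddHom.coe_mk, LinearMap.sum_apply,
      LinearMap.proj_apply, LinearMap.toSpanSingleton_apply, map_smul]
    refine Finset.sum_congr rfl fun j _ => ?_
    congr 3
    ext k
    simp [Pi.single_apply, eq_comm]

/-- Apply Hom(-, T) over R' to the projective resolution of T: the first term is the endomorphism
ring, which is R by assumption, and the last map is onto because Ext¹(T, T) = 0. -/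
theorem IsPartialTilting.exists_coresolution (h : IsPartialTilting R' T)
    (h_inj : ∀ a : R, (∀ t : T, a • t = 0) → a = 0)
    (h_surj : ∀ φ : T →ₗ[R'] T, ∃ a : R, ∀ t, φ t = a • t) :
    ∃ (T₀ T₁ : ModuleCat.{u} R) (f : R →ₗ[R] T₀) (g : T₀ →ₗ[R] T₁),
      InAdd R T T₀ ∧ InAdd R T T₁ ∧
        Function.Injective f ∧ Function.Exact f g ∧ Function.Surjective g := by
  obtain ⟨Q₁, Q₀, f, g, h₁, h₀, hf, hfg, hg⟩ := h.resolution
  have hfg0 (x : Q₁) : g (f x) = 0 := (hfg _).2 ⟨x, rfl⟩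
  refine ⟨ModuleCat.of R (Q₀ →ₗ[R'] T), ModuleCat.of R (Q₁ →ₗ[R'] T),
    LinearMap.toSpanSingleton R (Q₀ →ₗ[R'] T) g,
    { toFun := fun φ => φ ∘ₗ f
      map_add' := fun _ _ => rfl
      map_smul' := fun _ _ => rfl }, h₀.linearMap, h₁.linearMap, ?_, fun φ => ⟨fun hφ => ?_, ?_⟩,
    fun φ => ?_⟩
  · rw [← LinearMap.ker_eq_bot, LinearMap.ker_eq_bot']
    intro a ha
    refine h_inj a fun t => ?_
    obtain ⟨q, rfl⟩ := hg t
    exact LinearMap.congr_fun ha q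
  · have hφ' (x : Q₁) : φ (f x) = 0 := LinearMap.congr_fun hφ x
    have hker : LinearMap.ker g ≤ LinearMap.ker φ := fun q hq => by
      obtain ⟨x, rfl⟩ := (hfg q).1 hq
      exact hφ' x
    let e := g.quotKerEquivOfSurjective hg
    obtain ⟨a, ha⟩ := h_surj (Submodule.liftQ _ φ hker ∘ₗ e.symm.toLinearMap)
    refine ⟨a, LinearMap.ext fun q => ?_⟩
    have h1 := ha (g q)
    have h2 : e.symm (g q) = Submodule.Quotient.mk q := by
      rw [LinearEquiv.symm_apply_eq]
      rfl
    rw [LinearMap.comp_apply, LinearEquiv.coe_coe, h2] at h1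
    exact h1.symm
  · rintro ⟨a, rfl⟩
    refine LinearMap.ext fun x => ?_
    change a • g (f x) = 0
    rw [hfg0, smul_zero]
  · have : Subsingleton (Ext (shortComplexOf f g hfg).X₃ (ModuleCat.of R' T) 1) :=
      h.ext_eq_zero 1 one_pos
    obtain ⟨ψ, hψ⟩ := exists_extend_of_subsingleton_ext_one (shortExact_of hf hfg hg)
      (ModuleCat.ofHom φ)
    exact ⟨ψ.hom, congrArg ModuleCat.Hom.hom hψ⟩

end Coresolution

/-! ### Two-sided ideals as right modules -/

section Opposite

variable {R : Type u} [Ring R]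

/-- A two-sided ideal is a right module. -/
instance rightModule (I : Ideal R) [hI : I.IsTwoSided] : Module Rᵐᵒᵖ I where
  smul b x := ⟨x * b.unop, hI.mul_mem_of_left _ x.2⟩
  one_smul _ := Subtype.ext (mul_one _)
  mul_smul _ _ _ := Subtype.ext (mul_assoc _ _ _).symm
  smul_zero _ := Subtype.ext (zero_mul _)
  smul_add _ _ _ := Subtype.ext (add_mul _ _ _)
  add_smul _ _ _ := Subtype.ext (mul_add _ _ _)
  zero_smul _ := Subtype.ext (mul_zero _)

instance (I : Ideal R) [I.IsTwoSided] : SMulCommClass R Rᵐᵒᵖ I where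
  smul_comm _ _ _ := Subtype.ext (mul_assoc _ _ _).symm

instance (I : Ideal R) [I.IsTwoSided] : SMulCommClass Rᵐᵒᵖ R I :=
  SMulCommClass.symm _ _ _

/-- A two-sided ideal, as a left ideal of the opposite ring. -/
def opIdeal (I : Ideal R) [hI : I.IsTwoSided] : Ideal Rᵐᵒᵖ where
  carrier := {x | x.unop ∈ I}
  add_mem' := I.add_mem
  zero_mem' := I.zero_mem
  smul_mem' b _ hx := hI.mul_mem_of_left b.unop hx

theorem mem_opIdeal {I : Ideal R} [I.IsTwoSided] {x : Rᵐᵒᵖ} : x ∈ opIdeal I ↔ x.unop ∈ I := Iff.rfl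

instance (I : Ideal R) [I.IsTwoSided] : (opIdeal I).IsTwoSided :=
  ⟨fun b hx => I.mul_mem_left b.unop hx⟩

/-- The reversal of factors is why rigidity on the right is proved by induction from the end of the
product. -/
theorem opIdeal_mul {I J T : Ideal R} [I.IsTwoSided] [J.IsTwoSided] [T.IsTwoSided]
    (h : T = I * J) : opIdeal T = opIdeal J * opIdeal I := by
  refine le_antisymm (fun x hx => ?_) (Ideal.mul_le.2 fun a ha b hb => ?_)
  · have hx' : x.unop ∈ I * J := h ▸ hx
    suffices ∀ y ∈ I * J, op y ∈ opIdeal J * opIdeal I from this _ hx'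
    intro y hy
    induction hy using Submodule.mul_induction_on' with
    | mem_mul_mem a ha b hb =>
      exact Ideal.mul_mem_mul (r := op b) (s := op a) hb ha
    | add a _ b _ ha hb => exact add_mem ha hb
  · rw [mem_opIdeal, h]
    exact Ideal.mul_mem_mul hb ha

/-- A two-sided ideal, viewed as a right module and as a left ideal of the opposite ring. -/
def opIdealEquiv (I : Ideal R) [I.IsTwoSided] : opIdeal I ≃ₗ[Rᵐᵒᵖ] I where
  toFun x := ⟨x.1.unop, x.2⟩
  invFun x := ⟨op x.1, x.2⟩
  map_add' _ _ := rfl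
  map_smul' _ _ := rfl
  left_inv _ := rfl
  right_inv _ := rfl

/-- The identification of a two-sided ideal with a submodule of the right module `R`. -/
def asRightEquiv (I : Ideal R) [hI : I.IsTwoSided] : I ≃ₗ[Rᵐᵒᵖ] asRight I hI where
  toFun x := ⟨x.1, x.2⟩
  invFun x := ⟨x.1, x.2⟩
  map_add' _ _ := rfl
  map_smul' _ _ := rfl
  left_inv _ := rfl
  right_inv _ := rfl

variable {K : Type v} [Field K] [Algebra K R]

theorem FinDim.quotient_opIdeal {I : Ideal R} [I.IsTwoSided] (h : FinDim K R (R ⧸ I)) :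
    FinDim K Rᵐᵒᵖ (Rᵐᵒᵖ ⧸ opIdeal I) := by
  rw [finDim_iff] at h ⊢
  have h1 : Module.Finite K (R ⧸ I.restrictScalars K) :=
    Module.Finite.equiv (Submodule.Quotient.restrictScalarsEquiv K I).symm
  have hle : I.restrictScalars K ≤ LinearMap.ker (((opIdeal I).restrictScalars K).mkQ ∘ₗ
      (MulOpposite.opLinearEquiv K : R ≃ₗ[K] Rᵐᵒᵖ).toLinearMap) := fun a ha =>
    (Submodule.Quotient.mk_eq_zero _).2 ha
  have h2 : Module.Finite K (Rᵐᵒᵖ ⧸ (opIdeal I).restrictScalars K) := by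
    refine Module.Finite.of_surjective (Submodule.liftQ _ _ hle) fun x => ?_
    obtain ⟨b, rfl⟩ := Submodule.Quotient.mk_surjective _ x
    exact ⟨Submodule.Quotient.mk b.unop, rfl⟩
  exact Module.Finite.equiv (Submodule.Quotient.restrictScalarsEquiv K (opIdeal I))

theorem isCofiniteRigid_opIdeal_annProd (h : HasCYDuality K R) (h' : HasCYDuality K Rᵐᵒᵖ)
    (l : List (ModuleCat.{u} R)) (hl : ∀ S ∈ l, IsFinDimRigidSimple K S) :
    IsCofiniteRigid K (opIdeal (annProd l)) := by
  -- In the opposite ring the last annihilator is the leftmost factor. Its idempotence there is the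
  -- one already known for left modules, so no dual simple module is needed.
  induction l using List.reverseRecOn with
  | nil =>
    have : opIdeal (annProd ([] : List (ModuleCat.{u} R))) = ⊤ :=
      eq_top_iff.2 fun _ _ => Submodule.mem_top (R := R)
    rw [this]
    exact IsCofiniteRigid.top
  | append_singleton l S ih =>
    have hS := hl S (by simp)
    rw [opIdeal_mul (annProd_append_singleton l S)]
    exact (ih fun S' hS' => hl S' (by simp [hS'])).mul h' inferInstance
      hS.finDim.quotient_annihilator.quotient_opIdeal
      (opIdeal_mul (h.annihilator_mul_self hS).symm).symm

theorem HasCYDuality.existsUnique_end_eq_mul (h : HasCYDuality K R) {I : Ideal R}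
    (hI : FinDim K R (R ⧸ I)) (φ : Module.End R I) : ∃! a : R, ∀ t : I, (φ t : R) = t * a :=
  h.exists_eq_mul hI (I.subtype ∘ₗ φ)

theorem HasCYDuality.existsUnique_end_eq_mul_left (h' : HasCYDuality K Rᵐᵒᵖ) {I : Ideal R}
    [I.IsTwoSided] (hI : FinDim K R (R ⧸ I)) (φ : Module.End Rᵐᵒᵖ I) :
    ∃! a : R, ∀ t : I, (φ t : R) = a * t := by
  obtain ⟨a, ha, ha'⟩ := h'.exists_eq_mul hI.quotient_opIdeal
    ((opIdeal I).subtype ∘ₗ (opIdealEquiv I).symm.toLinearMap ∘ₗ φ ∘ₗ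
      (opIdealEquiv I).toLinearMap)
  refine ⟨a.unop, fun t => congrArg unop (ha ((opIdealEquiv I).symm t)), fun b hb => ?_⟩
  exact congrArg unop (ha' (op b) fun t => congrArg op (hb (opIdealEquiv I t)))

theorem HasCYDuality.endEqSelf (h : HasCYDuality K R) (h' : HasCYDuality K Rᵐᵒᵖ) {I : Ideal R}
    [hI : I.IsTwoSided] (hF : FinDim K R (R ⧸ I)) : EndEqSelf I := by
  have b₁ : Function.Bijective (Module.toModuleEnd R (S := Rᵐᵒᵖ) I) := by
    refine ⟨fun a b hab => ?_, fun φ => ?_⟩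
    · have h1 (t : I) : a • t = b • t := LinearMap.congr_fun hab t
      exact MulOpposite.unop_injective ((h.existsUnique_end_eq_mul hF
        (Module.toModuleEnd R (S := Rᵐᵒᵖ) I a)).unique (fun t => rfl)
        fun t => congrArg Subtype.val (h1 t))
    · obtain ⟨a, ha, -⟩ := h.existsUnique_end_eq_mul hF φ
      exact ⟨op a, LinearMap.ext fun t => Subtype.ext (ha t).symm⟩
  have b₂ : Function.Bijective (Module.toModuleEnd Rᵐᵒᵖ (S := R) I) := by
    refine ⟨fun a b hab => ?_, fun φ => ?_⟩
    · have h1 (t : I) : a • t = b • t := LinearMap.congr_fun hab t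
      exact (h'.existsUnique_end_eq_mul_left hF
        (Module.toModuleEnd Rᵐᵒᵖ (S := R) I a)).unique (fun t => rfl)
        fun t => congrArg Subtype.val (h1 t)
    · obtain ⟨a, ha, -⟩ := h'.existsUnique_end_eq_mul_left hF φ
      exact ⟨a, LinearMap.ext fun t => Subtype.ext (ha t).symm⟩
  exact ⟨hI, ⟨RingEquiv.ofBijective _ b₁, fun a x => rfl⟩,
    ⟨(RingEquiv.ofBijective _ b₂).trans (asRightEquiv I).conjRingEquiv, fun a x => rfl⟩⟩

/-- Each side supplies the coresolution for the other: the right resolution gives the left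
coresolution and conversely. -/
theorem HasCYDuality.isTiltingIdeal (h : HasCYDuality K R) (h' : HasCYDuality K Rᵐᵒᵖ) {I : Ideal R}
    [hI : I.IsTwoSided] (hl : IsCofiniteRigid K I) (hr : IsCofiniteRigid K (opIdeal I)) :
    IsTiltingIdeal I := by
  have pl : IsPartialTilting R I := hl.isPartialTilting h
  have pr : IsPartialTilting Rᵐᵒᵖ I := (hr.isPartialTilting h').of_equiv (opIdealEquiv I)
  refine ⟨hI, ⟨pl, pr.exists_coresolution (fun a ha => ?_) fun φ => ?_⟩,
    IsTilting.of_equiv ⟨pr, pl.exists_coresolution (fun a ha => ?_) fun φ => ?_⟩ (asRightEquiv I)⟩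
  · exact (h'.existsUnique_end_eq_mul_left hl.finDim 0).unique
      (fun t => (congrArg Subtype.val (ha t)).symm) fun t => (zero_mul _).symm
  · obtain ⟨a, ha, -⟩ := h'.existsUnique_end_eq_mul_left hl.finDim φ
    exact ⟨a, fun t => Subtype.ext (ha t)⟩
  · exact MulOpposite.unop_injective ((h.existsUnique_end_eq_mul hl.finDim 0).unique
      (fun t => (congrArg Subtype.val (ha t)).symm) fun t => (mul_zero _).symm)
  · obtain ⟨a, ha, -⟩ := h.existsUnique_end_eq_mul hl.finDim φ
    exact ⟨op a, fun t => Subtype.ext (ha t)⟩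

end Opposite

/-! ### Factorisation of rigid left ideals -/

section Factorisation

open Abelian

variable {K : Type v} [Field K] {R : Type u} [Ring R] [Algebra K R]

/-- Ext²(R/T, T) is an image of Ext¹(T, T) = 0, and by duality its vanishing kills Hom(T, R/T). -/
theorem IsCofiniteRigid.hom_eq_zero (h : HasCYDuality K R) {T : Ideal R}
    (hT : IsCofiniteRigid K T) (f : T →ₗ[R] R ⧸ T) : f = 0 := by
  have hE := hT.ext_one
  have : Subsingleton (Ext (ModuleCat.of R (R ⧸ T)) (ModuleCat.of R T) 2) := by
    refine subsingleton_of_forall_eq 0 fun x => ?_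
    have := subsingleton_ext_of_projective R (ModuleCat.of R T) 2 two_pos
    obtain ⟨y, rfl⟩ := Ext.contravariant_sequence_exact₃ (shortExact_ideal T) _ x
      (Subsingleton.elim (α := Ext (ModuleCat.of R R) _ 2) _ _) (show 1 + 1 = 2 from rfl)
    rw [Subsingleton.elim (α := Ext (ModuleCat.of R T) (ModuleCat.of R T) 1) y 0, Ext.comp_zero]
  exact congrArg ModuleCat.Hom.hom (h.hom_eq_zero (ModuleCat.of R (R ⧸ T)) hT.finDim
    (ModuleCat.of R T) this (ModuleCat.ofHom f))

/-- The left ideal `{a | I a ⊆ T}`. -/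
def leftColon (I T : Ideal R) [hI : I.IsTwoSided] : Ideal R where
  carrier := {a | ∀ b ∈ I, b * a ∈ T}
  add_mem' hx hy b hb := by
    rw [mul_add]
    exact T.add_mem (hx b hb) (hy b hb)
  zero_mem' b _ := by
    rw [mul_zero]
    exact T.zero_mem
  smul_mem' c x hx b hb := by
    rw [smul_eq_mul, ← mul_assoc]
    exact hx _ (hI.mul_mem_of_left c hb)

theorem le_leftColon (I T : Ideal R) [I.IsTwoSided] : T ≤ leftColon I T :=
  fun _ ha b _ => T.mul_mem_left b ha

/-- Put V = T₁/T. From Hom(V, R/T₁) = 0 follow Ext¹(T₁, V) = 0 and Ext¹(V, T₁) = 0; together with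
Ext¹(T, T) = 0 they leave no room for Ext¹(T₁, T₁). -/
theorem HasCYDuality.isCofiniteRigid_leftColon (h : HasCYDuality K R) {I T : Ideal R} [I.IsTwoSided]
    (hII : I * I = I) (hT : IsCofiniteRigid K T) : IsCofiniteRigid K (leftColon I T) := by
  set T₁ := leftColon I T
  have hle : T ≤ T₁ := le_leftColon I T
  have hF : FinDim K R (R ⧸ T₁) := hT.finDim.of_surjective (Submodule.factor hle)
    (Submodule.factor_surjective hle)
  let V := ModuleCat.of R (T₁ ⧸ T.submoduleOf T₁)
  have hVF : FinDim K R V := by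
    refine hT.finDim.of_injective (Submodule.mapQ _ _ T₁.subtype le_rfl) ?_
    exact LinearMap.ker_eq_bot.1 (Submodule.ker_liftQ_eq_bot _ _ _ fun t ht =>
      (Submodule.Quotient.mk_eq_zero T).1 ht)
  have hV (a : R) (ha : a ∈ I) (v : T₁ ⧸ T.submoduleOf T₁) : a • v = 0 := by
    obtain ⟨t, rfl⟩ := (T.submoduleOf T₁).mkQ_surjective v
    rw [← map_smul]
    exact (Submodule.Quotient.mk_eq_zero _).2 (t.2 a ha)
  -- I kills V, while R/T₁ has no nonzero element killed by I: if Ib ⊆ T₁ then Ib = I²b ⊆ T.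
  have hom_zero (f : T₁ ⧸ T.submoduleOf T₁ →ₗ[R] R ⧸ T₁) : f = 0 := by
    refine LinearMap.ext fun v => ?_
    obtain ⟨b, hb⟩ := T₁.mkQ_surjective (f v)
    rw [LinearMap.zero_apply, ← hb]
    have hb1 : ∀ a ∈ I, a * b ∈ T₁ := fun a ha => by
      refine (Submodule.Quotient.mk_eq_zero T₁).1 ?_
      have : a • T₁.mkQ b = 0 := by rw [hb, ← map_smul, hV a ha, map_zero]
      exact this
    refine (Submodule.Quotient.mk_eq_zero T₁).2 fun a ha => ?_
    rw [← hII] at ha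
    induction ha using Submodule.mul_induction_on' with
    | mem_mul_mem a ha c hc =>
      rw [mul_assoc]
      exact hb1 c hc a ha
    | add x _ y _ hx hy =>
      rw [add_mul]
      exact T.add_mem hx hy
  have ext_T₁_V : Subsingleton (Ext (ModuleCat.of R T₁) V 1) := by
    refine subsingleton_of_forall_eq 0 fun x => ?_
    have : Subsingleton (Ext (shortComplexOf T₁.subtype T₁.mkQ
      (LinearMap.exact_subtype_mkQ T₁)).X₂ V 1) := subsingleton_ext_of_projective R V 1 one_pos
    refine extClass_comp_injective (shortExact_ideal T₁) (show 1 + 1 = 2 from rfl) ?_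
    -- Applied to the zero map V → V, through which all maps V → R/T₁ factor since they vanish, the
    -- injectivity statement says Ext²(R/T₁, V) = 0.
    refine h.ext_two_injective (ModuleCat.of R (R ⧸ T₁)) hF V V 0 (fun g => ⟨0, ?_⟩) _ ?_
    · rw [Limits.zero_comp]
      exact (ModuleCat.hom_ext (hom_zero g.hom)).symm
    · rw [Ext.mk₀_zero, Ext.comp_zero]
  have ext_V_T₁ : Subsingleton (Ext V (ModuleCat.of R T₁) 1) := by
    refine subsingleton_of_forall_eq 0 fun x => ?_
    have := h.ext_one_ring V hVF
    obtain ⟨y, rfl⟩ := Ext.covariant_sequence_exact₁ V (shortExact_ideal T₁) x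
      (Subsingleton.elim (α := Ext V (ModuleCat.of R R) 1) _ _) (zero_add 1)
    obtain ⟨g, rfl⟩ := (Ext.mk₀_bijective _ _).2 y
    have : g = 0 := ModuleCat.hom_ext (hom_zero g.hom)
    rw [this, Ext.mk₀_zero, Ext.zero_comp]
  refine ⟨hF, subsingleton_of_forall_eq 0 fun x => ?_⟩
  let S := shortExact_inclusion hle
  let ι : ModuleCat.of R T ⟶ ModuleCat.of R T₁ := ModuleCat.ofHom (Submodule.inclusion hle)
  let π : ModuleCat.of R T₁ ⟶ V := ModuleCat.ofHom (T.submoduleOf T₁).mkQ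
  have hE := hT.ext_one
  -- The restriction of x to T dies in Ext¹(T, V) since it passes through Ext¹(T₁, V) = 0, so it
  -- comes from Ext¹(T, T) = 0. Hence x itself comes from Ext¹(V, T₁) = 0.
  have h1 : ((Ext.mk₀ ι).comp x (zero_add 1)).comp (Ext.mk₀ π) (add_zero 1) = 0 := by
    rw [Ext.comp_assoc_of_third_deg_zero,
      Subsingleton.elim (α := Ext (ModuleCat.of R T₁) V 1) (x.comp (Ext.mk₀ π) _) 0, Ext.comp_zero]
  obtain ⟨y, hy⟩ := Ext.covariant_sequence_exact₂ _ S _ h1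
  rw [Subsingleton.elim (α := Ext (ModuleCat.of R T) (ModuleCat.of R T) 1) y 0,
    Ext.zero_comp] at hy
  obtain ⟨z, rfl⟩ := Ext.contravariant_sequence_exact₂ S _ x hy.symm
  rw [Subsingleton.elim (α := Ext V (ModuleCat.of R T₁) 1) z 0, Ext.comp_zero]

theorem InSerre.of_surjective {𝒮 : Set (ModuleCat.{u} R)} {M N : Type u} [AddCommGroup M]
    [Module R M] [AddCommGroup N] [Module R N] (h : InSerre K 𝒮 M) (f : M →ₗ[R] N)
    (hf : Function.Surjective f) : InSerre K 𝒮 N := by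
  refine ⟨h.1.of_surjective f hf, fun L L' hL => ?_⟩
  let φ : L'.comap f →ₗ[R] L' ⧸ L.submoduleOf L' :=
    (L.submoduleOf L').mkQ ∘ₗ f.restrict (p := L'.comap f) (q := L') fun _ hx => hx
  have hφ : Function.Surjective φ := by
    refine (Submodule.mkQ_surjective _).comp fun y => ?_
    obtain ⟨x, hx⟩ := hf y
    exact ⟨⟨x, by rw [Submodule.mem_comap, hx]; exact y.2⟩, Subtype.ext hx⟩
  have hker : LinearMap.ker φ = (L.comap f).submoduleOf (L'.comap f) := by
    ext x
    exact Submodule.Quotient.mk_eq_zero _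
  let e : (L'.comap f ⧸ (L.comap f).submoduleOf (L'.comap f)) ≃ₗ[R] (L' ⧸ L.submoduleOf L') :=
    (Submodule.quotEquivOfEq _ _ hker.symm).trans (φ.quotKerEquivOfSurjective hφ)
  have hs : IsSimpleModule R (L' ⧸ L.submoduleOf L') := (covBy_iff_quot_is_simple hL.le).1 hL
  have hc : L.comap f ⋖ L'.comap f :=
    (covBy_iff_quot_is_simple (Submodule.comap_mono hL.le)).2 (IsSimpleModule.congr e)
  obtain ⟨S, hS, ⟨e'⟩⟩ := h.2 _ _ hc
  exact ⟨S, hS, ⟨e.symm.trans e'⟩⟩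

theorem InSerre.exists_injective {𝒮 : Set (ModuleCat.{u} R)} {M : Type u} [AddCommGroup M]
    [Module R M] [Nontrivial M] (h : InSerre K 𝒮 M) :
    ∃ S ∈ 𝒮, ∃ f : S →ₗ[R] M, Function.Injective f := by
  have : IsArtinian R M := by
    let _ : Module K M := Module.compHom M (algebraMap K R)
    have := isScalarTower_compHom (K := K) (R := R) M
    have : Module.Finite K M := finDim_iff.1 h.1
    exact isArtinian_of_tower K inferInstance
  obtain ⟨N, hN, -⟩ := (eq_bot_or_exists_atom_le (⊤ : Submodule R M)).resolve_left top_ne_bot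
  obtain ⟨S, hS, ⟨e⟩⟩ := h.2 ⊥ N (bot_covBy_iff.2 hN)
  have hbot : (⊥ : Submodule R M).submoduleOf N = ⊥ := by
    simp [Submodule.submoduleOf]
  let e' : N ≃ₗ[R] S := (Submodule.quotEquivOfEqBot _ hbot).symm.trans e
  exact ⟨S, hS, N.subtype ∘ₗ e'.symm.toLinearMap, N.subtype_injective.comp e'.symm.injective⟩

theorem mem_annProducts_of_isCofiniteRigid (h : HasCYDuality K R) {𝒮 : Set (ModuleCat.{u} R)}
    (h𝒮 : ∀ S ∈ 𝒮, IsFinDimRigidSimple K S) (T : Ideal R) (hT : IsCofiniteRigid K T)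
    (hT' : InSerre K 𝒮 (R ⧸ T)) : T ∈ annProducts 𝒮 := by
  induction hn : Module.finrank K (R ⧸ T) using Nat.strong_induction_on generalizing T with
  | _ n ih =>
  subst hn
  by_cases htop : T = ⊤
  · exact ⟨[], by simp, htop.symm⟩
  have : Nontrivial (R ⧸ T) := Submodule.Quotient.nontrivial_iff.2 htop
  obtain ⟨S, hS, f, hf⟩ := hT'.exists_injective
  have hS' := h𝒮 S hS
  have := hS'.simple
  have := h.finite_ideal hT.finDim
  let I := Module.annihilator R S
  let T₁ := leftColon I T
  have hle : T ≤ T₁ := le_leftColon I T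
  -- A map T → S followed by the embedding S → R/T is zero by duality, so T has no nonzero map to S.
  have hfac : T = I * T₁ := by
    refine hS'.finDim.eq_mul_of_forall_hom_eq_zero
      (Ideal.mul_le.2 fun a ha b hb => hb a ha)
      (fun t ht a ha => Ideal.mul_mem_mul ha (hle ht)) fun g _ => ?_
    have h0 := hT.hom_eq_zero h (f ∘ₗ g)
    ext t
    exact hf ((LinearMap.congr_fun h0 t).trans (map_zero f).symm)
  have hT₁ := h.isCofiniteRigid_leftColon (I := I) (h.annihilator_mul_self hS') hT
  -- Representatives in R of elements of the embedded copy of S lie in T₁, because I kills S; those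
  -- of nonzero elements are not in T.
  have hne : ¬ T₁ ≤ T := by
    intro hle'
    have := IsSimpleModule.nontrivial R S
    obtain ⟨s, hs⟩ := exists_ne (0 : S)
    obtain ⟨a, ha⟩ := T.mkQ_surjective (f s)
    have ha' : a ∈ T₁ := fun b hb => by
      refine (Submodule.Quotient.mk_eq_zero T).1 ?_
      have : b • T.mkQ a = 0 := by
        rw [ha, ← map_smul, Module.mem_annihilator.1 hb, map_zero]
      exact this
    refine hs (hf ?_)
    rw [map_zero, ← ha]
    exact (Submodule.Quotient.mk_eq_zero T).2 (hle' ha')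
  have hlt : Module.finrank K (R ⧸ T₁) < Module.finrank K (R ⧸ T) := by
    have : Module.Finite K (R ⧸ T) := finDim_iff.1 hT.finDim
    let q := (Submodule.factor hle).restrictScalars K
    have hq : Function.Surjective q := Submodule.factor_surjective hle
    have hrank := LinearMap.finrank_range_add_finrank_ker q
    rw [LinearMap.range_eq_top.2 hq, finrank_top] at hrank
    have hker : LinearMap.ker q ≠ ⊥ := fun hbot => hne fun a ha => by
      have : (Submodule.Quotient.mk a : R ⧸ T) ∈ LinearMap.ker q :=
        (Submodule.Quotient.mk_eq_zero T₁).2 ha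
      rw [hbot, Submodule.mem_bot] at this
      exact (Submodule.Quotient.mk_eq_zero T).1 this
    have := Submodule.one_le_finrank_iff.2 hker
    omega
  obtain ⟨l, hl, hl'⟩ := ih _ hlt T₁ hT₁
    (hT'.of_surjective (Submodule.factor hle) (Submodule.factor_surjective hle)) rfl
  refine ⟨S :: l, fun S' hS' => ?_, ?_⟩
  · rcases List.mem_cons.1 hS' with rfl | h'
    · exact hS
    · exact hl S' h'
  · rw [annProd_cons, hl', hfac]

end Factorisation

end CYTilting

end

theorem theorem1p6 {K : Type v} [Field K] {A : Type u} [Ring A] [Algebra K A]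
    (hA : CYTilting.IsCalabiYau K A 2)
    (𝒮 : Set (ModuleCat.{u} A)) (h𝒮 : ∀ S ∈ 𝒮, CYTilting.IsFinDimRigidSimple K S) :
    (∀ I ∈ CYTilting.annProducts 𝒮,
      CYTilting.IsTiltingIdeal I ∧ CYTilting.InSerre K 𝒮 (A ⧸ I) ∧ CYTilting.EndEqSelf I) ∧
    (∀ I : Ideal A, CYTilting.IsPartialTilting A I → CYTilting.InSerre K 𝒮 (A ⧸ I) →
      I ∈ CYTilting.annProducts 𝒮) ∧
    (∀ I ∈ CYTilting.annProducts 𝒮, ∀ I' ∈ CYTilting.annProducts 𝒮,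
      Nonempty (I ≃ₗ[A] I') → I = I') := by
  obtain ⟨h, h'⟩ := hA.hasCYDuality
  refine ⟨?_, fun I hI hI' => ?_, ?_⟩
  · rintro _ ⟨l, hl, rfl⟩
    have hl' : ∀ S ∈ l, CYTilting.IsFinDimRigidSimple K S := fun S hS => h𝒮 S (hl S hS)
    have hr := CYTilting.isCofiniteRigid_annProd h l hl'
    exact ⟨h.isTiltingIdeal h' hr (CYTilting.isCofiniteRigid_opIdeal_annProd h h' l hl'),
      CYTilting.inSerre_annProd h h𝒮 l hl, h.endEqSelf h' hr.finDim⟩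
  · exact CYTilting.mem_annProducts_of_isCofiniteRigid h h𝒮 I
      ⟨hI'.1, hI.ext_eq_zero 1 one_pos⟩ hI'
  · rintro _ ⟨l, hl, rfl⟩ _ ⟨l', hl', rfl⟩ ⟨e⟩
    exact h.eq_of_equiv inferInstance inferInstance
      (CYTilting.inSerre_annProd h h𝒮 l hl).1 (CYTilting.inSerre_annProd h h𝒮 l' hl').1 e
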